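/- **Setup.** Let $n\ge 1$, $[n]=\{1,\dots,n\}$, $G=\mathrm{GL}_n(\mathbb C)$, $B\subset G$ the upper triangular Borel subgroup, and $\mathrm{Fl}_n=G/B$ the flag variety. For $x,y\in[n]$ let $[x,y)_c=\{x,\dots,y-1\}$ if $x\le y$ and $[x,y)_c=\{x,\dots,n\}\cup\{1,\dots,y-1\}$ if $x>y$. For $r\in[n]$ let $<_r$ be the total order $r<_r r+1<_r\cdots<_r n<_r1<_r\cdots<_r r-1$, and for $k$-subsets $A,A'$ of $[n]$ write $A\le_r A'$ if the elements of $A$ and $A'$, sorted by $<_r$, satisfy the entrywise inequalities. For $w\in S_n$ put $w_k=w(k)$ and $w[k]=\{w_1,\dots,w_k\}$; products of permutations are compositions and $s_i=(i\ i{+}1)$. For $\mathbf a=(a_1,\dots,a_n)\in[n]^n$ (with $a_{n+1}:=1$) and $u,v\in S_n$ write $u\le_{\mathbf a}v$ if $u[k]\le_{a_k}v[k]$ for all $k$; $u\sim_{\mathbf a}v$ if $|u[k]\cap[a_k,a_{k+1})_c|=|v[k]\cap[a_k,a_{k+1})_c|$ for all $k$; and $u\lesssim_{\mathbf a}v$ if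 both hold. Let $\mathrm{Jump}_{\mathbf a}=\{k\in[n]:a_k\ne a_{k+1}\}$. If it is nonempty, let $q=q(\mathbf a)$ be its minimum; $\mathrm{flat}(\mathbf a)$ is obtained from $\mathbf a$ by replacing $a_1,\dots,a_q$ by $a_{q+1}$; and $w\in S_n$ is *$\mathbf a$-flattenable* if for some $0\le p\le q$ we have $w_i\in[a_1,a_{q+1})_c$ for $i\le p$ and $w_i\in[a_{q+1},a_1)_c$ for $p<i\le q$. *Words.* If $\mathrm{Jump}_{\mathbf a}=\emptyset$, an $\mathbf a$-tilted word is a finite sequence of simple transpositions. Otherwise it is a sequence $\mathbf w'\,|\,\mathbf t$ where $\mathbf w'$ is a $\mathrm{flat}(\mathbf a)$-tilted word whose product is $\mathbf a$-flattenable, and $\mathbf t$ is a sequence of simple transpositions $s_i$ with $i\notin\mathrm{Jump}_{\mathbf a}$. It is a word for its product (bars counting as the identity), its length is its number of factors (bars included), and it is *reduced* if it has minimal length among the $\mathbf a$-tilted words for the same permutation. Let $\mathbf v$ be an $\mathbf a$-tilted reduced word for $v$, of length $\ell$. Let $J^s$ be the set of $j\in[\ell]$ for which the $j$-th factor is a simple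 transposition, denoted $s_{i_j}$. Put $\mathbf a^{(\ell)}=\mathbf a$, and $\mathbf a^{(j-1)}=\mathbf a^{(j)}$ if $j\in J^s$, $\mathbf a^{(j-1)}=\mathrm{flat}(\mathbf a^{(j)})$ if the $j$-th factor is a bar. Let $v^{(j)}$ be the product of the first $j$ factors of $\mathbf v$. The word $\mathbf v$ is *regular* if for every bar, at position $j$ say, with $q=q(\mathbf a^{(j)})$ and $p=|v[q]\cap[a^{(j)}_1,a^{(j)}_{q+1})_c|$, the bar is immediately preceded by consecutive factors that are simple transpositions and form a (classical) reduced word (possibly empty) for the permutation with one-line notation $q{-}p{+}1,\dots,q,1,\dots,q{-}p,q{+}1,\dots,n$. A *subword* $\mathbf u$ of $\mathbf v$ corresponding to $u$ is obtained by replacing some of the simple transpositions in $\mathbf v$ by $1$, such that omitting the $1$'s gives an $\mathbf a$-tilted word, the product is $u$, and $u\sim_{\mathbf a}v$. Subwords with different sets of replaced positions count as different. Let $u^{(j)}$ be the product of the first $j$ factors of $\mathbf u$. The subword is *(tilted) distinguished*, written $\mathbf u\prec\mathbf v$, if $u^{(j)}\le_{\mathbf a^{(j)}}u^{(j-1)}s_{i_j}$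 for all $j\in J^s$; then $J^+_{\mathbf u}$, $J^\circ_{\mathbf u}$, $J^-_{\mathbf u}$ are the sets of $j\in J^s$ with $u^{(j-1)}<_{\mathbf a^{(j)}}u^{(j)}$, $u^{(j-1)}=u^{(j)}$, $u^{(j-1)}>_{\mathbf a^{(j)}}u^{(j)}$, respectively. *Varieties.* $\mathcal T^\circ_{u,v}\subset\mathrm{Fl}_n$ is the set of flags $gB$ such that for all $i,k\in[n]$ the submatrix of $g$ with columns $1,\dots,k$ and rows $[a_k,i)_c$ has rank $|u[k]\cap[a_k,i)_c|$, and the one with columns $1,\dots,k$ and rows $[i,a_k)_c$ has rank $|v[k]\cap[i,a_k)_c|$; here $\mathbf a$ is any sequence with $u\le_{\mathbf a}v$ (the set does not depend on it). For $w\in S_n$, let $X^\circ_{w,\mathbf a}$ (resp. $\Omega^\circ_{w,\mathbf a}$) be the set of flags $gB$ such that for all $k$ the minor of $g$ with rows $w[k]$ and columns $1,\dots,k$ is nonzero, and the minor with rows $w[k-1]\cup\{w_i\}$ and columns $1,\dots,k$ vanishes whenever $i>k$ and $w_i>_{a_k}w_k$ (resp. $w_i<_{a_k}w_k$). For a distinguished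 subword $\mathbf u\prec\mathbf v$ corresponding to $u$, the *tilted Deodhar cell* $\mathcal D_{\mathbf u,\mathbf v}$ is the set of $gB\in\mathcal T^\circ_{u,v}$ for which there are flags $g_0B=B,\ g_1B,\dots,g_\ell B=gB$ with $g_jB\in X^\circ_{v^{(j)},\mathbf a^{(j)}}\cap\Omega^\circ_{u^{(j)},\mathbf a^{(j)}}$ for $0\le j\le\ell$, with $g_{j-1}^{-1}g_j\in Bs_{i_j}B$ if $j\in J^s$, and with $g_{j-1}B=g_jB$ if the $j$-th factor is a bar. For $i\in[n-1]$ let $\phi_i(A)$ be the identity matrix with the block in rows and columns $i,i+1$ replaced by the $2\times2$ matrix $A$, and put $y_i(p)=\phi_i\left(\begin{smallmatrix}1&0\\p&1\end{smallmatrix}\right)$, $\dot s_i=\phi_i\left(\begin{smallmatrix}0&-1\\1&0\end{smallmatrix}\right)$, $x_i(m)=\phi_i\left(\begin{smallmatrix}1&m\\0&1\end{smallmatrix}\right)$. **Theorem (tilted Deodhar decomposition).** Suppose $u\lesssim_{\mathbf a}v$ and let $\mathbf v$ be a regular $\mathbf a$-tilted reduced word for $v$. Then $\mathcal T^\circ_{u,v}$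 is the disjoint union $$\mathcal T^\circ_{u,v}=\bigsqcup_{\mathbf u\prec\mathbf v}\mathcal D_{\mathbf u,\mathbf v}$$ over the distinguished subwords $\mathbf u\prec\mathbf v$ corresponding to $u$. For each of them there is an isomorphism of varieties $$(\mathbb C^*)^{|J^\circ_{\mathbf u}|}\times\mathbb C^{|J^-_{\mathbf u}|}\ \xrightarrow{\ \sim\ }\ \mathcal D_{\mathbf u,\mathbf v},\qquad \bigl((p_j)_{j\in J^\circ_{\mathbf u}},(m_j)_{j\in J^-_{\mathbf u}}\bigr)\mapsto g_1g_2\cdots g_\ell B,$$ where $g_j=\dot s_{i_j}$ if $j\in J^+_{\mathbf u}$, $g_j=y_{i_j}(p_j)$ if $j\in J^\circ_{\mathbf u}$, $g_j=x_{i_j}(m_j)\dot s_{i_j}^{-1}$ if $j\in J^-_{\mathbf u}$, and $g_j=1$ if the $j$-th factor of $\mathbf v$ is a bar. -/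

import Mathlib

/-!
Conventions.  The set `[n] = {1, …, n}` is modelled by `Fin n = {0, …, n-1}`, so that the position
or value `k + 1` of the text is the element `k` here.  Permutations are elements of
`Equiv.Perm (Fin n)`, a product `u * w` is the composition `u ∘ w`, and the one-line notation of
`w` is `w 0, w 1, …`; thus right multiplication by `s_i` exchanges the entries in positions
`i, i+1`.
-/

namespace TiltedDeodhar

open scoped Topology

/-! ### Combinatorics of tilted Bruhat orders -/

/-- The cyclic interval `[a, b)_c`. -/
def cyclicIco {n : ℕ} (a b : Fin n) : Finset (Fin n) :=
  if a ≤ b then Finset.Ico a b else Finset.Ici a ∪ Finset.Iio b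

/-- The strict shifted linear order `i <_r j`, where `r <_r r+1 <_r ⋯ <_r n <_r 1 <_r ⋯ <_r r-1`
(subtraction in `Fin n` is modulo `n`). -/
def ShiftedLT {n : ℕ} (r i j : Fin n) : Prop := i - r < j - r

/-- The elements of `A`, listed increasingly in the shifted order `≤_r`, each `x` being recorded
by its rank `x - r` (modulo `n`) in that order. -/
def shiftedSort {n : ℕ} (r : Fin n) (A : Finset (Fin n)) : List (Fin n) :=
  (A.image fun x => x - r).sort (· ≤ ·)

/-- The shifted Gale order `A ≤_r B`: entrywise comparison of the `≤_r`-sorted lists. -/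
def GaleLE {n : ℕ} (r : Fin n) (A B : Finset (Fin n)) : Prop :=
  List.Forall₂ (· ≤ ·) (shiftedSort r A) (shiftedSort r B)

/-- The set `w[k]` of the entries of `w` in the positions up to and including `k`. -/
def initialSet {n : ℕ} (w : Equiv.Perm (Fin n)) (k : Fin n) : Finset (Fin n) :=
  (Finset.Iic k).image w

/-- The entry of `a` following the one at position `k`, with `a_{n+1} := 1`. -/
def nextEntry {n : ℕ} [NeZero n] (a : Fin n → Fin n) (k : Fin n) : Fin n :=
  if h : k.val + 1 < n then a ⟨k.val + 1, h⟩ else 0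

/-- The `a`-tilted Bruhat order `u ≤_a v`. -/
def TiltedLE {n : ℕ} (a : Fin n → Fin n) (u v : Equiv.Perm (Fin n)) : Prop :=
  ∀ k, GaleLE (a k) (initialSet u k) (initialSet v k)

/-- The strict `a`-tilted Bruhat order `u <_a v`. -/
def TiltedLT {n : ℕ} (a : Fin n → Fin n) (u v : Equiv.Perm (Fin n)) : Prop :=
  TiltedLE a u v ∧ u ≠ v

/-- The equivalence relation `u ∼_a v`. -/
def TiltedSim {n : ℕ} [NeZero n] (a : Fin n → Fin n) (u v : Equiv.Perm (Fin n)) : Prop :=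
  ∀ k, (initialSet u k ∩ cyclicIco (a k) (nextEntry a k)).card =
    (initialSet v k ∩ cyclicIco (a k) (nextEntry a k)).card

/-- The order `u ≲_a v`. -/
def TiltedLesssim {n : ℕ} [NeZero n] (a : Fin n → Fin n) (u v : Equiv.Perm (Fin n)) : Prop :=
  TiltedLE a u v ∧ TiltedSim a u v

/-- The set of jumps of `a`. -/
def jumps {n : ℕ} [NeZero n] (a : Fin n → Fin n) : Finset (Fin n) :=
  Finset.univ.filter fun k => a k ≠ nextEntry a k

/-- The minimum jump of `a` (only meaningful if `a` has a jump). -/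
def minJump {n : ℕ} [NeZero n] (a : Fin n → Fin n) : Fin n :=
  if h : (jumps a).Nonempty then (jumps a).min' h else 0

/-- The flattening of `a`: the entries up to the minimum jump are replaced by the entry following
it. (If there is no jump, `a = (1, …, 1)`, and `a` is left unchanged.) -/
def flatten {n : ℕ} [NeZero n] (a : Fin n → Fin n) : Fin n → Fin n :=
  fun j => if j ≤ minJump a then nextEntry a (minJump a) else a j

/-- `w` is `a`-flattenable (for `a` with at least one jump). -/
def Flattenable {n : ℕ} [NeZero n] (a : Fin n → Fin n) (w : Equiv.Perm (Fin n)) : Prop :=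
  ∃ p : ℕ, p ≤ (minJump a).val + 1 ∧ ∀ i : Fin n, i ≤ minJump a →
    (i.val < p → w i ∈ cyclicIco (a 0) (nextEntry a (minJump a))) ∧
    (p ≤ i.val → w i ∈ cyclicIco (nextEntry a (minJump a)) (a 0))

/-! ### Words -/

/-- The position `i`. -/
def lo {n : ℕ} (i : Fin (n - 1)) : Fin n := ⟨i.val, by omega⟩

/-- The position `i + 1`. -/
def hi {n : ℕ} (i : Fin (n - 1)) : Fin n := ⟨i.val + 1, by omega⟩

/-- A factor of a word: a simple transposition `s_i`, a bar, or (in subwords) the identity `1`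
that replaces a simple transposition. -/
inductive Factor (n : ℕ) : Type
  | s (i : Fin (n - 1))
  | bar
  | one
  deriving DecidableEq

/-- The permutation a factor contributes to the product. -/
def Factor.perm {n : ℕ} : Factor n → Equiv.Perm (Fin n)
  | .s i => Equiv.swap (lo i) (hi i)
  | .bar => 1
  | .one => 1

/-- The product of a word. -/
def wordProd {n : ℕ} (w : List (Factor n)) : Equiv.Perm (Fin n) := (w.map Factor.perm).prod

/-- A word consisting of simple transpositions only. -/
def plainWord {n : ℕ} (w : List (Fin (n - 1))) : List (Factor n) := w.map Factor.s

/-- A plain word is reduced if it is shortest among the plain words with the same product. -/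
def IsReducedPlainWord {n : ℕ} (w : List (Fin (n - 1))) : Prop :=
  ∀ w' : List (Fin (n - 1)), wordProd (plainWord w') = wordProd (plainWord w) →
    w.length ≤ w'.length

/-- `a`-tilted words (for their product). -/
inductive IsTiltedWord {n : ℕ} [NeZero n] : (Fin n → Fin n) → List (Factor n) → Prop
  | base (a : Fin n → Fin n) (ha : jumps a = ∅) (w : List (Fin (n - 1))) :
      IsTiltedWord a (plainWord w)
  | step (a : Fin n → Fin n) (ha : jumps a ≠ ∅) (w : List (Factor n))
      (hw : IsTiltedWord (flatten a) w) (hflat : Flattenable a (wordProd w))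
      (t : List (Fin (n - 1))) (ht : ∀ i ∈ t, lo i ∉ jumps a) :
      IsTiltedWord a (w ++ Factor.bar :: plainWord t)

/-- `w` is an `a`-tilted reduced word for the permutation `x`. -/
def IsTiltedReducedWord {n : ℕ} [NeZero n] (a : Fin n → Fin n) (x : Equiv.Perm (Fin n))
    (w : List (Factor n)) : Prop :=
  (IsTiltedWord a w ∧ wordProd w = x) ∧
    ∀ w' : List (Factor n), IsTiltedWord a w' → wordProd w' = x → w.length ≤ w'.length

/-- `U` is a subword of the `a`-tilted word `V` corresponding to `u`. Subwords have the same
length as `V`, the omitted simple transpositions being replaced by `1`; so different choices of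
omitted positions give different subwords. -/
def IsSubword {n : ℕ} [NeZero n] (a : Fin n → Fin n) (V U : List (Factor n))
    (u : Equiv.Perm (Fin n)) : Prop :=
  List.Forall₂ (fun x y : Factor n => x = y ∨ (x = Factor.one ∧ ∃ i, y = Factor.s i)) U V ∧
    IsTiltedWord a (U.filter fun x => x ≠ Factor.one) ∧
    wordProd U = u ∧ TiltedSim a u (wordProd V)

/-- The product `w^{(j)}` of the first `j` factors of `w`. -/
def prefixProd {n : ℕ} (w : List (Factor n)) (j : ℕ) : Equiv.Perm (Fin n) := wordProd (w.take j)

/-- The sequence `a^{(j)}`: starting from `a^{(ℓ)} = a`, one flattens once for every bar among the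
factors number `j+1, …, ℓ` of `V`. -/
def seqAt {n : ℕ} [NeZero n] (a : Fin n → Fin n) (V : List (Factor n)) (j : ℕ) : Fin n → Fin n :=
  flatten^[(V.drop j).count Factor.bar] a

/-- `U ≺ V`: `U` is a distinguished subword of `V` corresponding to `u`. The factor number `j + 1`
of `V` is `V[j]`. -/
def IsDistinguished {n : ℕ} [NeZero n] (a : Fin n → Fin n) (V U : List (Factor n))
    (u : Equiv.Perm (Fin n)) : Prop :=
  IsSubword a V U u ∧ ∀ (j : Fin V.length) (i : Fin (n - 1)), V[j] = Factor.s i →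
    TiltedLE (seqAt a V (j + 1)) (prefixProd U (j + 1))
      (prefixProd U j * Equiv.swap (lo i) (hi i))

/-- The index set `J⁺`. -/
def JPlus {n : ℕ} [NeZero n] (a : Fin n → Fin n) (V U : List (Factor n)) : Set (Fin V.length) :=
  {j | (∃ i, V[j] = Factor.s i) ∧
    TiltedLT (seqAt a V (j + 1)) (prefixProd U j) (prefixProd U (j + 1))}

/-- The index set `J°`. -/
def JZero {n : ℕ} (V U : List (Factor n)) : Set (Fin V.length) :=
  {j | (∃ i, V[j] = Factor.s i) ∧ prefixProd U j = prefixProd U (j + 1)}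

/-- The index set `J⁻`. -/
def JMinus {n : ℕ} [NeZero n] (a : Fin n → Fin n) (V U : List (Factor n)) : Set (Fin V.length) :=
  {j | (∃ i, V[j] = Factor.s i) ∧
    TiltedLT (seqAt a V (j + 1)) (prefixProd U (j + 1)) (prefixProd U j)}

/-- `x` is the bi-Grassmannian permutation `s_{a,b}`, with one-line notation
`a+1, …, a+b, 1, …, a, a+b+1, …, n`. -/
def IsBiGrassmannian {n : ℕ} (a b : ℕ) (x : Equiv.Perm (Fin n)) : Prop :=
  ∀ i : Fin n, (x i).val =
    if i.val < b then i.val + a else if i.val < a + b then i.val - b else i.val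

/-- Regularity of an `a`-tilted word `V` for `v`: every bar is immediately preceded by a reduced
word (of simple transpositions) for `s_{q-p,p}`. For the bar at position `j`, `q` is the minimum
jump of `a^{(j)}` and `p` is the number of elements of `v[q] ∩ [a^{(j)}_1, a^{(j)}_{q+1})_c`. -/
def IsRegularWord {n : ℕ} [NeZero n] (a : Fin n → Fin n) (v : Equiv.Perm (Fin n))
    (V : List (Factor n)) : Prop :=
  ∀ j : Fin V.length, V[j] = Factor.bar →
    let b := seqAt a V (j + 1)
    let q := minJump b
    let p := (initialSet v q ∩ cyclicIco (b 0) (nextEntry b q)).card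
    ∃ (k : ℕ) (t : List (Fin (n - 1))), k ≤ j ∧ (V.take j).drop k = plainWord t ∧
      IsReducedPlainWord t ∧ IsBiGrassmannian (q.val + 1 - p) p (wordProd (plainWord t))

/-! ### Flags -/

/-- The Borel subgroup of upper triangular matrices. -/
def borel (n : ℕ) : Subgroup (GL (Fin n) ℂ) where
  carrier := {g | (g : Matrix (Fin n) (Fin n) ℂ).BlockTriangular id}
  one_mem' := by
    simpa using Matrix.blockTriangular_one (R := ℂ) (m := Fin n) (b := id)
  mul_mem' := by
    intro g h hg hh
    simpa using Matrix.BlockTriangular.mul hg hh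
  inv_mem' := by
    intro g hg
    have : Invertible (g : Matrix (Fin n) (Fin n) ℂ) := g.invertible
    have h : (g : Matrix (Fin n) (Fin n) ℂ).BlockTriangular id := hg
    simpa using Matrix.blockTriangular_inv_of_blockTriangular h

/-- The complete flag variety `G/B`. The coset `gB` is the flag whose `k`-th subspace is spanned by
the first `k` columns of `g`. -/
abbrev Flag (n : ℕ) : Type := GL (Fin n) ℂ ⧸ borel n

/-- The flag `gB`. -/
def toFlag {n : ℕ} (g : GL (Fin n) ℂ) : Flag n := QuotientGroup.mk g

/-- The rank of the submatrix of `g` with rows in `S` and columns up to and including `k`. -/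
noncomputable def rankOn {n : ℕ} (g : GL (Fin n) ℂ) (S : Finset (Fin n)) (k : Fin n) : ℕ :=
  ((g : Matrix (Fin n) (Fin n) ℂ).submatrix (fun i : {i // i ∈ S} => i.val)
    (fun j : {j : Fin n // j ≤ k} => j.val)).rank

/-- The open tilted Richardson variety `T°_{u,v,a}`, by rank conditions. -/
def openTiltedRichardsonAt {n : ℕ} (u v : Equiv.Perm (Fin n)) (a : Fin n → Fin n) :
    Set (Flag n) :=
  {F | ∃ g, toFlag g = F ∧ ∀ i k : Fin n,
    rankOn g (cyclicIco (a k) i) k = (initialSet u k ∩ cyclicIco (a k) i).card ∧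
    rankOn g (cyclicIco i (a k)) k = (initialSet v k ∩ cyclicIco i (a k)).card}

/-- The open tilted Richardson variety `T°_{u,v}`: it is `T°_{u,v,a}` for any `a` with `u ≤_a v`
(such `a` exist, and the choice does not matter). -/
def openTiltedRichardson {n : ℕ} (u v : Equiv.Perm (Fin n)) : Set (Flag n) :=
  {F | ∃ a, TiltedLE a u v ∧ F ∈ openTiltedRichardsonAt u v a}

/-- The minor of `g` with the rows `r 0, …, r k` (in that order) and the columns `0, …, k`. -/
noncomputable def flagMinor {n : ℕ} (g : GL (Fin n) ℂ) (k : Fin n) (r : Fin n → Fin n) : ℂ :=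
  ((g : Matrix (Fin n) (Fin n) ℂ).submatrix (fun j : {j : Fin n // j ≤ k} => r j.val)
    (fun j : {j : Fin n // j ≤ k} => j.val)).det

/-- The tilted Schubert cell `X°_{w,a}`: `Δ_w ≠ 0`, and `Δ_{w[k-1] ∪ {w_i}} = 0` for all `k < i`
with `w_i >_{a_k} w_k`. -/
def tiltedSchubertCell {n : ℕ} (w : Equiv.Perm (Fin n)) (a : Fin n → Fin n) : Set (Flag n) :=
  {F | ∃ g, toFlag g = F ∧ (∏ k, flagMinor g k w) ≠ 0 ∧
    ∀ i k : Fin n, k < i → ShiftedLT (a k) (w k) (w i) →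
      flagMinor g k (Function.update w k (w i)) = 0}

/-- The opposite tilted Schubert cell `Ω°_{w,a}`: `Δ_w ≠ 0`, and `Δ_{w[k-1] ∪ {w_i}} = 0` for all
`k < i` with `w_i <_{a_k} w_k`. -/
def oppositeTiltedSchubertCell {n : ℕ} (w : Equiv.Perm (Fin n)) (a : Fin n → Fin n) :
    Set (Flag n) :=
  {F | ∃ g, toFlag g = F ∧ (∏ k, flagMinor g k w) ≠ 0 ∧
    ∀ i k : Fin n, k < i → ShiftedLT (a k) (w i) (w k) →
      flagMinor g k (Function.update w k (w i)) = 0}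

/-- The permutation matrix of `w`, with a `1` in each position `(w_k, k)`. -/
def permMat {n : ℕ} (w : Equiv.Perm (Fin n)) : Matrix (Fin n) (Fin n) ℂ :=
  Matrix.of fun i k => if i = w k then 1 else 0

/-- The flags `F₁ = g₁B`, `F₂ = g₂B` are in relative position `w`, that is,
`g₁⁻¹ g₂ ∈ B w B`. -/
def RelPos {n : ℕ} (w : Equiv.Perm (Fin n)) (F₁ F₂ : Flag n) : Prop :=
  ∃ g₁ g₂ : GL (Fin n) ℂ, toFlag g₁ = F₁ ∧ toFlag g₂ = F₂ ∧
    ∃ b ∈ borel n, ∃ b' ∈ borel n, ((g₁⁻¹ * g₂ : GL (Fin n) ℂ) : Matrix (Fin n) (Fin n) ℂ) =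
      (b : Matrix (Fin n) (Fin n) ℂ) * permMat w * (b' : Matrix (Fin n) (Fin n) ℂ)

/-- Two consecutive flags of the chain defining a Deodhar cell: in relative position `s_i` at a
factor `s_i`, equal at a bar. -/
def StepRel {n : ℕ} : Factor n → Flag n → Flag n → Prop
  | .s i, F₁, F₂ => RelPos (Equiv.swap (lo i) (hi i)) F₁ F₂
  | .bar, F₁, F₂ => F₁ = F₂
  | .one, F₁, F₂ => F₁ = F₂

/-- The tilted Deodhar cell `D_{U,V}` (with `u`, `v` the products of `U`, `V`): the flags
`F ∈ T°_{u,v}` for which there is a chain `B = y₀, y₁, …, y_ℓ = F` with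
`y_j ∈ X°_{v^{(j)}, a^{(j)}} ∩ Ω°_{u^{(j)}, a^{(j)}}` for all `j`, consecutive flags being related
as prescribed by the factors of `V`. -/
def deodharCell {n : ℕ} [NeZero n] (a : Fin n → Fin n) (V U : List (Factor n)) : Set (Flag n) :=
  {F | F ∈ openTiltedRichardson (wordProd U) (wordProd V) ∧
    ∃ y : Fin (V.length + 1) → Flag n, y 0 = toFlag 1 ∧ y (Fin.last V.length) = F ∧
      (∀ j : Fin (V.length + 1), y j ∈ tiltedSchubertCell (prefixProd V j) (seqAt a V j) ∧
        y j ∈ oppositeTiltedSchubertCell (prefixProd U j) (seqAt a V j)) ∧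
      ∀ j : Fin V.length, StepRel V[j] (y j.castSucc) (y j.succ)}

/-! ### The parametrization -/

/-- The identity matrix with its block in rows and columns `i, i+1` replaced by `A`. -/
def phi {n : ℕ} (i : Fin (n - 1)) (A : Matrix (Fin 2) (Fin 2) ℂ) : Matrix (Fin n) (Fin n) ℂ :=
  Matrix.of fun r c =>
    if r = lo i ∧ c = lo i then A 0 0
    else if r = lo i ∧ c = hi i then A 0 1
    else if r = hi i ∧ c = lo i then A 1 0
    else if r = hi i ∧ c = hi i then A 1 1
    else if r = c then 1 else 0

theorem lo_ne_hi {n : ℕ} (i : Fin (n - 1)) : lo i ≠ hi i := by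
  intro h
  have := congrArg Fin.val h
  simp [lo, hi] at this

theorem phi_one {n : ℕ} (i : Fin (n - 1)) : phi i 1 = 1 := by
  have h := lo_ne_hi i
  ext r c
  simp only [phi, Matrix.of_apply, Matrix.one_apply]
  by_cases h1 : r = lo i <;> by_cases h2 : r = hi i <;> by_cases h3 : c = lo i <;>
    by_cases h4 : c = hi i <;> simp_all [eq_comm]

theorem phi_mul {n : ℕ} (i : Fin (n - 1)) (A A' : Matrix (Fin 2) (Fin 2) ℂ) :
    phi i (A * A') = phi i A * phi i A' := by
  have h := lo_ne_hi i
  ext r c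
  rw [Matrix.mul_apply]
  have split : ∀ f : Fin n → ℂ, ∑ k, f k =
      f (lo i) + f (hi i) + ∑ k ∈ (Finset.univ.erase (lo i)).erase (hi i), f k := by
    intro f
    rw [← Finset.add_sum_erase Finset.univ f (Finset.mem_univ (lo i)),
      ← Finset.add_sum_erase (Finset.univ.erase (lo i)) f
        (Finset.mem_erase.2 ⟨h.symm, Finset.mem_univ _⟩), add_assoc]
  rw [split]
  by_cases hr : r = lo i ∨ r = hi i
  · have hz : ∑ k ∈ (Finset.univ.erase (lo i)).erase (hi i), phi i A r k * phi i A' k c = 0 := by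
      refine Finset.sum_eq_zero fun k hk => ?_
      simp only [Finset.mem_erase, Finset.mem_univ, and_true] at hk
      have : phi i A r k = 0 := by
        have hrk : r ≠ k := by
          rintro rfl
          rcases hr with hr | hr
          · exact hk.2 hr
          · exact hk.1 hr
        simp [phi, hk.1, hk.2, hrk]
      rw [this, zero_mul]
    rw [hz, add_zero]
    rcases eq_or_ne c (lo i) with h3 | h3
    · rcases hr with hr | hr <;>
        simp [phi, hr, h3, h, h.symm, Matrix.mul_apply, Fin.sum_univ_two]
    rcases eq_or_ne c (hi i) with h4 | h4
    · rcases hr with hr | hr <;>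
        simp [phi, hr, h4, h, h.symm, Matrix.mul_apply, Fin.sum_univ_two]
    · rcases hr with hr | hr <;>
        simp [phi, hr, h3, h4, h, h.symm, h3.symm, h4.symm]
  · push Not at hr
    have hz : ∑ k ∈ (Finset.univ.erase (lo i)).erase (hi i), phi i A r k * phi i A' k c =
        phi i A' r c := by
      rw [Finset.sum_eq_single r]
      · simp [phi, hr.1, hr.2]
      · intro k _ hk
        have : phi i A r k = 0 := by simp [phi, hr.1, hr.2, hk.symm]
        rw [this, zero_mul]
      · intro hn
        simp [hr.1, hr.2] at hn
    rw [hz]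
    simp [phi, hr.1, hr.2]

/-- `phi i` as a homomorphism of monoids. -/
def phiHom {n : ℕ} (i : Fin (n - 1)) :
    Matrix (Fin 2) (Fin 2) ℂ →* Matrix (Fin n) (Fin n) ℂ where
  toFun := phi i
  map_one' := phi_one i
  map_mul' := phi_mul i

/-- The element of `GL_n(ℂ)` with matrix `phi i A`, for `A ∈ SL_2(ℂ)`. -/
def phiGL {n : ℕ} (i : Fin (n - 1)) (A : Matrix.SpecialLinearGroup (Fin 2) ℂ) : GL (Fin n) ℂ :=
  Units.map (phiHom i) (Matrix.SpecialLinearGroup.toGL A)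

/-- `y_i(p)`. -/
def yMat {n : ℕ} (i : Fin (n - 1)) (p : ℂ) : GL (Fin n) ℂ :=
  phiGL i ⟨!![1, 0; p, 1], by simp [Matrix.det_fin_two]⟩

/-- `x_i(m)`. -/
def xMat {n : ℕ} (i : Fin (n - 1)) (m : ℂ) : GL (Fin n) ℂ :=
  phiGL i ⟨!![1, m; 0, 1], by simp [Matrix.det_fin_two]⟩

/-- `ṡ_i`. -/
def sDot {n : ℕ} (i : Fin (n - 1)) : GL (Fin n) ℂ :=
  phiGL i ⟨!![0, -1; 1, 0], by simp [Matrix.det_fin_two]⟩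

/-- The parameter space `(ℂ^*)^{J°} × ℂ^{J⁻}`. -/
abbrev Params {n : ℕ} [NeZero n] (a : Fin n → Fin n) (V U : List (Factor n)) : Type :=
  (JZero V U → ℂˣ) × (JMinus a V U → ℂ)

open Classical in
/-- The matrix `g_j`: it is `ṡ_i` if `j ∈ J⁺`, `y_i(p_j)` if `j ∈ J°`, `x_i(m_j) ṡ_i⁻¹` if
`j ∈ J⁻`, where the factor of `V` at `j` is `s_i`; bars contribute the identity. -/
noncomputable def factorMatrix {n : ℕ} [NeZero n] (a : Fin n → Fin n) (V U : List (Factor n))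
    (t : Params a V U) (j : Fin V.length) : GL (Fin n) ℂ :=
  match V[j] with
  | .s i =>
      if j ∈ JPlus a V U then sDot i
      else if h : j ∈ JZero V U then yMat i (t.1 ⟨j, h⟩)
      else if h : j ∈ JMinus a V U then xMat i (t.2 ⟨j, h⟩) * (sDot i)⁻¹
      else 1
  | .bar => 1
  | .one => 1

/-- The product `g_1 g_2 ⋯ g_ℓ`. -/
noncomputable def cellMatrix {n : ℕ} [NeZero n] (a : Fin n → Fin n) (V U : List (Factor n))
    (t : Params a V U) : GL (Fin n) ℂ :=
  (List.ofFn (factorMatrix a V U t)).prod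

/-! ### Algebraic varieties as spaces with functions -/

/-- A space with functions: a topology and, for (open) sets `S`, the complex functions on the
space whose restriction to `S` is regular. Classical varieties over `ℂ` and their morphisms are
considered in this form below. -/
structure SpaceWithFunctions (X : Type*) where
  top : TopologicalSpace X
  regular : Set X → (X → ℂ) → Prop

/-- The structure induced from affine space by coordinates `c : X → ℂ^σ`: the Zariski topology, and
the functions that are locally quotients of polynomials. -/
def affineStructure {X σ : Type*} (c : X → σ → ℂ) : SpaceWithFunctions X where
  top := TopologicalSpace.generateFrom
    {S | ∃ Q : MvPolynomial σ ℂ, S = {x | MvPolynomial.eval (c x) Q ≠ 0}}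
  regular S f := ∀ x ∈ S, ∃ P Q : MvPolynomial σ ℂ, MvPolynomial.eval (c x) Q ≠ 0 ∧
    ∀ y ∈ S, MvPolynomial.eval (c y) Q ≠ 0 →
      f y = MvPolynomial.eval (c y) P / MvPolynomial.eval (c y) Q

/-- The quotient structure along `π`. -/
def SpaceWithFunctions.quotient {X Y : Type*} (𝓧 : SpaceWithFunctions X) (π : X → Y) :
    SpaceWithFunctions Y where
  top := 𝓧.top.coinduced π
  regular S f := 𝓧.regular (π ⁻¹' S) (f ∘ π)

/-- The structure induced on a subset: the subspace topology, and the functions that locally extend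
to regular functions on open subsets of the ambient space. -/
def SpaceWithFunctions.restrict {X : Type*} (𝓧 : SpaceWithFunctions X) (D : Set X) :
    SpaceWithFunctions D where
  top := 𝓧.top.induced Subtype.val
  regular S f := ∀ x ∈ S, ∃ (W : Set X) (h : X → ℂ), IsOpen[𝓧.top] W ∧ x.val ∈ W ∧
    𝓧.regular W h ∧ ∀ y ∈ S, y.val ∈ W → f y = h y.val

/-- The bijection `e` is an isomorphism: open sets correspond to open sets and regular functions
on them to regular functions. -/
def IsIsomorphism {X Y : Type*} (𝓧 : SpaceWithFunctions X) (𝓨 : SpaceWithFunctions Y)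
    (e : X ≃ Y) : Prop :=
  (∀ S : Set Y, IsOpen[𝓨.top] S ↔ IsOpen[𝓧.top] (e ⁻¹' S)) ∧
    ∀ S : Set Y, IsOpen[𝓨.top] S → ∀ f : Y → ℂ,
      (𝓨.regular S f ↔ 𝓧.regular (e ⁻¹' S) (f ∘ e))

/-- The variety `GL_n(ℂ)`, with the matrix entries as coordinates. -/
def glVariety (n : ℕ) : SpaceWithFunctions (GL (Fin n) ℂ) :=
  affineStructure fun g (ij : Fin n × Fin n) => (g : Matrix (Fin n) (Fin n) ℂ) ij.1 ij.2

/-- The flag variety, as the quotient variety `G/B`. -/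
def flagVariety (n : ℕ) : SpaceWithFunctions (Flag n) := (glVariety n).quotient toFlag

/-- The variety `(ℂ^*)^I × ℂ^K`. -/
def torusTimesAffine (I K : Type*) : SpaceWithFunctions ((I → ℂˣ) × (K → ℂ)) :=
  affineStructure fun t => Sum.elim (fun i => (t.1 i : ℂ)) t.2

end TiltedDeodhar

open TiltedDeodhar

/-!
The proof works with the subspaces `E_k` spanned by the first `k` columns of `g`. For a total order
on the rows, the leading positions of the vectors of `E_k` form a `k`-subset (`leads`,
`card_leads`), and the dimension of the intersection of `E_k` with the coordinate subspace of a
lower set is the number of leading positions in that set. Hence the rank conditions defining the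
open tilted Richardson variety say that, in the shifted order attached to `a_k`, the maximal leading
positions of `E_k` are `v[k]` and the minimal ones are `u[k]` (`HasExtremes`, `hasExtremes_iff`). If
`u[k]` and `v[k]` meet `[r, s)_c` in equally many elements, where `r = a_k`, then `E_k` splits along
`[r, s)_c`, and nothing changes when the order `≤_r` is replaced by `≤_s`
(`HasExtremes.change_seq`). This one fact shows that the variety
does not depend on `a` (`mem_openTiltedRichardson`), that it is not affected by flattening `a` as
long as `u` and `v` are flattenable (`HasExtremes.flatten`, `HasExtremes.of_flatten`), and, by
comparing each `E_k` with `E_{k+1}`, that for `u ∼_a v` it is the intersection of the two tilted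
Schubert cells (`HasExtremes.mem_cells`, `hasExtremes_of_mem_cells`).

A reduced tilted word consists of ascents: every simple transposition raises the number of tilted
inversions by one, or lowers it, while the effect of a bar does not depend on the word
(`IsTiltedReducedWord.isAscendingWord`). So consider a flag of the variety and the last factor `s_i`
of the word. The flags that differ from it at most in the subspace of dimension `i` form a
projective line, and exactly one of its points has the smaller upper extreme `v s_i`
(`LeadsAround.exists_lower`, `LeadsAround.unique`). Moving to this point at each simple
transposition, and not at all at a bar, produces one and only one chain of flags ending in the given
one; the lower extremes along the chain are the partial products of a distinguished subword
(`exists_isFlagChain`, `IsFlagChain.subword_eq`). This is the decomposition.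

For the parametrization, the partial products `z_j = g_1 ⋯ g_j` have to stay in the varieties of the
prefixes. The upper extreme takes care of itself because the word is ascending. For the lower
extreme one shows that the `k`-th column of `z_j` leads at `u^{(j)}_k` with zeros before it, in the
order attached to `a^{(j)}_k` (`IsLow`). Simple steps preserve this by a computation with two
columns. At a bar the order changes, and here regularity enters: the segment in front of the bar has
just enough letters to move the entries of the interval `[a_1, a_{q+1})_c` past the other ones, so
that each of its letters must be used for such an exchange (`crossing_at_every_step`). Therefore it
contributes only factors `ṡ_i`, which permute the columns, and the columns in question are supported
outside the interval (`DistinguishedData.isLow_bar`, `DistinguishedData.invariant`).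

Each step of a chain is realized by exactly one value of its parameter, whence the parametrization
is onto (`IsFlagChain.exists_params`). For the inverse map, the ratios of flag minors with rows near
`v[k]` are the entries of a canonical matrix `C` of the flag (`canon`); the canonical matrices of
the earlier flags of the chain are rational functions of the last one, since moving down is right
multiplication of `C` by `ṡ_i` (`DistinguishedData.canon_partialMatrix_mem`), and the parameter of a
step is a ratio of two entries of `z_{j-1}⁻¹ C_j` (`DistinguishedData.params_mem_step`). Hence the
parametrization is injective, and a bijection that is given by rational functions in both directions
is an isomorphism (`isIsomorphism_of_ratFns`).
-/

namespace TiltedDeodhar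

open Matrix
open scoped Topology

section

/-! ### Shifted orders and cyclic intervals -/

theorem sub_val {n : ℕ} (x r : Fin n) :
    (x - r).val = if r ≤ x then x.val - r.val else x.val + n - r.val := by
  have hx := x.isLt
  have hr := r.isLt
  rw [Fin.sub_def]
  simp only [Fin.le_def]
  split_ifs with h
  · rw [show n - r.val + x.val = (x.val - r.val) + n by omega, Nat.add_mod_right,
      Nat.mod_eq_of_lt (by omega)]
  · rw [Nat.mod_eq_of_lt (by omega)]
    omega

theorem sub_right_injective {n : ℕ} (r : Fin n) : Function.Injective fun x : Fin n => x - r := by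
  intro x y h
  have h' := congrArg Fin.val h
  simp only [sub_val, Fin.le_def] at h'
  ext
  have hx := x.isLt
  have hy := y.isLt
  split_ifs at h' <;> omega

theorem mem_cyclicIco {n : ℕ} (r s x : Fin n) : x ∈ cyclicIco r s ↔ x - r < s - r := by
  have hx := x.isLt
  have hr := r.isLt
  have hs := s.isLt
  rw [Fin.lt_def, sub_val, sub_val]
  unfold cyclicIco
  by_cases h : r ≤ s
  · rw [if_pos h, if_pos h, Finset.mem_Ico]
    simp only [Fin.le_def, Fin.lt_def] at *
    split_ifs <;> omega
  · rw [if_neg h, if_neg h, Finset.mem_union, Finset.mem_Ici, Finset.mem_Iio]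
    simp only [Fin.le_def, Fin.lt_def] at *
    split_ifs <;> omega

/-- The complement of a nonempty proper cyclic interval is the opposite cyclic interval. -/
theorem mem_cyclicIco_swap {n : ℕ} {r s : Fin n} (h : r ≠ s) (x : Fin n) :
    x ∈ cyclicIco s r ↔ x ∉ cyclicIco r s := by
  have hx := x.isLt
  have hr := r.isLt
  have hs := s.isLt
  have h' : r.val ≠ s.val := fun e => h (Fin.ext e)
  rw [mem_cyclicIco, mem_cyclicIco, Fin.lt_def, Fin.lt_def, sub_val, sub_val, sub_val, sub_val]
  simp only [Fin.le_def]
  split_ifs <;> omega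

/-- The ranking of `Fin n` by the shifted order `≤_r`. -/
def keyUp {n : ℕ} (r x : Fin n) : ℤ := ((x - r).val : ℤ)

/-- The ranking of `Fin n` by the reverse of the shifted order `≤_r`. -/
def keyDown {n : ℕ} (r x : Fin n) : ℤ := -((x - r).val : ℤ)

theorem keyUp_injective {n : ℕ} (r : Fin n) : Function.Injective (keyUp r) := by
  intro x y h
  apply sub_right_injective r
  simpa [keyUp, Fin.val_inj] using h

theorem keyDown_injective {n : ℕ} (r : Fin n) : Function.Injective (keyDown r) := by
  intro x y h
  apply keyUp_injective r
  simpa [keyUp, keyDown] using h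

theorem keyDown_eq {n : ℕ} (r x : Fin n) : keyDown r x = -keyUp r x := rfl

theorem shiftedLT_iff {n : ℕ} (r x y : Fin n) : ShiftedLT r x y ↔ keyUp r x < keyUp r y := by
  rw [ShiftedLT, Fin.lt_def, keyUp, keyUp, Nat.cast_lt]

theorem keyUp_lt_of_mem {n : ℕ} {r s x y : Fin n} (hx : x ∈ cyclicIco r s)
    (hy : y ∉ cyclicIco r s) : keyUp r x < keyUp r y := by
  rw [mem_cyclicIco, Fin.lt_def] at hx hy
  simp only [keyUp]
  omega

theorem keyUp_lt_of_notMem {n : ℕ} {r s x y : Fin n} (hx : x ∉ cyclicIco r s)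
    (hy : y ∈ cyclicIco r s) : keyUp s x < keyUp s y := by
  have hx' := x.isLt
  have hy' := y.isLt
  have hr := r.isLt
  have hs := s.isLt
  rw [mem_cyclicIco, Fin.lt_def, sub_val, sub_val] at hx hy
  simp only [keyUp, sub_val]
  simp only [Fin.le_def] at *
  split_ifs at * <;> omega

/-- The orders `≤_r` and `≤_s` agree on `[r, s)_c` and on its complement. -/
theorem keyUp_le_iff {n : ℕ} {r s x y : Fin n} (h : x ∈ cyclicIco r s ↔ y ∈ cyclicIco r s) :
    keyUp r x ≤ keyUp r y ↔ keyUp s x ≤ keyUp s y := by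
  have hx' := x.isLt
  have hy' := y.isLt
  have hr := r.isLt
  have hs := s.isLt
  rw [mem_cyclicIco, mem_cyclicIco, Fin.lt_def, Fin.lt_def] at h
  simp only [keyUp, sub_val] at h ⊢
  simp only [Fin.le_def] at *
  split_ifs at * <;> omega

/-- A set is determined by its size and by the sizes of its intersections with the cyclic
intervals starting at `r`. -/
theorem eq_of_card_inter_cyclicIco {n : ℕ} (r : Fin n) {A B : Finset (Fin n)}
    (hc : A.card = B.card)
    (h : ∀ i, (A ∩ cyclicIco r i).card = (B ∩ cyclicIco r i).card) : A = B := by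
  classical
  have count : ∀ c : ℕ, (A.filter fun x => (x - r).val < c).card =
      (B.filter fun x => (x - r).val < c).card := by
    intro c
    by_cases hcn : c < n
    · obtain ⟨i, hi⟩ : ∃ i : Fin n, (i - r).val = c := by
        have hsurj := Finite.surjective_of_injective (sub_right_injective r)
        obtain ⟨i, hi⟩ := hsurj ⟨c, hcn⟩
        exact ⟨i, by simpa using congrArg Fin.val hi⟩
      have e : ∀ D : Finset (Fin n), (D.filter fun x => (x - r).val < c) =
          D ∩ cyclicIco r i := by
        intro D
        ext x
        simp [mem_cyclicIco, Fin.lt_def, hi]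
      rw [e, e, h]
    · have e : ∀ D : Finset (Fin n), (D.filter fun x => (x - r).val < c) = D := by
        intro D
        refine Finset.filter_true_of_mem fun x _ => ?_
        have := (x - r).isLt
        omega
      rw [e, e, hc]
  have step : ∀ (D : Finset (Fin n)) (x : Fin n),
      (D.filter fun y => (y - r).val < (x - r).val + 1).card =
      (D.filter fun y => (y - r).val < (x - r).val).card + if x ∈ D then 1 else 0 := by
    intro D x
    split_ifs with hx
    · rw [← Finset.card_insert_of_notMem
        (a := x) (s := D.filter fun y => (y - r).val < (x - r).val) (by simp)]
      congr 1
      ext y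
      simp only [Finset.mem_filter, Finset.mem_insert]
      constructor
      · rintro ⟨h1, h2⟩
        rcases Nat.lt_succ_iff_lt_or_eq.1 h2 with h3 | h3
        · exact Or.inr ⟨h1, h3⟩
        · exact Or.inl (sub_right_injective r (Fin.ext h3))
      · rintro (rfl | ⟨h1, h2⟩)
        · exact ⟨hx, by omega⟩
        · exact ⟨h1, by omega⟩
    · rw [add_zero]
      congr 1
      ext y
      simp only [Finset.mem_filter]
      constructor
      · rintro ⟨h1, h2⟩
        rcases Nat.lt_succ_iff_lt_or_eq.1 h2 with h3 | h3
        · exact ⟨h1, h3⟩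
        · rw [sub_right_injective r (Fin.ext h3)] at h1
          exact absurd h1 hx
      · rintro ⟨h1, h2⟩
        exact ⟨h1, by omega⟩
  ext x
  have h1 := count ((x - r).val + 1)
  rw [step, step, count] at h1
  by_cases ha : x ∈ A <;> by_cases hb : x ∈ B <;> simp_all

/-! ### Leading positions of a subspace -/

open Classical in
/-- The leading positions of the nonzero vectors of `E`: the `κ`-maximal elements of their
supports. -/
noncomputable def leads {n : ℕ} (κ : Fin n → ℤ) (E : Submodule ℂ (Fin n → ℂ)) :
    Finset (Fin n) :=
  Finset.univ.filter fun x => ∃ f ∈ E, f x ≠ 0 ∧ ∀ y, f y ≠ 0 → κ y ≤ κ x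

/-- The vectors supported in `S`. -/
def coordSub {n : ℕ} (S : Finset (Fin n)) : Submodule ℂ (Fin n → ℂ) where
  carrier := {f | ∀ x, x ∉ S → f x = 0}
  add_mem' := by
    intro f g hf hg x hx
    simp [hf x hx, hg x hx]
  zero_mem' := by
    intro x _
    rfl
  smul_mem' := by
    intro c f hf x hx
    simp [hf x hx]

variable {n : ℕ} {κ κ' : Fin n → ℤ} {E D N : Submodule ℂ (Fin n → ℂ)} {S A : Finset (Fin n)}

theorem mem_leads {x : Fin n} :
    x ∈ leads κ E ↔ ∃ f ∈ E, f x ≠ 0 ∧ ∀ y, f y ≠ 0 → κ y ≤ κ x := by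
  simp [leads]

theorem mem_coordSub {f : Fin n → ℂ} : f ∈ coordSub S ↔ ∀ x, x ∉ S → f x = 0 := Iff.rfl

theorem exists_lead (κ : Fin n → ℤ) {f : Fin n → ℂ} (hf : f ≠ 0) :
    ∃ x, f x ≠ 0 ∧ ∀ y, f y ≠ 0 → κ y ≤ κ x := by
  classical
  have hne : (Finset.univ.filter fun x => f x ≠ 0).Nonempty := by
    obtain ⟨x, hx⟩ := Function.ne_iff.1 hf
    exact ⟨x, by simpa using hx⟩
  obtain ⟨x, hx, hmax⟩ := Finset.exists_max_image _ κ hne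
  refine ⟨x, by simpa using hx, fun y hy => hmax y (by simpa using hy)⟩

theorem eq_zero_of_leads {f : Fin n → ℂ} (hf : f ∈ E) (h : ∀ x ∈ leads κ E, f x = 0) :
    f = 0 := by
  by_contra hne
  obtain ⟨x, hx, hmax⟩ := exists_lead κ hne
  exact hx (h x (mem_leads.2 ⟨f, hf, hx, hmax⟩))

theorem leads_mono (h : E ≤ D) : leads κ E ⊆ leads κ D := by
  intro x hx
  obtain ⟨f, hf, h1⟩ := mem_leads.1 hx
  exact mem_leads.2 ⟨f, h hf, h1⟩

/-- The dimension is the number of leading positions. -/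
theorem card_leads (hκ : Function.Injective κ) : (leads κ E).card = Module.finrank ℂ E := by
  apply le_antisymm
  · choose f hfE hf0 hfmax using fun x : {x // x ∈ leads κ E} => mem_leads.1 x.2
    have hli : LinearIndependent ℂ (fun x : {x // x ∈ leads κ E} => (⟨f x, hfE x⟩ : E)) := by
      rw [Fintype.linearIndependent_iff]
      intro c hc
      by_contra! hne
      have hne' : (Finset.univ.filter fun x => c x ≠ 0).Nonempty := by
        obtain ⟨x, hx⟩ := hne
        exact ⟨x, by simpa using hx⟩
      obtain ⟨x, hx, hmax⟩ := Finset.exists_max_image _ (fun x => κ x.1) hne'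
      have hx0 : c x ≠ 0 := by simpa using hx
      have hsum := congrFun (congrArg Subtype.val hc) x.1
      simp only [Submodule.coe_sum, Submodule.coe_smul, Finset.sum_apply, Pi.smul_apply,
        smul_eq_mul, Submodule.coe_zero, Pi.zero_apply] at hsum
      rw [Finset.sum_eq_single x] at hsum
      · exact (mul_ne_zero hx0 (hf0 x)) hsum
      · intro y _ hyx
        by_contra h0
        have hcy : c y ≠ 0 := left_ne_zero_of_mul h0
        have hfy : f y x.1 ≠ 0 := right_ne_zero_of_mul h0
        have h1 := hfmax y x.1 hfy
        have h2 := hmax y (by simpa using hcy)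
        exact hyx (Subtype.ext (hκ (le_antisymm h2 h1)))
      · simp
    simpa using hli.fintype_card_le_finrank
  · let L : E →ₗ[ℂ] ({x // x ∈ leads κ E} → ℂ) :=
      (LinearMap.funLeft ℂ ℂ (Subtype.val : {x // x ∈ leads κ E} → Fin n)).comp E.subtype
    have hL : Function.Injective L := by
      rw [← LinearMap.ker_eq_bot, LinearMap.ker_eq_bot']
      intro f hf
      apply Subtype.ext
      apply eq_zero_of_leads (κ := κ) f.2
      intro x hx
      exact congrFun hf ⟨x, hx⟩
    simpa using LinearMap.finrank_le_finrank_of_injective hL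

/-- `S` is a lower set for the ranking `κ`. -/
def IsLowerFor (κ : Fin n → ℤ) (S : Finset (Fin n)) : Prop :=
  ∀ x ∈ S, ∀ y, y ∉ S → κ x < κ y

theorem leads_inf_coordSub (hS : IsLowerFor κ S) :
    leads κ (E ⊓ coordSub S) = leads κ E ∩ S := by
  ext x
  simp only [Finset.mem_inter, mem_leads, Submodule.mem_inf, mem_coordSub]
  constructor
  · rintro ⟨f, ⟨hf, hfS⟩, h0, hmax⟩
    exact ⟨⟨f, hf, h0, hmax⟩, by_contra fun h => h0 (hfS x h)⟩
  · rintro ⟨⟨f, hf, h0, hmax⟩, hx⟩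
    refine ⟨f, ⟨hf, fun y hy => ?_⟩, h0, hmax⟩
    by_contra h
    exact absurd (hmax y h) (not_le.2 (hS x hx y hy))

theorem finrank_inf_coordSub (hκ : Function.Injective κ) (hS : IsLowerFor κ S) :
    Module.finrank ℂ (E ⊓ coordSub S : Submodule ℂ (Fin n → ℂ)) = (leads κ E ∩ S).card := by
  rw [← card_leads hκ, leads_inf_coordSub hS]

theorem mem_coordSub_of_leads (hS : IsLowerFor κ S) (h : leads κ E ⊆ S) {f : Fin n → ℂ}
    (hf : f ∈ E) : f ∈ coordSub S := by
  rcases eq_or_ne f 0 with rfl | hne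
  · exact zero_mem _
  obtain ⟨x, hx, hmax⟩ := exists_lead κ hne
  have hxS := h (mem_leads.2 ⟨f, hf, hx, hmax⟩)
  intro y hy
  by_contra h0
  exact absurd (hmax y h0) (not_le.2 (hS x hxS y hy))

theorem leads_subset_of_le_coordSub (h : E ≤ coordSub S) : leads κ E ⊆ S := by
  intro x hx
  obtain ⟨f, hf, h0, -⟩ := mem_leads.1 hx
  by_contra hxS
  exact h0 (h hf x hxS)

/-- `E` is the direct sum of its intersections with the coordinate subspaces of `S` and of the
complement of `S`. -/
def SplitsAlong (S : Finset (Fin n)) (E : Submodule ℂ (Fin n → ℂ)) : Prop :=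
  ∀ f ∈ E, (fun x => if x ∈ S then f x else 0) ∈ E

/-- If the minimal and the maximal bases of `E` for some order meet a lower set `S` in equally many
elements, the dimensions of the two coordinate parts of `E` add up to the dimension of `E`. -/
theorem splitsAlong_of_card_eq (hκ : Function.Injective κ) (hκ' : Function.Injective κ')
    (hS : IsLowerFor κ S) (hS' : IsLowerFor κ' Sᶜ)
    (hc : (leads κ E ∩ S).card = (leads κ' E ∩ S).card) : SplitsAlong S E := by
  have h1 := finrank_inf_coordSub (E := E) hκ hS
  have h2 := finrank_inf_coordSub (E := E) hκ' hS'
  have h3 : (leads κ' E ∩ S).card + (leads κ' E ∩ Sᶜ).card = Module.finrank ℂ E := by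
    rw [← card_leads hκ', ← Finset.card_inter_add_card_sdiff (leads κ' E) S,
      Finset.sdiff_eq_inter_compl]
  have h4 : (E ⊓ coordSub S) ⊓ (E ⊓ coordSub Sᶜ) = ⊥ := by
    rw [eq_bot_iff]
    rintro f ⟨⟨-, hf1⟩, ⟨-, hf2⟩⟩
    rw [Submodule.mem_bot]
    ext x
    by_cases hx : x ∈ S
    · exact hf2 x (by simpa using hx)
    · exact hf1 x hx
  have h5 := Submodule.finrank_sup_add_finrank_inf_eq (E ⊓ coordSub S) (E ⊓ coordSub Sᶜ)
  rw [h4, finrank_bot, add_zero, h1, h2, hc, h3] at h5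
  have h6 : (E ⊓ coordSub S) ⊔ (E ⊓ coordSub Sᶜ) = E :=
    Submodule.eq_of_le_of_finrank_eq (sup_le inf_le_left inf_le_left) h5
  intro f hf
  rw [← h6] at hf
  obtain ⟨g, hg, g', hg', rfl⟩ := Submodule.mem_sup.1 hf
  have e : (fun x => if x ∈ S then (g + g') x else 0) = g := by
    ext x
    split_ifs with hx
    · simp [hg'.2 x (by simpa using hx)]
    · exact (hg.2 x hx).symm
  rw [e]
  exact hg.1

theorem leads_subset_of_splitsAlong (hE : SplitsAlong S E)
    (h : ∀ x y, (x ∈ S ↔ y ∈ S) → κ x ≤ κ y → κ' x ≤ κ' y) : leads κ E ⊆ leads κ' E := by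
  intro x hx
  obtain ⟨f, hf, h0, hmax⟩ := mem_leads.1 hx
  by_cases hxS : x ∈ S
  · refine mem_leads.2 ⟨_, hE f hf, by simpa [hxS] using h0, fun y hy => ?_⟩
    simp only [ne_eq, ite_eq_right_iff, Classical.not_imp] at hy
    exact h y x (by simp [hxS, hy.1]) (hmax y hy.2)
  · refine mem_leads.2 ⟨_, E.sub_mem hf (hE f hf), by simpa [hxS] using h0, fun y hy => ?_⟩
    by_cases hyS : y ∈ S
    · simp [hyS] at hy
    · simp only [Pi.sub_apply, hyS, if_false, sub_zero] at hy
      exact h y x (by simp [hxS, hyS]) (hmax y hy)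

/-- For a subspace that splits along `S`, only the order within the two parts matters. -/
theorem leads_eq_of_splitsAlong (hE : SplitsAlong S E)
    (h : ∀ x y, (x ∈ S ↔ y ∈ S) → (κ x ≤ κ y ↔ κ' x ≤ κ' y)) : leads κ E = leads κ' E :=
  Finset.Subset.antisymm (leads_subset_of_splitsAlong hE fun x y hxy => (h x y hxy).1)
    (leads_subset_of_splitsAlong hE fun x y hxy => (h x y hxy).2)

/-- Adding to `E` a vector whose leading position `w` is new adds exactly `w` to the leading
positions. -/
theorem leads_sup_span (hκ : Function.Injective κ) {c : Fin n → ℂ} {w : Fin n} (hw : c w ≠ 0)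
    (hmax : ∀ y, c y ≠ 0 → κ y ≤ κ w) (hwE : w ∉ leads κ E) :
    leads κ (E ⊔ Submodule.span ℂ {c}) = insert w (leads κ E) := by
  symm
  apply Finset.eq_of_subset_of_card_le
  · intro x hx
    rcases Finset.mem_insert.1 hx with rfl | hx
    · exact mem_leads.2 ⟨c, Submodule.mem_sup_right (Submodule.mem_span_singleton_self c), hw, hmax⟩
    · exact leads_mono le_sup_left hx
  · rw [card_leads hκ, Finset.card_insert_of_notMem hwE, card_leads hκ]
    refine (Submodule.finrank_add_le_finrank_add_finrank _ _).trans ?_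
    gcongr
    simpa using finrank_span_le_card (R := ℂ) ({c} : Set (Fin n → ℂ))

/-- Every vector is congruent modulo `E` to one vanishing on the leading positions of `E`. -/
theorem exists_sub_vanishing (hκ : Function.Injective κ) (f : Fin n → ℂ) :
    ∃ e ∈ E, ∀ x ∈ leads κ E, (f - e) x = 0 := by
  let L : E →ₗ[ℂ] ({x // x ∈ leads κ E} → ℂ) :=
    (LinearMap.funLeft ℂ ℂ (Subtype.val : {x // x ∈ leads κ E} → Fin n)).comp E.subtype
  have hL : Function.Injective L := by
    rw [← LinearMap.ker_eq_bot, LinearMap.ker_eq_bot']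
    intro f hf
    apply Subtype.ext
    apply eq_zero_of_leads (κ := κ) f.2
    intro x hx
    exact congrFun hf ⟨x, hx⟩
  have hs : Function.Surjective L := by
    rw [← LinearMap.injective_iff_surjective_of_finrank_eq_finrank]
    · exact hL
    · simp [card_leads hκ]
  obtain ⟨e, he⟩ := hs fun x => f x
  refine ⟨e, e.2, fun x hx => ?_⟩
  have := congrFun he ⟨x, hx⟩
  rw [Pi.sub_apply, sub_eq_zero]
  exact this.symm

/-- In the pencil of subspaces between `E` and `N`, there is only one whose additional leading
position is the smaller one of the two positions added in `N`. -/
theorem eq_of_leads_eq_insert (hκ : Function.Injective κ) {D' : Submodule ℂ (Fin n → ℂ)}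
    {x y : Fin n} (hx : x ∉ leads κ E) (hxy : κ x < κ y)
    (hED : E ≤ D) (hED' : E ≤ D') (hDN : D ≤ N) (hDN' : D' ≤ N)
    (hN : leads κ N = insert x (insert y (leads κ E)))
    (hD : leads κ D = insert x (leads κ E)) (hD' : leads κ D' = insert x (leads κ E)) :
    D = D' := by
  have key : ∀ F : Submodule ℂ (Fin n → ℂ), E ≤ F → leads κ F = insert x (leads κ E) →
      ∃ f ∈ F, f x ≠ 0 ∧ (∀ z, f z ≠ 0 → κ z ≤ κ x) ∧ (∀ z ∈ leads κ E, f z = 0) := by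
    intro F hEF hF
    obtain ⟨g, hg, hgx, hgmax⟩ := mem_leads.1 (hF ▸ Finset.mem_insert_self x (leads κ E))
    have hgE : g ∉ E := fun h => hx (mem_leads.2 ⟨g, h, hgx, hgmax⟩)
    obtain ⟨e, he, hv⟩ := exists_sub_vanishing (E := E) hκ g
    have hne : g - e ≠ 0 := fun h => hgE (by rwa [sub_eq_zero.1 h])
    obtain ⟨z, hz, hzmax⟩ := exists_lead κ hne
    have hge : g - e ∈ F := F.sub_mem hg (hEF he)
    have hzF : z ∈ leads κ F := mem_leads.2 ⟨_, hge, hz, hzmax⟩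
    rw [hF, Finset.mem_insert] at hzF
    rcases hzF with rfl | hzF
    · exact ⟨_, hge, hz, hzmax, hv⟩
    · exact absurd (hv z hzF) hz
  obtain ⟨f, hf, hfx, hfmax, hfv⟩ := key D hED hD
  obtain ⟨f', hf', hfx', hfmax', hfv'⟩ := key D' hED' hD'
  have hprop : f = (f x / f' x) • f' := by
    rw [← sub_eq_zero]
    apply eq_zero_of_leads (κ := κ) (E := N)
      (N.sub_mem (hDN hf) (N.smul_mem _ (hDN' hf')))
    intro z hz
    rw [hN, Finset.mem_insert, Finset.mem_insert] at hz
    rcases hz with rfl | rfl | hz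
    · simp [hfx']
    · have h1 : f z = 0 := by_contra fun h => absurd (hfmax z h) (not_le.2 hxy)
      have h2 : f' z = 0 := by_contra fun h => absurd (hfmax' z h) (not_le.2 hxy)
      simp [h1, h2]
    · simp [hfv z hz, hfv' z hz]
  have hfin : ∀ F : Submodule ℂ (Fin n → ℂ), E ≤ F → leads κ F = insert x (leads κ E) →
      f ∈ F → E ⊔ Submodule.span ℂ {f} = F := by
    intro F hEF hF hfF
    apply Submodule.eq_of_le_of_finrank_le
    · exact sup_le hEF ((Submodule.span_singleton_le_iff_mem _ _).2 hfF)
    · rw [← card_leads hκ, ← card_leads hκ, hF]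
      apply Finset.card_le_card
      rw [leads_sup_span hκ hfx hfmax hx]
  rw [← hfin D hED hD hf, ← hfin D' hED' hD' (hprop ▸ D'.smul_mem _ hf')]

end

section

variable {n : ℕ}

/-! ### Initial sets of permutations and initial subspaces of flags -/

/-- The set of the first `k` entries of `w`. -/
def firstSet (w : Equiv.Perm (Fin n)) (k : ℕ) : Finset (Fin n) :=
  (Finset.univ.filter fun j : Fin n => j.val < k).image w

theorem mem_firstSet {w : Equiv.Perm (Fin n)} {k : ℕ} {x : Fin n} :
    x ∈ firstSet w k ↔ (w⁻¹ x).val < k := by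
  simp only [firstSet, Finset.mem_image, Finset.mem_filter, Finset.mem_univ, true_and]
  constructor
  · rintro ⟨j, hj, rfl⟩
    simpa using hj
  · intro h
    exact ⟨w⁻¹ x, h, by simp⟩

theorem apply_mem_firstSet {w : Equiv.Perm (Fin n)} {k : ℕ} {j : Fin n} :
    w j ∈ firstSet w k ↔ j.val < k := by
  simp [mem_firstSet]

theorem initialSet_eq (w : Equiv.Perm (Fin n)) (k : Fin n) :
    initialSet w k = firstSet w (k.val + 1) := by
  have e : Finset.Iic k = Finset.univ.filter fun j : Fin n => j.val < k.val + 1 := by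
    ext j
    rw [Finset.mem_Iic, Finset.mem_filter, Fin.le_def, Nat.lt_succ_iff]
    exact ⟨fun h => ⟨Finset.mem_univ j, h⟩, fun h => h.2⟩
  rw [initialSet, firstSet, e]

theorem firstSet_zero (w : Equiv.Perm (Fin n)) : firstSet w 0 = ∅ := by
  simp [firstSet]

theorem firstSet_succ (w : Equiv.Perm (Fin n)) (k : Fin n) :
    firstSet w (k.val + 1) = insert (w k) (firstSet w k.val) := by
  ext x
  rw [Finset.mem_insert, mem_firstSet, mem_firstSet, Nat.lt_succ_iff_lt_or_eq, or_comm,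
    ← Fin.ext_iff, Equiv.Perm.inv_eq_iff_eq]

theorem card_firstSet (w : Equiv.Perm (Fin n)) {k : ℕ} (hk : k ≤ n) :
    (firstSet w k).card = k := by
  rw [firstSet, Finset.card_image_of_injective _ w.injective]
  rw [Fin.card_filter_val_lt]
  exact min_eq_right hk

/-- The span of the first `k` columns. -/
def colSpan (g : Matrix (Fin n) (Fin n) ℂ) (k : ℕ) : Submodule ℂ (Fin n → ℂ) :=
  Submodule.span ℂ (Set.range fun j : {j : Fin n // j.val < k} => fun r => g r j.1)

theorem col_mem_colSpan (g : Matrix (Fin n) (Fin n) ℂ) {k : ℕ} {j : Fin n} (hj : j.val < k) :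
    (fun r => g r j) ∈ colSpan g k :=
  Submodule.subset_span ⟨⟨j, hj⟩, rfl⟩

theorem colSpan_le {g : Matrix (Fin n) (Fin n) ℂ} {k : ℕ} {E : Submodule ℂ (Fin n → ℂ)} :
    colSpan g k ≤ E ↔ ∀ j : Fin n, j.val < k → (fun r => g r j) ∈ E := by
  rw [colSpan, Submodule.span_le]
  constructor
  · intro h j hj
    exact h ⟨⟨j, hj⟩, rfl⟩
  · rintro h _ ⟨j, rfl⟩
    exact h j.1 j.2

theorem colSpan_mono (g : Matrix (Fin n) (Fin n) ℂ) {k l : ℕ} (h : k ≤ l) :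
    colSpan g k ≤ colSpan g l :=
  colSpan_le.2 fun _ hj => col_mem_colSpan g (hj.trans_le h)

theorem colSpan_zero (g : Matrix (Fin n) (Fin n) ℂ) : colSpan g 0 = ⊥ := by
  rw [eq_bot_iff, colSpan_le]
  intro j hj
  exact absurd hj (Nat.not_lt_zero _)

theorem colSpan_succ (g : Matrix (Fin n) (Fin n) ℂ) (k : Fin n) :
    colSpan g (k.val + 1) = colSpan g k.val ⊔ Submodule.span ℂ {fun r => g r k} := by
  apply le_antisymm
  · rw [colSpan_le]
    intro j hj
    rcases Nat.lt_succ_iff_lt_or_eq.1 hj with h | h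
    · exact Submodule.mem_sup_left (col_mem_colSpan g h)
    · rw [Fin.ext h]
      exact Submodule.mem_sup_right (Submodule.mem_span_singleton_self _)
  · refine sup_le (colSpan_mono g (Nat.le_succ _)) ?_
    rw [Submodule.span_singleton_le_iff_mem]
    exact col_mem_colSpan g (Nat.lt_succ_self _)

theorem finrank_colSpan (g : GL (Fin n) ℂ) {k : ℕ} (hk : k ≤ n) :
    Module.finrank ℂ (colSpan (g : Matrix (Fin n) (Fin n) ℂ) k) = k := by
  have hli : LinearIndependent ℂ (fun j : Fin n => fun r => (g : Matrix (Fin n) (Fin n) ℂ) r j) :=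
    Matrix.linearIndependent_cols_of_isUnit g.isUnit
  have h2 := hli.comp (Subtype.val : {j : Fin n // j.val < k} → Fin n) Subtype.val_injective
  have h3 := finrank_span_eq_card h2
  rw [colSpan]
  refine h3.trans ?_
  rw [Fintype.card_subtype, Fin.card_filter_val_lt]
  exact min_eq_right hk

theorem mem_colSpan_iff {g : Matrix (Fin n) (Fin n) ℂ} {k : ℕ} {f : Fin n → ℂ} :
    f ∈ colSpan g k ↔ ∃ x : Fin n → ℂ, (∀ j : Fin n, k ≤ j.val → x j = 0) ∧ f = g *ᵥ x := by
  constructor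
  · intro hf
    induction hf using Submodule.span_induction with
    | mem f hf =>
      obtain ⟨j, rfl⟩ := hf
      refine ⟨Pi.single j.1 1, fun i hi => ?_, ?_⟩
      · have : i ≠ j.1 := fun h => by have := j.2; omega
        simp [this]
      · ext r
        simp
    | zero => exact ⟨0, fun _ _ => rfl, by simp⟩
    | add f f' _ _ h h' =>
      obtain ⟨x, hx, rfl⟩ := h
      obtain ⟨x', hx', rfl⟩ := h'
      exact ⟨x + x', fun j hj => by simp [hx j hj, hx' j hj], by rw [Matrix.mulVec_add]⟩
    | smul c f _ h =>
      obtain ⟨x, hx, rfl⟩ := h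
      exact ⟨c • x, fun j hj => by simp [hx j hj], by rw [Matrix.mulVec_smul]⟩
  · rintro ⟨x, hx, rfl⟩
    have : g *ᵥ x = ∑ j, x j • (fun r => g r j) := by
      ext r
      simp [Matrix.mulVec, dotProduct, mul_comm]
    rw [this]
    refine Submodule.sum_mem _ fun j _ => ?_
    by_cases hj : j.val < k
    · exact Submodule.smul_mem _ _ (col_mem_colSpan g hj)
    · rw [hx j (not_lt.1 hj), zero_smul]
      exact zero_mem _

theorem mem_borel {b : GL (Fin n) ℂ} :
    b ∈ borel n ↔ ∀ i j : Fin n, j < i → (b : Matrix (Fin n) (Fin n) ℂ) i j = 0 := by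
  constructor
  · intro h i j hij
    exact h hij
  · intro h i j hij
    exact h i j hij

theorem colSpan_mul_le (g b : Matrix (Fin n) (Fin n) ℂ)
    (hb : ∀ i j : Fin n, j < i → b i j = 0) (k : ℕ) : colSpan (g * b) k ≤ colSpan g k := by
  rw [colSpan_le]
  intro j hj
  refine mem_colSpan_iff.2 ⟨fun i => b i j, fun i hi => hb i j ?_, ?_⟩
  · rw [Fin.lt_def]
    omega
  · ext r
    simp [Matrix.mul_apply, Matrix.mulVec, dotProduct]

theorem toFlag_eq_iff {g h : GL (Fin n) ℂ} :
    toFlag g = toFlag h ↔ ∀ k, colSpan (g : Matrix (Fin n) (Fin n) ℂ) k =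
      colSpan (h : Matrix (Fin n) (Fin n) ℂ) k := by
  rw [toFlag, toFlag, QuotientGroup.eq]
  constructor
  · intro hb k
    have e1 : (h : Matrix (Fin n) (Fin n) ℂ) =
        (g : Matrix (Fin n) (Fin n) ℂ) *
          ((g⁻¹ * h : GL (Fin n) ℂ) : Matrix (Fin n) (Fin n) ℂ) := by
      rw [← Units.val_mul]
      simp
    have e2 : (g : Matrix (Fin n) (Fin n) ℂ) =
        (h : Matrix (Fin n) (Fin n) ℂ) *
          (((g⁻¹ * h)⁻¹ : GL (Fin n) ℂ) : Matrix (Fin n) (Fin n) ℂ) := by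
      rw [← Units.val_mul]
      simp
    apply le_antisymm
    · conv_lhs => rw [e2]
      exact colSpan_mul_le _ _ (mem_borel.1 ((borel n).inv_mem hb)) k
    · conv_lhs => rw [e1]
      exact colSpan_mul_le _ _ (mem_borel.1 hb) k
  · intro hk
    rw [mem_borel]
    intro i j hij
    have h1 := col_mem_colSpan (h : Matrix (Fin n) (Fin n) ℂ) (Nat.lt_succ_self j.val)
    rw [← hk, mem_colSpan_iff] at h1
    obtain ⟨x, hx, hx'⟩ := h1
    have h2 : ((g⁻¹ * h : GL (Fin n) ℂ) : Matrix (Fin n) (Fin n) ℂ) i j = x i := by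
      have h3 : ((g⁻¹ : GL (Fin n) ℂ) : Matrix (Fin n) (Fin n) ℂ) *ᵥ
          (fun r => (h : Matrix (Fin n) (Fin n) ℂ) r j) = x := by
        rw [hx', Matrix.mulVec_mulVec, ← Units.val_mul]
        simp
      rw [← h3, Units.val_mul, Matrix.mul_apply]
      rfl
    rw [h2]
    exact hx i hij

/-! ### Rank conditions and leading positions -/

theorem rankOn_add (g : GL (Fin n) ℂ) (S : Finset (Fin n)) (k : Fin n) :
    rankOn g S k + Module.finrank ℂ
      (colSpan (g : Matrix (Fin n) (Fin n) ℂ) (k.val + 1) ⊓ coordSub Sᶜ :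
        Submodule ℂ (Fin n → ℂ)) = k.val + 1 := by
  let E := colSpan (g : Matrix (Fin n) (Fin n) ℂ) (k.val + 1)
  let R : (Fin n → ℂ) →ₗ[ℂ] ({i // i ∈ S} → ℂ) := LinearMap.funLeft ℂ ℂ Subtype.val
  have h1 : rankOn g S k = Module.finrank ℂ (LinearMap.range (R.domRestrict E)) := by
    have hE : E = Submodule.span ℂ (Set.range fun j : {j : Fin n // j.val < k.val + 1} =>
      fun r => (g : Matrix (Fin n) (Fin n) ℂ) r j.1) := rfl
    have hspan : Submodule.span ℂ (Set.range
        ((g : Matrix (Fin n) (Fin n) ℂ).submatrix (fun i : {i // i ∈ S} => i.val)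
          (fun j : {j : Fin n // j ≤ k} => j.val)).col) = Submodule.map R E := by
      rw [hE, Submodule.map_span]
      apply congrArg
      apply Set.Subset.antisymm
      · rintro _ ⟨j, rfl⟩
        exact ⟨_, ⟨⟨j.1, Nat.lt_succ_of_le j.2⟩, rfl⟩, rfl⟩
      · rintro _ ⟨_, ⟨j, rfl⟩, rfl⟩
        exact ⟨⟨j.1, Nat.le_of_lt_succ j.2⟩, rfl⟩
    rw [rankOn, Matrix.rank_eq_finrank_span_cols, LinearMap.range_domRestrict, hspan]
  have h2 := LinearMap.finrank_range_add_finrank_ker (R.domRestrict E)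
  have h3 : Module.finrank ℂ E = k.val + 1 := finrank_colSpan g k.isLt
  have h4 : LinearMap.ker (R.domRestrict E) = (E ⊓ coordSub Sᶜ).comap E.subtype := by
    ext f
    simp only [LinearMap.mem_ker, Submodule.mem_comap, Submodule.mem_inf, mem_coordSub,
      Finset.mem_compl, not_not]
    constructor
    · intro hf
      exact ⟨f.2, fun x hx => congrFun hf ⟨x, hx⟩⟩
    · rintro ⟨-, hf⟩
      ext x
      exact hf x.1 x.2
  have h5 : Module.finrank ℂ (LinearMap.ker (R.domRestrict E)) =
      Module.finrank ℂ (E ⊓ coordSub Sᶜ : Submodule ℂ (Fin n → ℂ)) := by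
    rw [h4]
    exact (Submodule.comapSubtypeEquivOfLe inf_le_left).finrank_eq
  rw [h3, h5] at h2
  rw [h1]
  exact h2

theorem rankOn_eq_card {κ : Fin n → ℤ} (hκ : Function.Injective κ) (g : GL (Fin n) ℂ)
    {S : Finset (Fin n)} (hS : IsLowerFor κ Sᶜ) (k : Fin n) :
    rankOn g S k =
      (leads κ (colSpan (g : Matrix (Fin n) (Fin n) ℂ) (k.val + 1)) ∩ S).card := by
  have h1 := rankOn_add g S k
  rw [finrank_inf_coordSub hκ hS] at h1
  have h2 := card_leads (E := colSpan (g : Matrix (Fin n) (Fin n) ℂ) (k.val + 1)) hκ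
  rw [finrank_colSpan g k.isLt, ← Finset.card_inter_add_card_sdiff _ S,
    Finset.sdiff_eq_inter_compl] at h2
  omega

theorem isLowerFor_keyUp (r s : Fin n) : IsLowerFor (keyUp r) (cyclicIco r s) :=
  fun _ hx _ hy => keyUp_lt_of_mem hx hy

theorem isLowerFor_keyDown (r s : Fin n) : IsLowerFor (keyDown r) (cyclicIco r s)ᶜ := by
  intro x hx y hy
  rw [Finset.mem_compl] at hx
  rw [Finset.mem_compl, not_not] at hy
  have := keyUp_lt_of_mem hy hx
  simp only [keyDown_eq]
  omega

theorem isLowerFor_keyUp_compl (r s : Fin n) : IsLowerFor (keyUp s) (cyclicIco r s)ᶜ := by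
  intro x hx y hy
  rw [Finset.mem_compl] at hx
  rw [Finset.mem_compl, not_not] at hy
  exact keyUp_lt_of_notMem hx hy

/-- For every `k`, the minimal and the maximal basis, in the order `≤_{a_k}`, of the `k`-th
subspace of the flag `gB` are given by the first `k` entries of `u` and of `v`. -/
def HasExtremes (u v : Equiv.Perm (Fin n)) (a : Fin n → Fin n) (g : GL (Fin n) ℂ) : Prop :=
  ∀ k : Fin n,
    leads (keyUp (a k)) (colSpan (g : Matrix (Fin n) (Fin n) ℂ) (k.val + 1)) =
      firstSet v (k.val + 1) ∧
    leads (keyDown (a k)) (colSpan (g : Matrix (Fin n) (Fin n) ℂ) (k.val + 1)) =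
      firstSet u (k.val + 1)

theorem card_leads_colSpan {κ : Fin n → ℤ} (hκ : Function.Injective κ) (g : GL (Fin n) ℂ)
    {k : ℕ} (hk : k ≤ n) :
    (leads κ (colSpan (g : Matrix (Fin n) (Fin n) ℂ) k)).card = k := by
  rw [card_leads hκ, finrank_colSpan g hk]

theorem card_inter_cyclicIco_swap {A B : Finset (Fin n)} (hc : A.card = B.card) {r s : Fin n}
    (h : (A ∩ cyclicIco r s).card = (B ∩ cyclicIco r s).card) :
    (A ∩ cyclicIco s r).card = (B ∩ cyclicIco s r).card := by
  rcases eq_or_ne r s with rfl | hrs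
  · exact h
  · have e : cyclicIco s r = (cyclicIco r s)ᶜ := by
      ext x
      rw [Finset.mem_compl, mem_cyclicIco_swap hrs]
    rw [e, ← Finset.sdiff_eq_inter_compl, ← Finset.sdiff_eq_inter_compl]
    have h1 := Finset.card_inter_add_card_sdiff A (cyclicIco r s)
    have h2 := Finset.card_inter_add_card_sdiff B (cyclicIco r s)
    omega

/-- The rank conditions of the open tilted Richardson variety prescribe the extreme bases: a set is
determined by its intersections with the initial segments `[a_k, i)_c`, and a rank is complementary
to the dimension of the kernel of the projection. -/
theorem hasExtremes_iff {u v : Equiv.Perm (Fin n)} {a : Fin n → Fin n} {g : GL (Fin n) ℂ} :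
    HasExtremes u v a g ↔ ∀ i k : Fin n,
      rankOn g (cyclicIco (a k) i) k = (initialSet u k ∩ cyclicIco (a k) i).card ∧
      rankOn g (cyclicIco i (a k)) k = (initialSet v k ∩ cyclicIco i (a k)).card := by
  have hup : ∀ i k : Fin n, rankOn g (cyclicIco i (a k)) k =
      (leads (keyUp (a k)) (colSpan (g : Matrix (Fin n) (Fin n) ℂ) (k.val + 1)) ∩
        cyclicIco i (a k)).card :=
    fun i k => rankOn_eq_card (keyUp_injective _) g (isLowerFor_keyUp_compl _ _) k
  have hdown : ∀ i k : Fin n, rankOn g (cyclicIco (a k) i) k =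
      (leads (keyDown (a k)) (colSpan (g : Matrix (Fin n) (Fin n) ℂ) (k.val + 1)) ∩
        cyclicIco (a k) i).card :=
    fun i k => rankOn_eq_card (keyDown_injective _) g (isLowerFor_keyDown _ _) k
  constructor
  · intro h i k
    rw [hup, hdown, (h k).1, (h k).2, initialSet_eq, initialSet_eq]
    exact ⟨rfl, rfl⟩
  · intro h k
    constructor
    · have hc := (card_leads_colSpan (keyUp_injective (a k)) g k.isLt).trans
        (card_firstSet v k.isLt).symm
      apply eq_of_card_inter_cyclicIco (a k) hc
      intro i
      apply card_inter_cyclicIco_swap hc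
      rw [← initialSet_eq, ← (h i k).2, hup]
    · have hc := (card_leads_colSpan (keyDown_injective (a k)) g k.isLt).trans
        (card_firstSet u k.isLt).symm
      apply eq_of_card_inter_cyclicIco (a k) hc
      intro i
      rw [← initialSet_eq, ← (h i k).1, hdown]

theorem HasExtremes.congr {u v : Equiv.Perm (Fin n)} {a : Fin n → Fin n} {g h : GL (Fin n) ℂ}
    (hg : HasExtremes u v a g) (hgh : toFlag g = toFlag h) : HasExtremes u v a h := by
  intro k
  rw [← toFlag_eq_iff.1 hgh]
  exact hg k

theorem mem_openTiltedRichardsonAt {u v : Equiv.Perm (Fin n)} {a : Fin n → Fin n}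
    {g : GL (Fin n) ℂ} :
    toFlag g ∈ openTiltedRichardsonAt u v a ↔ HasExtremes u v a g := by
  constructor
  · rintro ⟨h, hh, hr⟩
    exact (hasExtremes_iff.2 hr).congr hh
  · intro h
    exact ⟨g, rfl, hasExtremes_iff.1 h⟩

/-- A subspace that has equally many minimal and maximal leading positions in `[r, s)_c`, for the
order `≤_r`, has the same leading positions for `≤_r` and for `≤_s`. -/
theorem leads_key_eq {E : Submodule ℂ (Fin n → ℂ)} {r s : Fin n}
    (h : (leads (keyUp r) E ∩ cyclicIco r s).card = (leads (keyDown r) E ∩ cyclicIco r s).card) :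
    leads (keyUp r) E = leads (keyUp s) E ∧ leads (keyDown r) E = leads (keyDown s) E := by
  have hs : SplitsAlong (cyclicIco r s) E :=
    splitsAlong_of_card_eq (keyUp_injective r) (keyDown_injective r) (isLowerFor_keyUp r s)
      (isLowerFor_keyDown r s) h
  refine ⟨leads_eq_of_splitsAlong hs fun x y hxy => keyUp_le_iff hxy,
    leads_eq_of_splitsAlong hs fun x y hxy => ?_⟩
  rw [keyDown_eq, keyDown_eq, keyDown_eq, keyDown_eq, neg_le_neg_iff, neg_le_neg_iff]
  exact keyUp_le_iff hxy.symm

theorem leads_key_eq_symm {E : Submodule ℂ (Fin n → ℂ)} {r s : Fin n}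
    (h : (leads (keyUp s) E ∩ cyclicIco r s).card = (leads (keyDown s) E ∩ cyclicIco r s).card) :
    leads (keyUp r) E = leads (keyUp s) E ∧ leads (keyDown r) E = leads (keyDown s) E := by
  have := leads_key_eq (E := E) (r := s) (s := r) (by
    apply card_inter_cyclicIco_swap _ h
    rw [card_leads (keyUp_injective s), card_leads (keyDown_injective s)])
  exact ⟨this.1.symm, this.2.symm⟩

end

section

variable {n : ℕ}

/-! ### The shifted Gale order -/

/-- Entrywise comparison of sorted lists in terms of the number of entries below a bound. -/
theorem forall₂_le_iff_countP {α : Type*} [LinearOrder α] {l₁ l₂ : List α}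
    (h₁ : l₁.Pairwise (· ≤ ·)) (h₂ : l₂.Pairwise (· ≤ ·)) :
    List.Forall₂ (· ≤ ·) l₁ l₂ ↔
      l₁.length = l₂.length ∧ ∀ c, l₂.countP (· ≤ c) ≤ l₁.countP (· ≤ c) := by
  constructor
  · intro h
    refine ⟨h.length_eq, fun c => ?_⟩
    clear h₁ h₂
    induction h with
    | nil => simp
    | @cons x y l l' hxy _ ih =>
      rw [List.countP_cons, List.countP_cons]
      by_cases hy : y ≤ c
      · simpa [hy, hxy.trans hy] using ih
      · simp only [hy, decide_false, Bool.false_eq_true, if_false]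
        omega
  · rintro ⟨hl, hc⟩
    induction l₁ generalizing l₂ with
    | nil =>
      obtain rfl : l₂ = [] := List.length_eq_zero_iff.1 (by simpa using hl.symm)
      exact List.Forall₂.nil
    | cons x l ih =>
      cases l₂ with
      | nil => simp at hl
      | cons y l' =>
        rw [List.pairwise_cons] at h₁ h₂
        have hxy : x ≤ y := by
          have h := hc y
          rw [List.countP_cons] at h
          simp only [le_refl, decide_true, if_true] at h
          have hpos : 0 < (x :: l).countP (· ≤ y) := by omega
          obtain ⟨z, hz, hzy⟩ := List.countP_pos_iff.1 hpos
          have hzy' : z ≤ y := by simpa using hzy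
          rcases List.mem_cons.1 hz with rfl | hz
          · exact hzy'
          · exact (h₁.1 z hz).trans hzy'
        refine List.Forall₂.cons hxy (ih h₁.2 h₂.2 (by simpa using hl) fun c => ?_)
        have h := hc c
        rw [List.countP_cons, List.countP_cons] at h
        by_cases hy : y ≤ c
        · simpa [hy, hxy.trans hy] using h
        · have h0 : l'.countP (· ≤ c) = 0 := by
            rw [List.countP_eq_zero]
            intro z hz
            have := h₂.1 z hz
            simp only [decide_eq_true_eq, not_le]
            exact (not_le.1 hy).trans_le this
          rw [h0]
          exact Nat.zero_le _

theorem countP_shiftedSort (r : Fin n) (A : Finset (Fin n)) (c : Fin n) :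
    (shiftedSort r A).countP (· ≤ c) = (A.filter fun x => x - r ≤ c).card := by
  have h1 : ((A.image fun x => x - r).filter (· ≤ c)).card =
      (shiftedSort r A).countP (· ≤ c) := by
    rw [Finset.card_def, Finset.filter_val, ← Multiset.countP_eq_card_filter,
      ← Finset.sort_eq (A.image fun x => x - r) (· ≤ ·), Multiset.coe_countP]
    rfl
  rw [← h1, Finset.filter_image, Finset.card_image_of_injective _ (sub_right_injective r)]

theorem galeLE_iff {r : Fin n} {A B : Finset (Fin n)} :
    GaleLE r A B ↔ A.card = B.card ∧
      ∀ c, (B.filter fun x => x - r ≤ c).card ≤ (A.filter fun x => x - r ≤ c).card := by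
  have hs : ∀ D : Finset (Fin n), (shiftedSort r D).Pairwise (· ≤ ·) :=
    fun D => Finset.pairwise_sort _ _
  rw [GaleLE, forall₂_le_iff_countP (hs A) (hs B)]
  simp only [countP_shiftedSort]
  have h : ∀ D : Finset (Fin n), (shiftedSort r D).length = D.card := by
    intro D
    rw [shiftedSort, Finset.length_sort, Finset.card_image_of_injective _ (sub_right_injective r)]
  rw [h, h]

theorem GaleLE.card_inter_le {r : Fin n} {A B : Finset (Fin n)} (h : GaleLE r A B) (s : Fin n) :
    (B ∩ cyclicIco r s).card ≤ (A ∩ cyclicIco r s).card := by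
  have h1 := (galeLE_iff.1 h).2
  by_cases h0 : (s - r).val = 0
  · have : cyclicIco r s = ∅ := by
      ext x
      simp [mem_cyclicIco, Fin.lt_def, h0]
    simp [this]
  · have hlt := (s - r).isLt
    have h2 := h1 ⟨(s - r).val - 1, by omega⟩
    have e : ∀ D : Finset (Fin n), (D.filter fun x => x - r ≤ ⟨(s - r).val - 1, by omega⟩) =
        D ∩ cyclicIco r s := by
      intro D
      ext x
      rw [Finset.mem_filter, Finset.mem_inter, mem_cyclicIco, Fin.le_def, Fin.lt_def]
      refine and_congr_right fun _ => ?_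
      constructor <;> intro h <;> simp only at * <;> omega
    rwa [e, e] at h2

/-- Sets that differ in one element are compared by that element. -/
theorem galeLE_insert_iff {r x y : Fin n} {I : Finset (Fin n)} (hx : x ∉ I) (hy : y ∉ I) :
    GaleLE r (insert x I) (insert y I) ↔ keyUp r x ≤ keyUp r y := by
  rw [galeLE_iff, keyUp, keyUp, Nat.cast_le]
  simp only [Finset.filter_insert, Finset.card_insert_of_notMem hx, Finset.card_insert_of_notMem hy,
    true_and]
  constructor
  · intro h
    have h1 := h (y - r)
    rw [if_pos le_rfl, Finset.card_insert_of_notMem (by simp [hy])] at h1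
    by_contra hlt
    rw [if_neg (by rwa [Fin.le_def])] at h1
    omega
  · intro h c
    by_cases hc : y - r ≤ c
    · rw [if_pos hc, if_pos (le_trans (Fin.le_def.2 h) hc),
        Finset.card_insert_of_notMem (fun h => hx (Finset.mem_filter.1 h).1),
        Finset.card_insert_of_notMem (fun h => hy (Finset.mem_filter.1 h).1)]
    · rw [if_neg hc]
      split_ifs
      · exact Finset.card_le_card (Finset.subset_insert _ _)
      · exact le_rfl

theorem galeLE_refl (r : Fin n) (A : Finset (Fin n)) : GaleLE r A A :=
  galeLE_iff.2 ⟨rfl, fun _ => le_rfl⟩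

/-! ### Independence of the open tilted Richardson variety of the sequence -/

/-- The base points `a_k` may be moved to `a'_k` if `u[k]` and `v[k]` meet `[a_k, a'_k)_c` equally
often, since the subspaces of the flag then split along this interval. -/
theorem HasExtremes.change_seq {u v : Equiv.Perm (Fin n)} {a a' : Fin n → Fin n}
    {g : GL (Fin n) ℂ} (h : HasExtremes u v a g)
    (hc : ∀ k : Fin n, (firstSet u (k.val + 1) ∩ cyclicIco (a k) (a' k)).card =
      (firstSet v (k.val + 1) ∩ cyclicIco (a k) (a' k)).card) : HasExtremes u v a' g := by
  intro k
  have h1 := leads_key_eq (E := colSpan (g : Matrix (Fin n) (Fin n) ℂ) (k.val + 1))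
    (r := a k) (s := a' k) (by rw [(h k).1, (h k).2, hc])
  rw [← h1.1, ← h1.2]
  exact h k

theorem HasExtremes.change_seq_symm {u v : Equiv.Perm (Fin n)} {a a' : Fin n → Fin n}
    {g : GL (Fin n) ℂ} (h : HasExtremes u v a' g)
    (hc : ∀ k : Fin n, (firstSet u (k.val + 1) ∩ cyclicIco (a k) (a' k)).card =
      (firstSet v (k.val + 1) ∩ cyclicIco (a k) (a' k)).card) : HasExtremes u v a g := by
  intro k
  have h1 := leads_key_eq_symm (E := colSpan (g : Matrix (Fin n) (Fin n) ℂ) (k.val + 1))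
    (r := a k) (s := a' k) (by rw [(h k).1, (h k).2, hc])
  rw [h1.1, h1.2]
  exact h k

theorem card_inter_eq_of_galeLE {r s : Fin n} {A B : Finset (Fin n)} (h : GaleLE r A B)
    (h' : GaleLE s A B) : (A ∩ cyclicIco r s).card = (B ∩ cyclicIco r s).card := by
  apply le_antisymm _ (h.card_inter_le s)
  rcases eq_or_ne r s with rfl | hrs
  · simp [cyclicIco]
  have h1 := h'.card_inter_le r
  have e : cyclicIco s r = (cyclicIco r s)ᶜ := by
    ext x
    rw [Finset.mem_compl, mem_cyclicIco_swap hrs]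
  rw [e, ← Finset.sdiff_eq_inter_compl, ← Finset.sdiff_eq_inter_compl] at h1
  have h2 := Finset.card_inter_add_card_sdiff A (cyclicIco r s)
  have h3 := Finset.card_inter_add_card_sdiff B (cyclicIco r s)
  have h4 := (galeLE_iff.1 h).1
  omega

/-- The open tilted Richardson variety does not depend on the sequence: if `u ≤_a v` and `u ≤_{a'}
v`, the sets `u[k]` and `v[k]` meet `[a_k, a'_k)_c` equally often. -/
theorem mem_openTiltedRichardson {u v : Equiv.Perm (Fin n)} {a : Fin n → Fin n}
    (huv : TiltedLE a u v) {g : GL (Fin n) ℂ} :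
    toFlag g ∈ openTiltedRichardson u v ↔ HasExtremes u v a g := by
  constructor
  · rintro ⟨a', ha', h⟩
    refine (mem_openTiltedRichardsonAt.1 h).change_seq fun k => ?_
    rw [← initialSet_eq, ← initialSet_eq]
    exact card_inter_eq_of_galeLE (ha' k) (huv k)
  · intro h
    exact ⟨a, huv, mem_openTiltedRichardsonAt.2 h⟩

/-! ### Canonical matrices of flags -/

/-- `C` is the product of the permutation matrix of `w` and a lower unitriangular matrix. -/
def IsCanonical (w : Equiv.Perm (Fin n)) (C : Matrix (Fin n) (Fin n) ℂ) : Prop :=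
  ∀ k, C (w k) k = 1 ∧ ∀ j < k, C (w j) k = 0

theorem IsCanonical.det_ne_zero {w : Equiv.Perm (Fin n)} {C : Matrix (Fin n) (Fin n) ℂ}
    (h : IsCanonical w C) : C.det ≠ 0 := by
  have h1 : (C.submatrix w id).det = 1 := by
    rw [Matrix.det_of_isLowerTriangular]
    · exact Finset.prod_eq_one fun k _ => (h k).1
    · intro i j hij
      exact (h j).2 i hij
  rw [Matrix.det_permute] at h1
  exact right_ne_zero_of_mul (h1 ▸ one_ne_zero)

theorem flagMinor_update (g : GL (Fin n) ℂ) (k : Fin n) (w : Fin n → Fin n) (r : Fin n) :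
    flagMinor g k (Function.update w k r) =
      (((g : Matrix (Fin n) (Fin n) ℂ).submatrix (fun j : {j : Fin n // j ≤ k} => w j.val)
        (fun j : {j : Fin n // j ≤ k} => j.val)).updateRow ⟨k, le_rfl⟩
          fun j => (g : Matrix (Fin n) (Fin n) ℂ) r j.val).det := by
  rw [flagMinor]
  congr 1
  ext i j
  rw [Matrix.updateRow_apply, Matrix.submatrix_apply]
  split_ifs with h
  · subst h
    simp
  · have : i.val ≠ k := fun e => h (Subtype.ext e)
    simp [Function.update_of_ne this]

/-- The matrix of ratios of flag minors; it represents the flag `gB` if the minors of `g` with rows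
`w[k]` do not vanish. -/
noncomputable def canon (w : Equiv.Perm (Fin n)) (g : GL (Fin n) ℂ) :
    Matrix (Fin n) (Fin n) ℂ :=
  Matrix.of fun r k => flagMinor g k (Function.update w k r) / flagMinor g k w

theorem flagMinor_eq_zero {g : GL (Fin n) ℂ} {k : Fin n} {r : Fin n → Fin n} {i j : Fin n}
    (hi : i ≤ k) (hj : j ≤ k) (hij : i ≠ j) (h : r i = r j) : flagMinor g k r = 0 := by
  rw [flagMinor]
  apply Matrix.det_zero_of_row_eq (i := ⟨i, hi⟩) (j := ⟨j, hj⟩)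
  · simpa using hij
  · ext c
    simp [Matrix.submatrix_apply, h]

theorem isCanonical_canon {w : Equiv.Perm (Fin n)} {g : GL (Fin n) ℂ}
    (h : ∀ k, flagMinor g k w ≠ 0) : IsCanonical w (canon w g) := by
  intro k
  refine ⟨?_, fun j hj => ?_⟩
  · simp only [canon, Matrix.of_apply, Function.update_eq_self]
    exact div_self (h k)
  · simp only [canon, Matrix.of_apply]
    rw [flagMinor_eq_zero (i := j) (j := k) hj.le le_rfl hj.ne, zero_div]
    rw [Function.update_self, Function.update_of_ne hj.ne]

/-- Cofactor expansion: the `k`-th column of the canonical matrix is a combination of the first `k`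
columns of `g`. -/
theorem exists_canon_eq_mul {w : Equiv.Perm (Fin n)} (g : GL (Fin n) ℂ) :
    ∃ b : Matrix (Fin n) (Fin n) ℂ, (∀ i j : Fin n, j < i → b i j = 0) ∧
      canon w g = (g : Matrix (Fin n) (Fin n) ℂ) * b := by
  let M : ∀ k : Fin n, Matrix {j : Fin n // j ≤ k} {j : Fin n // j ≤ k} ℂ := fun k =>
    (g : Matrix (Fin n) (Fin n) ℂ).submatrix (fun j : {j : Fin n // j ≤ k} => w j.val)
      (fun j : {j : Fin n // j ≤ k} => j.val)
  refine ⟨Matrix.of fun j k => if h : j ≤ k then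
    (M k).adjugate ⟨j, h⟩ ⟨k, le_rfl⟩ / flagMinor g k w else 0, ?_, ?_⟩
  · intro i j hij
    simp [not_le.2 hij]
  · ext r k
    rw [canon, Matrix.of_apply, flagMinor_update, Matrix.mul_apply]
    change ((M k).updateRow _ _).det / _ = _
    rw [← Matrix.cramer_transpose_apply, Matrix.cramer_eq_adjugate_mulVec,
      ← Matrix.adjugate_transpose, Matrix.mulVec, dotProduct, Finset.sum_div]
    have hz : ∀ j ∈ (Finset.univ : Finset (Fin n)), j ∉ Finset.univ.filter (· ≤ k) →
        (g : Matrix (Fin n) (Fin n) ℂ) r j * (Matrix.of fun j k => if h : j ≤ k then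
          (M k).adjugate ⟨j, h⟩ ⟨k, le_rfl⟩ / flagMinor g k w else 0) j k = 0 := by
      intro j _ hj
      have : ¬ j ≤ k := by simpa using hj
      simp [this]
    rw [← Finset.sum_subset (Finset.subset_univ _) hz,
      Finset.sum_subtype (p := fun j => j ≤ k) _ (by simp)]
    refine Finset.sum_congr rfl fun j _ => ?_
    rw [Matrix.transpose_apply, Matrix.of_apply, dif_pos j.2]
    ring

theorem exists_canonical {w : Equiv.Perm (Fin n)} {g : GL (Fin n) ℂ}
    (h : ∀ k, flagMinor g k w ≠ 0) :
    ∃ C : GL (Fin n) ℂ, (C : Matrix (Fin n) (Fin n) ℂ) = canon w g ∧ toFlag C = toFlag g := by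
  obtain ⟨b, hb, hgb⟩ := exists_canon_eq_mul (w := w) g
  have hdet := (isCanonical_canon h).det_ne_zero
  refine ⟨Matrix.GeneralLinearGroup.mkOfDetNeZero _ hdet, rfl, ?_⟩
  symm
  rw [toFlag, toFlag, QuotientGroup.eq, mem_borel]
  intro i j hij
  rw [Units.val_mul]
  change ((g⁻¹ : GL (Fin n) ℂ) * canon w g : Matrix (Fin n) (Fin n) ℂ) i j = 0
  rw [hgb, ← Matrix.mul_assoc, ← Units.val_mul, inv_mul_cancel, Units.val_one, Matrix.one_mul]
  exact hb i j hij

theorem submatrix_mul_of_upper (g b : Matrix (Fin n) (Fin n) ℂ)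
    (hb : ∀ i j : Fin n, j < i → b i j = 0) (k : Fin n) (r : Fin n → Fin n) :
    (g * b).submatrix (fun j : {j : Fin n // j ≤ k} => r j.val)
      (fun j : {j : Fin n // j ≤ k} => j.val) =
    g.submatrix (fun j : {j : Fin n // j ≤ k} => r j.val)
      (fun j : {j : Fin n // j ≤ k} => j.val) *
    b.submatrix (fun j : {j : Fin n // j ≤ k} => j.val)
      (fun j : {j : Fin n // j ≤ k} => j.val) := by
  ext i j
  rw [Matrix.submatrix_apply, Matrix.mul_apply, Matrix.mul_apply]
  have hz : ∀ l ∈ (Finset.univ : Finset (Fin n)), l ∉ Finset.univ.filter (· ≤ k) →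
      g (r i.val) l * b l j.val = 0 := by
    intro l _ hl
    have : ¬ l ≤ k := by simpa using hl
    rw [hb l j.val (j.2.trans_lt (not_le.1 this)), mul_zero]
  rw [← Finset.sum_subset (Finset.subset_univ _) hz,
    Finset.sum_subtype (p := fun j => j ≤ k) _ (by simp)]
  rfl

theorem exists_flagMinor_mul (g : GL (Fin n) ℂ) {b : GL (Fin n) ℂ} (hb : b ∈ borel n)
    (k : Fin n) : ∃ c : ℂ, c ≠ 0 ∧ ∀ r, flagMinor (g * b) k r = flagMinor g k r * c := by
  refine ⟨((b : Matrix (Fin n) (Fin n) ℂ).submatrix (fun j : {j : Fin n // j ≤ k} => j.val)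
      (fun j : {j : Fin n // j ≤ k} => j.val)).det, ?_, fun r => ?_⟩
  rotate_left
  · rw [flagMinor, Units.val_mul, submatrix_mul_of_upper _ _ (mem_borel.1 hb), Matrix.det_mul]
    rfl
  · intro h0
    have h1 := submatrix_mul_of_upper (b : Matrix (Fin n) (Fin n) ℂ)
      ((b⁻¹ : GL (Fin n) ℂ) : Matrix (Fin n) (Fin n) ℂ) (mem_borel.1 ((borel n).inv_mem hb)) k id
    rw [← Units.val_mul, mul_inv_cancel, Units.val_one] at h1
    have h2 := congrArg Matrix.det h1
    rw [Matrix.det_mul] at h2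
    simp only [id] at h2
    rw [h0, zero_mul, Matrix.submatrix_one _ Subtype.val_injective, Matrix.det_one] at h2
    exact one_ne_zero h2

theorem flagMinor_ne_zero_congr {g h : GL (Fin n) ℂ} (hgh : toFlag g = toFlag h) (k : Fin n)
    (r : Fin n → Fin n) : flagMinor g k r ≠ 0 ↔ flagMinor h k r ≠ 0 := by
  obtain ⟨c, hc, hr⟩ := exists_flagMinor_mul g (QuotientGroup.eq.1 hgh) k
  have := hr r
  rw [mul_inv_cancel_left] at this
  rw [this]
  simp [hc]

/-- The minors in the numerator and the denominator of a canonical entry are rescaled by the same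
factor when `g` is multiplied by an upper triangular matrix. -/
theorem canon_congr (w : Equiv.Perm (Fin n)) {g h : GL (Fin n) ℂ} (hgh : toFlag g = toFlag h) :
    canon w g = canon w h := by
  ext r k
  obtain ⟨c, hc, hr⟩ := exists_flagMinor_mul g (QuotientGroup.eq.1 hgh) k
  simp only [mul_inv_cancel_left] at hr
  rw [canon, canon, Matrix.of_apply, Matrix.of_apply, hr, hr, mul_div_mul_right _ _ hc]

/-- A cell cut out by the vanishing of the minors `Δ_{w[k-1] ∪ {w_i}}` with `(k, w_i)` satisfying
an irreflexive condition, in terms of canonical matrices. -/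
theorem exists_minors_iff {w : Equiv.Perm (Fin n)} {P : Fin n → Fin n → Prop}
    (hP : ∀ k, ¬ P k (w k)) {h : GL (Fin n) ℂ} :
    (∃ g, toFlag g = toFlag h ∧ (∏ k, flagMinor g k w) ≠ 0 ∧
      ∀ i k : Fin n, k < i → P k (w i) → flagMinor g k (Function.update w k (w i)) = 0) ↔
    (∀ k, flagMinor h k w ≠ 0) ∧ ∀ k r, P k r → canon w h r k = 0 := by
  constructor
  · rintro ⟨g, hg, h0, hv⟩
    rw [Finset.prod_ne_zero_iff] at h0
    refine ⟨fun k => (flagMinor_ne_zero_congr hg k w).1 (h0 k (Finset.mem_univ k)), ?_⟩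
    rw [← canon_congr w hg]
    intro k r hr
    obtain ⟨i, rfl⟩ := w.surjective r
    rcases lt_trichotomy i k with hik | rfl | hik
    · exact (isCanonical_canon (fun k => h0 k (Finset.mem_univ k)) k).2 i hik
    · exact absurd hr (hP i)
    · simp [canon, hv i k hik hr]
  · rintro ⟨h0, hv⟩
    refine ⟨h, rfl, Finset.prod_ne_zero_iff.2 fun k _ => h0 k, fun i k _ hik => ?_⟩
    have := hv k (w i) hik
    simp only [canon, Matrix.of_apply, div_eq_zero_iff] at this
    exact this.resolve_right (h0 k)

theorem mem_tiltedSchubertCell {w : Equiv.Perm (Fin n)} {a : Fin n → Fin n} {h : GL (Fin n) ℂ} :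
    toFlag h ∈ tiltedSchubertCell w a ↔ (∀ k, flagMinor h k w ≠ 0) ∧
      ∀ k r, keyUp (a k) (w k) < keyUp (a k) r → canon w h r k = 0 := by
  rw [← exists_minors_iff (P := fun k r => keyUp (a k) (w k) < keyUp (a k) r) (by simp)]
  simp only [← shiftedLT_iff]
  rfl

theorem mem_oppositeTiltedSchubertCell {w : Equiv.Perm (Fin n)} {a : Fin n → Fin n}
    {h : GL (Fin n) ℂ} :
    toFlag h ∈ oppositeTiltedSchubertCell w a ↔ (∀ k, flagMinor h k w ≠ 0) ∧
      ∀ k r, keyDown (a k) (w k) < keyDown (a k) r → canon w h r k = 0 := by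
  rw [← exists_minors_iff (P := fun k r => keyDown (a k) (w k) < keyDown (a k) r) (by simp)]
  simp only [keyDown_eq, neg_lt_neg_iff, ← shiftedLT_iff]
  rfl

/-- A combination of the first `k` columns that vanishes in the rows of a set of leading positions
is zero. -/
theorem flagMinor_ne_zero_of_leads {w : Equiv.Perm (Fin n)} {κ : Fin n → ℤ} {g : GL (Fin n) ℂ}
    {k : Fin n} (h : leads κ (colSpan (g : Matrix (Fin n) (Fin n) ℂ) (k.val + 1)) =
      firstSet w (k.val + 1)) : flagMinor g k w ≠ 0 := by
  intro h0
  rw [flagMinor, ← Matrix.exists_mulVec_eq_zero_iff] at h0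
  obtain ⟨x, hx, hx0⟩ := h0
  let y : Fin n → ℂ := fun j => if hj : j ≤ k then x ⟨j, hj⟩ else 0
  have hy : ∀ r, ((g : Matrix (Fin n) (Fin n) ℂ) *ᵥ y) r =
      ∑ j : {j : Fin n // j ≤ k}, (g : Matrix (Fin n) (Fin n) ℂ) r j.1 * x j := by
    intro r
    rw [Matrix.mulVec, dotProduct]
    have hz : ∀ j ∈ (Finset.univ : Finset (Fin n)), j ∉ Finset.univ.filter (· ≤ k) →
        (g : Matrix (Fin n) (Fin n) ℂ) r j * y j = 0 := by
      intro j _ hj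
      have : ¬ j ≤ k := by simpa using hj
      simp [y, this]
    rw [← Finset.sum_subset (Finset.subset_univ _) hz,
      Finset.sum_subtype (p := fun j => j ≤ k) _ (by simp)]
    refine Finset.sum_congr rfl fun j _ => ?_
    simp only [y]
    rw [dif_pos j.2]
  have hmem : (g : Matrix (Fin n) (Fin n) ℂ) *ᵥ y ∈
      colSpan (g : Matrix (Fin n) (Fin n) ℂ) (k.val + 1) := by
    refine mem_colSpan_iff.2 ⟨y, fun j hj => ?_, rfl⟩
    have : ¬ j ≤ k := by
      rw [Fin.le_def]
      omega
    simp [y, this]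
  have hgy : (g : Matrix (Fin n) (Fin n) ℂ) *ᵥ y = 0 := by
    apply eq_zero_of_leads (κ := κ) hmem
    rw [h]
    intro z hz
    simp only [firstSet, Finset.mem_image, Finset.mem_filter, Finset.mem_univ, true_and] at hz
    obtain ⟨j, hj, rfl⟩ := hz
    rw [hy]
    exact congrFun hx0 ⟨j, Nat.le_of_lt_succ hj⟩
  have hy0 : y = 0 := by
    have := congrArg (fun f => ((g⁻¹ : GL (Fin n) ℂ) : Matrix (Fin n) (Fin n) ℂ) *ᵥ f) hgy
    simpa [Matrix.mulVec_mulVec, ← Units.val_mul] using this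
  apply hx
  ext j
  have := congrFun hy0 j.1
  simpa [y, j.2] using this

theorem canon_col_mem {w : Equiv.Perm (Fin n)} (g : GL (Fin n) ℂ) (k : Fin n) :
    (fun r => canon w g r k) ∈ colSpan (g : Matrix (Fin n) (Fin n) ℂ) (k.val + 1) := by
  obtain ⟨b, hb, h⟩ := exists_canon_eq_mul (w := w) g
  rw [h]
  exact colSpan_mul_le _ b hb _ (col_mem_colSpan _ (Nat.lt_succ_self _))

/-- The `k`-th canonical column vanishes at `w_1, …, w_{k-1}`, so that it can only lead at `w_k`. -/
theorem canon_support_of_leads {w : Equiv.Perm (Fin n)} {κ : Fin n → ℤ} {g : GL (Fin n) ℂ}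
    (h0 : ∀ k, flagMinor g k w ≠ 0) {k : Fin n}
    (h : leads κ (colSpan (g : Matrix (Fin n) (Fin n) ℂ) (k.val + 1)) = firstSet w (k.val + 1))
    {r : Fin n} (hr : canon w g r k ≠ 0) : κ r ≤ κ (w k) := by
  have hC := isCanonical_canon h0
  obtain ⟨x, hx, hmax⟩ := exists_lead κ (f := fun r => canon w g r k)
    (fun e => hr (congrFun e r))
  have hxm : x ∈ leads κ (colSpan (g : Matrix (Fin n) (Fin n) ℂ) (k.val + 1)) :=
    mem_leads.2 ⟨_, canon_col_mem g k, hx, hmax⟩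
  rw [h] at hxm
  obtain ⟨j, rfl⟩ := w.surjective x
  rw [apply_mem_firstSet] at hxm
  rcases (Fin.le_def.2 (Nat.le_of_lt_succ hxm) : j ≤ k).lt_or_eq with hj | rfl
  · exact absurd ((hC k).2 j hj) hx
  · exact hmax r hr

theorem HasExtremes.mem_cells {u v : Equiv.Perm (Fin n)} {a : Fin n → Fin n} {g : GL (Fin n) ℂ}
    (h : HasExtremes u v a g) :
    toFlag g ∈ tiltedSchubertCell v a ∧ toFlag g ∈ oppositeTiltedSchubertCell u a := by
  have hv : ∀ k, flagMinor g k v ≠ 0 := fun k => flagMinor_ne_zero_of_leads (h k).1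
  have hu : ∀ k, flagMinor g k u ≠ 0 := fun k => flagMinor_ne_zero_of_leads (h k).2
  rw [mem_tiltedSchubertCell, mem_oppositeTiltedSchubertCell]
  refine ⟨⟨hv, fun k r hr => ?_⟩, ⟨hu, fun k r hr => ?_⟩⟩
  · exact by_contra fun hne => absurd (canon_support_of_leads hv (h k).1 hne) (not_le.2 hr)
  · exact by_contra fun hne => absurd (canon_support_of_leads hu (h k).2 hne) (not_le.2 hr)

theorem leads_bot (κ : Fin n → ℤ) : leads κ (⊥ : Submodule ℂ (Fin n → ℂ)) = ∅ := by
  ext x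
  simp only [mem_leads, Submodule.mem_bot, Finset.notMem_empty, iff_false]
  rintro ⟨f, rfl, h, -⟩
  exact h rfl

theorem tiltedSim_apply [NeZero n] {a : Fin n → Fin n} {u v : Equiv.Perm (Fin n)}
    (h : TiltedSim a u v) {k l : Fin n} (hl : l.val = k.val + 1) :
    (firstSet u (k.val + 1) ∩ cyclicIco (a k) (a l)).card =
      (firstSet v (k.val + 1) ∩ cyclicIco (a k) (a l)).card := by
  have h1 := h k
  have e : nextEntry a k = a l := by
    rw [nextEntry, dif_pos (by have := l.isLt; omega)]
    congr 1
    exact Fin.ext hl.symm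
  rwa [initialSet_eq, initialSet_eq, e] at h1

/-- If `u ∼_a v`, each subspace of the flag has the same extremal bases in the order attached to
the next one. -/
theorem leads_prev [NeZero n] {a : Fin n → Fin n} {u v : Equiv.Perm (Fin n)}
    (hsim : TiltedSim a u v) {g : GL (Fin n) ℂ} {l : Fin n}
    (h : ∀ k : Fin n, l.val = k.val + 1 →
      leads (keyUp (a k)) (colSpan (g : Matrix (Fin n) (Fin n) ℂ) (k.val + 1)) =
        firstSet v (k.val + 1) ∧
      leads (keyDown (a k)) (colSpan (g : Matrix (Fin n) (Fin n) ℂ) (k.val + 1)) =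
        firstSet u (k.val + 1)) :
    leads (keyUp (a l)) (colSpan (g : Matrix (Fin n) (Fin n) ℂ) l.val) = firstSet v l.val ∧
    leads (keyDown (a l)) (colSpan (g : Matrix (Fin n) (Fin n) ℂ) l.val) = firstSet u l.val := by
  rcases Nat.eq_zero_or_pos l.val with h0 | hpos
  · rw [h0, colSpan_zero, leads_bot, leads_bot, firstSet_zero, firstSet_zero]
    exact ⟨rfl, rfl⟩
  · have hl := l.isLt
    obtain ⟨k, hk⟩ : ∃ k : Fin n, l.val = k.val + 1 := ⟨⟨l.val - 1, by omega⟩, by simp only; omega⟩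
    have h1 := h k hk
    have h2 := leads_key_eq (r := a k) (s := a l)
      (E := colSpan (g : Matrix (Fin n) (Fin n) ℂ) (k.val + 1)) (by
        rw [h1.1, h1.2]
        exact (tiltedSim_apply hsim hk).symm)
    rw [hk, ← h2.1, ← h2.2]
    exact h1

/-- For `u ∼_a v` the intersection of the cells is the open tilted Richardson variety. -/
theorem hasExtremes_of_mem_cells [NeZero n] {a : Fin n → Fin n} {u v : Equiv.Perm (Fin n)}
    (hsim : TiltedSim a u v) {g : GL (Fin n) ℂ} (hv : toFlag g ∈ tiltedSchubertCell v a)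
    (hu : toFlag g ∈ oppositeTiltedSchubertCell u a) : HasExtremes u v a g := by
  rw [mem_tiltedSchubertCell] at hv
  rw [mem_oppositeTiltedSchubertCell] at hu
  -- the `k`-th canonical column leads at `w k`
  have step : ∀ (κ : Fin n → ℤ) (w : Equiv.Perm (Fin n)) (k : Fin n), Function.Injective κ →
      (∀ k, flagMinor g k w ≠ 0) → (∀ r, κ (w k) < κ r → canon w g r k = 0) →
      leads κ (colSpan (g : Matrix (Fin n) (Fin n) ℂ) k.val) = firstSet w k.val →
      leads κ (colSpan (g : Matrix (Fin n) (Fin n) ℂ) (k.val + 1)) = firstSet w (k.val + 1) := by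
    intro κ w k hκ h0 hs hl
    obtain ⟨C, hC, hCg⟩ := exists_canonical h0
    have hCs := toFlag_eq_iff.1 hCg
    rw [← hCs, colSpan_succ, leads_sup_span hκ (w := w k), hCs, hl, firstSet_succ]
    · rw [hC, (isCanonical_canon h0 k).1]
      exact one_ne_zero
    · intro y hy
      rw [hC] at hy
      exact le_of_not_gt fun hlt => hy (hs y hlt)
    · rw [hCs, hl, apply_mem_firstSet]
      exact lt_irrefl _
  have main : ∀ (m : ℕ) (k : Fin n), k.val = m →
      leads (keyUp (a k)) (colSpan (g : Matrix (Fin n) (Fin n) ℂ) (k.val + 1)) =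
        firstSet v (k.val + 1) ∧
      leads (keyDown (a k)) (colSpan (g : Matrix (Fin n) (Fin n) ℂ) (k.val + 1)) =
        firstSet u (k.val + 1) := by
    intro m
    induction m with
    | zero =>
      intro k hk
      have h1 := leads_prev hsim (g := g) (l := k) (fun k' hk' => by omega)
      exact ⟨step _ v k (keyUp_injective _) hv.1 (hv.2 k) h1.1,
        step _ u k (keyDown_injective _) hu.1 (hu.2 k) h1.2⟩
    | succ m ih =>
      intro k hk
      have h1 := leads_prev hsim (g := g) (l := k) (fun k' hk' => ih k' (by omega))
      exact ⟨step _ v k (keyUp_injective _) hv.1 (hv.2 k) h1.1,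
        step _ u k (keyDown_injective _) hu.1 (hu.2 k) h1.2⟩
  exact fun k => main _ k rfl

end

section

variable {n : ℕ}

/-! ### Pencils of flags -/

theorem lo_val (i : Fin (n - 1)) : (lo i).val = i.val := rfl

theorem hi_val (i : Fin (n - 1)) : (hi i).val = i.val + 1 := rfl

theorem mul_swap_lo (w : Equiv.Perm (Fin n)) (i : Fin (n - 1)) :
    (w * Equiv.swap (lo i) (hi i)) (lo i) = w (hi i) := by
  simp

theorem mul_swap_hi (w : Equiv.Perm (Fin n)) (i : Fin (n - 1)) :
    (w * Equiv.swap (lo i) (hi i)) (hi i) = w (lo i) := by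
  simp

theorem mul_swap_ne (w : Equiv.Perm (Fin n)) {i : Fin (n - 1)} {j : Fin n} (h1 : j ≠ lo i)
    (h2 : j ≠ hi i) : (w * Equiv.swap (lo i) (hi i)) j = w j := by
  rw [Equiv.Perm.mul_apply, Equiv.swap_apply_of_ne_of_ne h1 h2]

theorem mul_swap_mul_swap (w : Equiv.Perm (Fin n)) (i : Fin (n - 1)) :
    w * Equiv.swap (lo i) (hi i) * Equiv.swap (lo i) (hi i) = w := by
  rw [mul_assoc, Equiv.swap_mul_self, mul_one]

theorem mul_swap_ne_self (w : Equiv.Perm (Fin n)) (i : Fin (n - 1)) :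
    w * Equiv.swap (lo i) (hi i) ≠ w := by
  intro h
  have := congrArg (fun x => x (lo i)) h
  simp only [mul_swap_lo] at this
  exact lo_ne_hi i (w.injective this).symm

theorem firstSet_mul_swap (w : Equiv.Perm (Fin n)) (i : Fin (n - 1)) {k : ℕ}
    (hk : k ≠ i.val + 1) : firstSet (w * Equiv.swap (lo i) (hi i)) k = firstSet w k := by
  ext x
  rw [mem_firstSet, mem_firstSet, _root_.mul_inv_rev, Equiv.swap_inv, Equiv.Perm.mul_apply]
  by_cases h1 : w⁻¹ x = lo i
  · rw [h1, Equiv.swap_apply_left, lo_val, hi_val]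
    omega
  by_cases h2 : w⁻¹ x = hi i
  · rw [h2, Equiv.swap_apply_right, lo_val, hi_val]
    omega
  rw [Equiv.swap_apply_of_ne_of_ne h1 h2]

theorem firstSet_lo_succ (w : Equiv.Perm (Fin n)) (i : Fin (n - 1)) :
    firstSet w (i.val + 1) = insert (w (lo i)) (firstSet w i.val) :=
  firstSet_succ w (lo i)

theorem firstSet_mul_swap_succ (w : Equiv.Perm (Fin n)) (i : Fin (n - 1)) :
    firstSet (w * Equiv.swap (lo i) (hi i)) (i.val + 1) =
      insert (w (hi i)) (firstSet w i.val) := by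
  rw [firstSet_lo_succ, mul_swap_lo, firstSet_mul_swap w i (by omega)]

theorem firstSet_hi_succ (w : Equiv.Perm (Fin n)) (i : Fin (n - 1)) :
    firstSet w (i.val + 2) = insert (w (lo i)) (insert (w (hi i)) (firstSet w i.val)) := by
  rw [Finset.insert_comm, ← firstSet_lo_succ]
  exact firstSet_succ w (hi i)

theorem eq_of_firstSet {u w : Equiv.Perm (Fin n)}
    (h : ∀ k : Fin n, firstSet u (k.val + 1) = firstSet w (k.val + 1)) : u = w := by
  have h' : ∀ k, k ≤ n → firstSet u k = firstSet w k := by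
    intro k hk
    rcases Nat.eq_zero_or_pos k with rfl | hpos
    · rw [firstSet_zero, firstSet_zero]
    · have := h ⟨k - 1, by omega⟩
      rwa [show (⟨k - 1, by omega⟩ : Fin n).val + 1 = k by simp only; omega] at this
  ext k
  have h1 : u k ∈ firstSet w (k.val + 1) := h k ▸ apply_mem_firstSet.2 (Nat.lt_succ_self _)
  have h2 : u k ∉ firstSet w k.val := by
    rw [← h' _ k.isLt.le, apply_mem_firstSet]
    exact lt_irrefl _
  rw [firstSet_succ, Finset.mem_insert] at h1
  rw [h1.resolve_right h2]

/-- The extreme bases of a flag determine the permutations. -/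
theorem HasExtremes.left_unique {u u' v v' : Equiv.Perm (Fin n)} {a : Fin n → Fin n}
    {g : GL (Fin n) ℂ} (h : HasExtremes u v a g) (h' : HasExtremes u' v' a g) : u = u' :=
  eq_of_firstSet fun k => (h k).2.symm.trans (h' k).2

theorem finrank_colSpan_eq_min (g : GL (Fin n) ℂ) (k : ℕ) :
    Module.finrank ℂ (colSpan (g : Matrix (Fin n) (Fin n) ℂ) k) = min n k := by
  rcases le_total k n with h | h
  · rw [finrank_colSpan g h, min_eq_right h]
  · rw [min_eq_left h]
    apply le_antisymm
    · simpa using Submodule.finrank_le (colSpan (g : Matrix (Fin n) (Fin n) ℂ) k)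
    · calc n = Module.finrank ℂ (colSpan (g : Matrix (Fin n) (Fin n) ℂ) n) :=
          (finrank_colSpan g le_rfl).symm
        _ ≤ _ := Submodule.finrank_mono (colSpan_mono _ h)

theorem colSpan_eq_of_le {g h : GL (Fin n) ℂ} {k : ℕ}
    (hle : colSpan (g : Matrix (Fin n) (Fin n) ℂ) k ≤ colSpan (h : Matrix (Fin n) (Fin n) ℂ) k) :
    colSpan (g : Matrix (Fin n) (Fin n) ℂ) k = colSpan (h : Matrix (Fin n) (Fin n) ℂ) k :=
  Submodule.eq_of_le_of_finrank_eq hle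
    ((finrank_colSpan_eq_min g k).trans (finrank_colSpan_eq_min h k).symm)

theorem sum_eq_lo_add_hi (i : Fin (n - 1)) (f : Fin n → ℂ)
    (hf : ∀ k, k ≠ lo i → k ≠ hi i → f k = 0) : ∑ k, f k = f (lo i) + f (hi i) := by
  rw [← Finset.sum_subset (Finset.subset_univ {lo i, hi i}), Finset.sum_pair (lo_ne_hi i)]
  intro k _ hk
  simp only [Finset.mem_insert, Finset.mem_singleton, not_or] at hk
  exact hf k hk.1 hk.2

theorem mul_phi_lo (g : Matrix (Fin n) (Fin n) ℂ) (i : Fin (n - 1))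
    (A : Matrix (Fin 2) (Fin 2) ℂ) (r : Fin n) :
    (g * phi i A) r (lo i) = g r (lo i) * A 0 0 + g r (hi i) * A 1 0 := by
  have h := lo_ne_hi i
  rw [Matrix.mul_apply, sum_eq_lo_add_hi i]
  · simp [phi, h, h.symm]
  · intro k h1 h2
    simp [phi, h1, h2]

theorem mul_phi_hi (g : Matrix (Fin n) (Fin n) ℂ) (i : Fin (n - 1))
    (A : Matrix (Fin 2) (Fin 2) ℂ) (r : Fin n) :
    (g * phi i A) r (hi i) = g r (lo i) * A 0 1 + g r (hi i) * A 1 1 := by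
  have h := lo_ne_hi i
  rw [Matrix.mul_apply, sum_eq_lo_add_hi i]
  · simp [phi, h.symm]
  · intro k h1 h2
    simp [phi, h1, h2]

theorem mul_phi_ne (g : Matrix (Fin n) (Fin n) ℂ) (i : Fin (n - 1))
    (A : Matrix (Fin 2) (Fin 2) ℂ) (r : Fin n) {c : Fin n} (h1 : c ≠ lo i) (h2 : c ≠ hi i) :
    (g * phi i A) r c = g r c := by
  rw [Matrix.mul_apply, Finset.sum_eq_single c]
  · simp [phi, h1, h2]
  · intro k _ hk
    simp [phi, h1, h2, hk]
  · simp

theorem colSpan_mul_phi_le (g : Matrix (Fin n) (Fin n) ℂ) (i : Fin (n - 1))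
    (A : Matrix (Fin 2) (Fin 2) ℂ) {k : ℕ} (hk : k ≠ i.val + 1) :
    colSpan (g * phi i A) k ≤ colSpan g k := by
  rw [colSpan_le]
  have comb : ∀ α β : ℂ, i.val + 1 < k →
      (fun r => g r (lo i) * α + g r (hi i) * β) ∈ colSpan g k := by
    intro α β h
    have h1 := col_mem_colSpan g (j := lo i) (k := k) (by rw [lo_val]; omega)
    have h2 := col_mem_colSpan g (j := hi i) (k := k) (by rw [hi_val]; omega)
    convert add_mem (Submodule.smul_mem _ α h1) (Submodule.smul_mem _ β h2) using 1
    ext r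
    simp [mul_comm]
  intro j hj
  by_cases h1 : j = lo i
  · subst h1
    simp only [mul_phi_lo]
    exact comb _ _ (by rw [lo_val] at hj; omega)
  by_cases h2 : j = hi i
  · subst h2
    simp only [mul_phi_hi]
    exact comb _ _ (by rw [hi_val] at hj; omega)
  simp only [mul_phi_ne _ _ _ _ h1 h2]
  exact col_mem_colSpan g hj

theorem xMat_coe (i : Fin (n - 1)) (m : ℂ) :
    ((xMat i m : GL (Fin n) ℂ) : Matrix (Fin n) (Fin n) ℂ) = phi i !![1, m; 0, 1] := rfl

theorem yMat_coe (i : Fin (n - 1)) (p : ℂ) :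
    ((yMat i p : GL (Fin n) ℂ) : Matrix (Fin n) (Fin n) ℂ) = phi i !![1, 0; p, 1] := rfl

theorem sDot_coe (i : Fin (n - 1)) :
    ((sDot i : GL (Fin n) ℂ) : Matrix (Fin n) (Fin n) ℂ) = phi i !![0, -1; 1, 0] := rfl

theorem xMat_mul_sDot_coe (i : Fin (n - 1)) (m : ℂ) :
    ((xMat i m * sDot i : GL (Fin n) ℂ) : Matrix (Fin n) (Fin n) ℂ) = phi i !![m, -1; 1, 0] := by
  rw [Units.val_mul, xMat_coe, sDot_coe, ← phi_mul]
  congr 1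
  ext r c
  fin_cases r <;> fin_cases c <;> simp [Matrix.mul_apply, Fin.sum_univ_two]

theorem phi_mem_borel (i : Fin (n - 1)) {A : Matrix (Fin 2) (Fin 2) ℂ} (hA : A 1 0 = 0)
    {b : GL (Fin n) ℂ} (hb : (b : Matrix (Fin n) (Fin n) ℂ) = phi i A) : b ∈ borel n := by
  have h := lo_ne_hi i
  rw [mem_borel]
  intro r c hrc
  have h1 : r ≠ c := hrc.ne'
  have h2 : ¬ (r = lo i ∧ c = hi i) := by
    rintro ⟨rfl, rfl⟩
    rw [Fin.lt_def, lo_val, hi_val] at hrc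
    omega
  rw [hb]
  simp only [phi, Matrix.of_apply, hA, h2, if_false]
  split_ifs <;> simp_all

/-- The flags `gB` and `hB` differ at most in the subspace of dimension `i + 1`. -/
def IsNeighbor (i : Fin (n - 1)) (g h : GL (Fin n) ℂ) : Prop :=
  ∀ k, k ≠ i.val + 1 → colSpan (g : Matrix (Fin n) (Fin n) ℂ) k =
    colSpan (h : Matrix (Fin n) (Fin n) ℂ) k

theorem IsNeighbor.symm {i : Fin (n - 1)} {g h : GL (Fin n) ℂ} (hg : IsNeighbor i g h) :
    IsNeighbor i h g := fun k hk => (hg k hk).symm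

theorem IsNeighbor.trans {i : Fin (n - 1)} {g h h' : GL (Fin n) ℂ} (hg : IsNeighbor i g h)
    (hh : IsNeighbor i h h') : IsNeighbor i g h' := fun k hk => (hg k hk).trans (hh k hk)

theorem isNeighbor_of_toFlag_eq (i : Fin (n - 1)) {g h : GL (Fin n) ℂ}
    (hg : toFlag g = toFlag h) : IsNeighbor i g h := fun k _ => toFlag_eq_iff.1 hg k

theorem isNeighbor_mul_phi (g : GL (Fin n) ℂ) {i : Fin (n - 1)} {A : Matrix (Fin 2) (Fin 2) ℂ}
    {b : GL (Fin n) ℂ} (hb : (b : Matrix (Fin n) (Fin n) ℂ) = phi i A) :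
    IsNeighbor i g (g * b) := by
  intro k hk
  symm
  apply colSpan_eq_of_le
  rw [Units.val_mul, hb]
  exact colSpan_mul_phi_le _ i _ hk

theorem IsNeighbor.toFlag_eq {i : Fin (n - 1)} {g h : GL (Fin n) ℂ} (hgh : IsNeighbor i g h)
    (he : colSpan (g : Matrix (Fin n) (Fin n) ℂ) (i.val + 1) =
      colSpan (h : Matrix (Fin n) (Fin n) ℂ) (i.val + 1)) : toFlag g = toFlag h := by
  rw [toFlag_eq_iff]
  intro k
  by_cases hk : k = i.val + 1
  · rw [hk, he]
  · exact hgh k hk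

section Pencil

variable {κ : Fin n → ℤ} {i : Fin (n - 1)} {w : Equiv.Perm (Fin n)} {g h : GL (Fin n) ℂ}

/-- The leading positions of the subspaces of dimensions `i`, `i + 1`, `i + 2` of `gB` are given by
the entries of `w`. -/
def LeadsAround (κ : Fin n → ℤ) (i : Fin (n - 1)) (w : Equiv.Perm (Fin n)) (g : GL (Fin n) ℂ) :
    Prop :=
  leads κ (colSpan (g : Matrix (Fin n) (Fin n) ℂ) i.val) = firstSet w i.val ∧
  leads κ (colSpan (g : Matrix (Fin n) (Fin n) ℂ) (i.val + 1)) = firstSet w (i.val + 1) ∧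
  leads κ (colSpan (g : Matrix (Fin n) (Fin n) ℂ) (i.val + 2)) = firstSet w (i.val + 2)

/-- On a pencil of flags, the subspace of dimension `i + 1` lies between two subspaces whose leading
positions differ by `w_i` and `w_{i+1}`; it gains one of the two. -/
theorem leadsAround_dichotomy (hκ : Function.Injective κ) (hg : LeadsAround κ i w g)
    (hgh : IsNeighbor i g h) :
    leads κ (colSpan (h : Matrix (Fin n) (Fin n) ℂ) (i.val + 1)) = firstSet w (i.val + 1) ∨
    leads κ (colSpan (h : Matrix (Fin n) (Fin n) ℂ) (i.val + 1)) =
      firstSet (w * Equiv.swap (lo i) (hi i)) (i.val + 1) := by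
  have hi2 := (hi i).isLt
  rw [hi_val] at hi2
  have h1 : firstSet w i.val ⊆ leads κ (colSpan (h : Matrix (Fin n) (Fin n) ℂ) (i.val + 1)) := by
    rw [← hg.1, hgh _ (by omega)]
    exact leads_mono (colSpan_mono _ (by omega))
  have h2 : leads κ (colSpan (h : Matrix (Fin n) (Fin n) ℂ) (i.val + 1)) ⊆
      firstSet w (i.val + 2) := by
    rw [← hg.2.2, hgh _ (by omega)]
    exact leads_mono (colSpan_mono _ (by omega))
  have hc := card_leads_colSpan hκ h (k := i.val + 1) (by omega)
  have hcA := card_firstSet w (k := i.val) (by omega)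
  rw [firstSet_mul_swap_succ, firstSet_lo_succ]
  rw [firstSet_hi_succ] at h2
  have key : ∀ x, x ∉ firstSet w i.val →
      x ∈ leads κ (colSpan (h : Matrix (Fin n) (Fin n) ℂ) (i.val + 1)) →
      leads κ (colSpan (h : Matrix (Fin n) (Fin n) ℂ) (i.val + 1)) =
        insert x (firstSet w i.val) := by
    intro x hx hxL
    symm
    apply Finset.eq_of_subset_of_card_le
    · exact Finset.insert_subset hxL h1
    · rw [hc, Finset.card_insert_of_notMem hx, hcA]
  have hlo : w (lo i) ∉ firstSet w i.val := by
    rw [apply_mem_firstSet, lo_val]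
    omega
  have hhi : w (hi i) ∉ firstSet w i.val := by
    rw [apply_mem_firstSet, hi_val]
    omega
  by_cases hx : w (lo i) ∈ leads κ (colSpan (h : Matrix (Fin n) (Fin n) ℂ) (i.val + 1))
  · exact Or.inl (key _ hlo hx)
  by_cases hy : w (hi i) ∈ leads κ (colSpan (h : Matrix (Fin n) (Fin n) ℂ) (i.val + 1))
  · exact Or.inr (key _ hhi hy)
  exfalso
  have h3 : leads κ (colSpan (h : Matrix (Fin n) (Fin n) ℂ) (i.val + 1)) ⊆
      firstSet w i.val := by
    intro z hz
    have hz2 := h2 hz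
    rw [Finset.mem_insert, Finset.mem_insert] at hz2
    rcases hz2 with rfl | rfl | hz2
    · exact absurd hz hx
    · exact absurd hz hy
    · exact hz2
  have := Finset.card_le_card h3
  omega

/-- The special point of a pencil, at which the smaller one of the two available positions is
leading, is unique. -/
theorem LeadsAround.unique (hκ : Function.Injective κ) (hg : LeadsAround κ i w g)
    (hgh : IsNeighbor i g h) (hlt : κ (w (lo i)) < κ (w (hi i)))
    (hh : leads κ (colSpan (h : Matrix (Fin n) (Fin n) ℂ) (i.val + 1)) =
      firstSet w (i.val + 1)) : toFlag g = toFlag h := by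
  apply hgh.toFlag_eq
  refine eq_of_leads_eq_insert (κ := κ) (x := w (lo i)) (y := w (hi i)) hκ
    (E := colSpan (g : Matrix (Fin n) (Fin n) ℂ) i.val)
    (N := colSpan (g : Matrix (Fin n) (Fin n) ℂ) (i.val + 2)) ?_ hlt
    (colSpan_mono _ (by omega)) ?_ (colSpan_mono _ (by omega)) ?_ ?_ ?_ ?_
  · rw [hg.1, apply_mem_firstSet, lo_val]
    omega
  · rw [hgh _ (by omega)]
    exact colSpan_mono _ (by omega)
  · rw [hgh _ (by omega)]
    exact colSpan_mono _ (by omega)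
  · rw [hg.2.2, hg.1, firstSet_hi_succ]
  · rw [hg.2.1, hg.1, firstSet_lo_succ]
  · rw [hh, hg.1, firstSet_lo_succ]

/-- Away from the special point of a pencil, the leading positions are the generic ones. -/
theorem LeadsAround.of_ne (hκ : Function.Injective κ) (hg : LeadsAround κ i w g)
    (hgh : IsNeighbor i g h) (hlt : κ (w (lo i)) < κ (w (hi i)))
    (hne : toFlag g ≠ toFlag h) :
    leads κ (colSpan (h : Matrix (Fin n) (Fin n) ℂ) (i.val + 1)) =
      firstSet (w * Equiv.swap (lo i) (hi i)) (i.val + 1) :=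
  (leadsAround_dichotomy hκ hg hgh).resolve_left fun hh => hne (hg.unique hκ hgh hlt hh)

theorem mul_xMat_mul_sDot_lo (g : GL (Fin n) ℂ) (i : Fin (n - 1)) (m : ℂ) (r : Fin n) :
    ((g * (xMat i m * sDot i) : GL (Fin n) ℂ) : Matrix (Fin n) (Fin n) ℂ) r (lo i) =
      (g : Matrix (Fin n) (Fin n) ℂ) r (lo i) * m + (g : Matrix (Fin n) (Fin n) ℂ) r (hi i) := by
  rw [Units.val_mul, xMat_mul_sDot_coe, mul_phi_lo]
  simp

theorem isNeighbor_mul_xMat_mul_sDot (g : GL (Fin n) ℂ) (i : Fin (n - 1)) (m : ℂ) :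
    IsNeighbor i g (g * (xMat i m * sDot i)) :=
  isNeighbor_mul_phi g (xMat_mul_sDot_coe i m)

theorem lo_col_mem (g : GL (Fin n) ℂ) (i : Fin (n - 1)) :
    (fun r => (g : Matrix (Fin n) (Fin n) ℂ) r (lo i)) ∈
      colSpan (g : Matrix (Fin n) (Fin n) ℂ) (i.val + 1) :=
  col_mem_colSpan _ (by rw [lo_val]; omega)

theorem mem_colSpan_mul_xMat (g : GL (Fin n) ℂ) (i : Fin (n - 1)) {x : Fin n → ℂ}
    (hx : ∀ j : Fin n, i.val + 2 ≤ j.val → x j = 0) (h0 : x (hi i) ≠ 0) :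
    (g : Matrix (Fin n) (Fin n) ℂ) *ᵥ x ∈
      colSpan ((g * (xMat i (x (lo i) / x (hi i)) * sDot i) : GL (Fin n) ℂ) :
        Matrix (Fin n) (Fin n) ℂ) (i.val + 1) := by
  set h := g * (xMat i (x (lo i) / x (hi i)) * sDot i) with hh
  have e : (g : Matrix (Fin n) (Fin n) ℂ) *ᵥ x =
      (g : Matrix (Fin n) (Fin n) ℂ) *ᵥ (fun j => if j.val < i.val then x j else 0) +
        x (hi i) • fun r => (h : Matrix (Fin n) (Fin n) ℂ) r (lo i) := by
    ext r
    rw [hh]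
    simp only [Pi.add_apply, Pi.smul_apply, smul_eq_mul, mul_xMat_mul_sDot_lo, Matrix.mulVec,
      dotProduct]
    rw [← sub_eq_iff_eq_add', ← Finset.sum_sub_distrib, sum_eq_lo_add_hi i]
    · have e0 : ¬ i.val + 1 < i.val := by omega
      simp only [lo_val, hi_val, lt_irrefl, if_false, mul_zero, sub_zero, e0]
      field_simp
    · intro k h1 h2
      split_ifs with h3
      · ring
      · have h1' : k.val ≠ i.val := fun e => h1 (Fin.ext e)
        have h2' : k.val ≠ i.val + 1 := fun e => h2 (Fin.ext e)
        rw [hx k (by omega)]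
        ring
  rw [e]
  refine add_mem ?_ (Submodule.smul_mem _ _ (lo_col_mem h i))
  apply colSpan_mono _ (Nat.le_succ i.val)
  rw [← isNeighbor_mul_xMat_mul_sDot g i _ i.val (by omega)]
  exact mem_colSpan_iff.2 ⟨_, fun j hj => if_neg (by omega), rfl⟩

/-- The special point of a pencil exists. -/
theorem LeadsAround.exists_lower (hκ : Function.Injective κ) (hg : LeadsAround κ i w g) :
    ∃ m : ℂ, leads κ (colSpan ((g * (xMat i m * sDot i) : GL (Fin n) ℂ) :
        Matrix (Fin n) (Fin n) ℂ) (i.val + 1)) =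
      firstSet (w * Equiv.swap (lo i) (hi i)) (i.val + 1) := by
  have hmem : w (hi i) ∈ leads κ (colSpan (g : Matrix (Fin n) (Fin n) ℂ) (i.val + 2)) := by
    rw [hg.2.2, apply_mem_firstSet, hi_val]
    omega
  obtain ⟨f, hf, hfw, hfmax⟩ := mem_leads.1 hmem
  obtain ⟨x, hx, rfl⟩ := mem_colSpan_iff.1 hf
  have h0 : x (hi i) ≠ 0 := by
    intro h0
    have h1 : (g : Matrix (Fin n) (Fin n) ℂ) *ᵥ x ∈
        colSpan (g : Matrix (Fin n) (Fin n) ℂ) (i.val + 1) := by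
      refine mem_colSpan_iff.2 ⟨x, fun j hj => ?_, rfl⟩
      rcases hj.eq_or_lt with hj | hj
      · rw [show j = hi i from Fin.ext hj.symm, h0]
      · exact hx j hj
    have h2 : w (hi i) ∈ leads κ (colSpan (g : Matrix (Fin n) (Fin n) ℂ) (i.val + 1)) :=
      mem_leads.2 ⟨_, h1, hfw, hfmax⟩
    rw [hg.2.1, apply_mem_firstSet, hi_val] at h2
    omega
  refine ⟨x (lo i) / x (hi i), ?_⟩
  refine (leadsAround_dichotomy hκ hg (isNeighbor_mul_xMat_mul_sDot g i _)).resolve_left ?_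
  intro he
  have h2 : w (hi i) ∈ leads κ (colSpan ((g * (xMat i (x (lo i) / x (hi i)) * sDot i) :
      GL (Fin n) ℂ) : Matrix (Fin n) (Fin n) ℂ) (i.val + 1)) :=
    mem_leads.2 ⟨_, mem_colSpan_mul_xMat g i hx h0, hfw, hfmax⟩
  rw [he, apply_mem_firstSet, hi_val] at h2
  omega

end Pencil

/-! ### Relative position of a simple transposition -/

theorem permMat_swap (i : Fin (n - 1)) :
    permMat (Equiv.swap (lo i) (hi i)) = phi i !![0, 1; 1, 0] := by
  have h := lo_ne_hi i
  ext r c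
  simp only [permMat, phi, Matrix.of_apply]
  by_cases h1 : c = lo i
  · subst h1
    by_cases h2 : r = hi i <;> by_cases h3 : r = lo i <;> simp_all
  by_cases h2 : c = hi i
  · subst h2
    by_cases h2 : r = hi i <;> by_cases h3 : r = lo i <;> simp_all
  rw [Equiv.swap_apply_of_ne_of_ne h1 h2]
  simp [h1, h2]

/-- The element of `GL_n(ℂ)` with matrix `phi i A`, for `A ∈ GL_2(ℂ)`. -/
noncomputable def phiUnit (i : Fin (n - 1)) (A : Matrix (Fin 2) (Fin 2) ℂ) (hA : A.det ≠ 0) :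
    GL (Fin n) ℂ :=
  Units.map (phiHom i) (Matrix.GeneralLinearGroup.mkOfDetNeZero A hA)

theorem phiUnit_coe (i : Fin (n - 1)) (A : Matrix (Fin 2) (Fin 2) ℂ) (hA : A.det ≠ 0) :
    (phiUnit i A hA : Matrix (Fin n) (Fin n) ℂ) = phi i A := rfl

theorem relPos_mul_phi (g : GL (Fin n) ℂ) {i : Fin (n - 1)} {A : Matrix (Fin 2) (Fin 2) ℂ}
    {h : GL (Fin n) ℂ} (hh : (h : Matrix (Fin n) (Fin n) ℂ) = phi i A) (hdet : A.det = 1)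
    (hA : A 1 0 ≠ 0) :
    RelPos (Equiv.swap (lo i) (hi i)) (toFlag g) (toFlag (g * h)) := by
  rw [Matrix.det_fin_two] at hdet
  -- the Bruhat decomposition of `A`
  refine ⟨g, _, rfl, rfl, phiUnit i !![1, A 0 0 / A 1 0; 0, 1] (by simp [Matrix.det_fin_two]),
    phi_mem_borel i (by simp) (phiUnit_coe _ _ _),
    phiUnit i !![A 1 0, A 1 1; 0, -1 / A 1 0] (by simp [Matrix.det_fin_two, hA]),
    phi_mem_borel i (by simp) (phiUnit_coe _ _ _), ?_⟩
  rw [inv_mul_cancel_left, permMat_swap, hh, phiUnit_coe, phiUnit_coe, ← phi_mul, ← phi_mul]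
  congr 1
  ext r c
  fin_cases r <;> fin_cases c <;> simp [Matrix.mul_apply, Fin.sum_univ_two]
  · field_simp
  · field_simp
    linear_combination -hdet

theorem toFlag_mul_borel (g : GL (Fin n) ℂ) {b : GL (Fin n) ℂ} (hb : b ∈ borel n) :
    toFlag (g * b) = toFlag g := by
  symm
  rw [toFlag, toFlag, QuotientGroup.eq, inv_mul_cancel_left]
  exact hb

/-- The cell `B s_i B / B` is parametrized by the matrices `x_i(m) ṡ_i`. -/
theorem toFlag_mul_borel_mul_swap (g : GL (Fin n) ℂ) {i : Fin (n - 1)} {b s : GL (Fin n) ℂ}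
    (hb : b ∈ borel n) (hs : (s : Matrix (Fin n) (Fin n) ℂ) = phi i !![0, 1; 1, 0]) :
    toFlag (g * b * s) = toFlag (g * (xMat i ((b : Matrix (Fin n) (Fin n) ℂ) (lo i) (hi i) /
      (b : Matrix (Fin n) (Fin n) ℂ) (hi i) (hi i)) * sDot i)) := by
  have hbd : (b : Matrix (Fin n) (Fin n) ℂ) (hi i) (hi i) ≠ 0 := by
    have hdet : (b : Matrix (Fin n) (Fin n) ℂ).det ≠ 0 :=
      ((Matrix.isUnit_iff_isUnit_det _).1 b.isUnit).ne_zero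
    rw [Matrix.det_of_isUpperTriangular (M := (b : Matrix (Fin n) (Fin n) ℂ))
      (fun r c hrc => mem_borel.1 hb r c hrc)] at hdet
    exact Finset.prod_ne_zero_iff.1 hdet _ (Finset.mem_univ _)
  have hnb : IsNeighbor i (g * b * s) (g * (xMat i ((b : Matrix (Fin n) (Fin n) ℂ) (lo i) (hi i) /
      (b : Matrix (Fin n) (Fin n) ℂ) (hi i) (hi i)) * sDot i)) :=
    (isNeighbor_mul_phi (g * b) hs).symm.trans
      ((isNeighbor_of_toFlag_eq i (toFlag_mul_borel g hb)).trans
        (isNeighbor_mul_xMat_mul_sDot g i _))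
  apply hnb.toFlag_eq
  apply colSpan_eq_of_le
  rw [colSpan_le]
  intro j hj
  by_cases hjl : j = lo i
  · subst hjl
    have hx : (fun r => ((g * b * s : GL (Fin n) ℂ) : Matrix (Fin n) (Fin n) ℂ) r (lo i)) =
        (g : Matrix (Fin n) (Fin n) ℂ) *ᵥ
          fun r => (b : Matrix (Fin n) (Fin n) ℂ) r (hi i) := by
      ext r
      rw [Units.val_mul _ s, hs, mul_phi_lo, Units.val_mul]
      simp [Matrix.mul_apply, Matrix.mulVec, dotProduct]
    rw [hx]
    refine mem_colSpan_mul_xMat g i (x := fun r => (b : Matrix (Fin n) (Fin n) ℂ) r (hi i))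
      (fun j hj => ?_) hbd
    apply mem_borel.1 hb
    rw [Fin.lt_def, hi_val]
    omega
  · have hj' : j.val < i.val := by
      have : j.val ≠ i.val := fun e => hjl (Fin.ext e)
      omega
    apply colSpan_mono _ (Nat.le_succ i.val)
    rw [← hnb i.val (by omega)]
    exact col_mem_colSpan _ hj'

theorem exists_of_relPos {g : GL (Fin n) ℂ} {i : Fin (n - 1)} {F : Flag n}
    (h : RelPos (Equiv.swap (lo i) (hi i)) (toFlag g) F) :
    ∃ m : ℂ, F = toFlag (g * (xMat i m * sDot i)) := by
  obtain ⟨g₁, g₂, h1, rfl, b, hb, b', hb', hbb⟩ := h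
  have hβ : (g₁⁻¹ * g)⁻¹ * b ∈ borel n :=
    (borel n).mul_mem ((borel n).inv_mem (QuotientGroup.eq.1 h1)) hb
  obtain ⟨s, hs⟩ : ∃ s : GL (Fin n) ℂ, (s : Matrix (Fin n) (Fin n) ℂ) = phi i !![0, 1; 1, 0] :=
    ⟨_, phiUnit_coe i _ (by simp [Matrix.det_fin_two])⟩
  have e1 : g₁⁻¹ * g₂ = b * s * b' := by
    apply Units.ext
    rw [hbb, permMat_swap, Units.val_mul, Units.val_mul, hs]
  have e2 : g₂ = g * ((g₁⁻¹ * g)⁻¹ * b) * s * b' := by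
    have : g₂ = g₁ * (b * s * b') := by
      rw [← e1, mul_inv_cancel_left]
    rw [this]
    group
  refine ⟨_, Eq.trans ?_ (toFlag_mul_borel_mul_swap g hβ hs)⟩
  conv_lhs => rw [e2]
  exact toFlag_mul_borel _ hb'

theorem toFlag_mul_xMat_ne (g : GL (Fin n) ℂ) (i : Fin (n - 1)) (m : ℂ) :
    toFlag g ≠ toFlag (g * (xMat i m * sDot i)) := by
  intro h
  have h1 := QuotientGroup.eq.1 h
  rw [inv_mul_cancel_left, mem_borel] at h1
  have h2 := h1 (hi i) (lo i) (by rw [Fin.lt_def, lo_val, hi_val]; omega)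
  rw [xMat_mul_sDot_coe] at h2
  simp [phi, (lo_ne_hi i).symm] at h2

theorem relPos_isNeighbor {g h : GL (Fin n) ℂ} {i : Fin (n - 1)}
    (hr : RelPos (Equiv.swap (lo i) (hi i)) (toFlag g) (toFlag h)) :
    IsNeighbor i g h ∧ toFlag g ≠ toFlag h := by
  obtain ⟨m, hm⟩ := exists_of_relPos hr
  refine ⟨(isNeighbor_mul_xMat_mul_sDot g i m).trans (isNeighbor_of_toFlag_eq i hm.symm), ?_⟩
  rw [hm]
  exact toFlag_mul_xMat_ne g i m

theorem RelPos.symm {i : Fin (n - 1)} {F F' : Flag n}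
    (h : RelPos (Equiv.swap (lo i) (hi i)) F F') : RelPos (Equiv.swap (lo i) (hi i)) F' F := by
  obtain ⟨g₁, g₂, rfl, rfl, b, hb, b', hb', hbb⟩ := h
  obtain ⟨s, hs'⟩ : ∃ s : GL (Fin n) ℂ, (s : Matrix (Fin n) (Fin n) ℂ) = phi i !![0, 1; 1, 0] :=
    ⟨_, phiUnit_coe i _ (by simp [Matrix.det_fin_two])⟩
  have hs : (s : Matrix (Fin n) (Fin n) ℂ) = permMat (Equiv.swap (lo i) (hi i)) := by
    rw [hs', permMat_swap]
  have hss : s * s = 1 := by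
    apply Units.ext
    rw [Units.val_mul, hs, permMat_swap, ← phi_mul, Units.val_one, ← phi_one i]
    congr 1
    ext r c
    fin_cases r <;> fin_cases c <;> simp [Matrix.mul_apply, Fin.sum_univ_two]
  have hsi : s⁻¹ = s := inv_eq_of_mul_eq_one_left hss
  have e1 : g₁⁻¹ * g₂ = b * s * b' := by
    apply Units.ext
    rw [hbb, Units.val_mul, Units.val_mul, hs]
  refine ⟨g₂, g₁, rfl, rfl, b'⁻¹, (borel n).inv_mem hb', b⁻¹, (borel n).inv_mem hb, ?_⟩
  rw [← hs, ← Units.val_mul, ← Units.val_mul]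
  congr 1
  have e2 : (g₁⁻¹ * g₂)⁻¹ = (b * s * b')⁻¹ := by rw [e1]
  rw [_root_.mul_inv_rev, inv_inv] at e2
  rw [e2, _root_.mul_inv_rev, _root_.mul_inv_rev, hsi, mul_assoc]

end

section

variable {n : ℕ} [NeZero n]

/-! ### Jumps and flattenings -/

theorem mem_jumps {a : Fin n → Fin n} {k : Fin n} : k ∈ jumps a ↔ a k ≠ nextEntry a k := by
  simp [jumps]

theorem nextEntry_eq {a : Fin n → Fin n} {k l : Fin n} (h : l.val = k.val + 1) :
    nextEntry a k = a l := by
  rw [nextEntry, dif_pos (by have := l.isLt; omega)]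
  congr 1
  exact Fin.ext h.symm

theorem nextEntry_last {a : Fin n → Fin n} {k : Fin n} (h : k.val + 1 = n) :
    nextEntry a k = 0 := by
  rw [nextEntry, dif_neg (by omega)]

theorem apply_hi_eq {a : Fin n → Fin n} {i : Fin (n - 1)} (h : lo i ∉ jumps a) :
    a (hi i) = a (lo i) := by
  rw [mem_jumps, not_not, nextEntry_eq (l := hi i) rfl] at h
  exact h.symm

theorem eq_zero_of_jumps_eq_empty {a : Fin n → Fin n} (h : jumps a = ∅) (k : Fin n) : a k = 0 := by
  have hk : ∀ (m : ℕ) (k : Fin n), k.val + m + 1 = n → a k = 0 := by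
    intro m
    induction m with
    | zero =>
      intro k hk
      have h1 : k ∉ jumps a := by simp [h]
      rw [mem_jumps, not_not, nextEntry_last (by omega)] at h1
      exact h1
    | succ m ih =>
      intro k hk
      have h1 : k ∉ jumps a := by simp [h]
      rw [mem_jumps, not_not, nextEntry_eq (l := ⟨k.val + 1, by omega⟩) rfl] at h1
      rw [h1]
      exact ih _ (by simp only; omega)
  have := k.isLt
  exact hk (n - 1 - k.val) k (by omega)

theorem minJump_mem {a : Fin n → Fin n} (h : jumps a ≠ ∅) : minJump a ∈ jumps a := by
  rw [minJump, dif_pos (Finset.nonempty_iff_ne_empty.2 h)]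
  exact Finset.min'_mem _ _

theorem minJump_le {a : Fin n → Fin n} {k : Fin n} (hk : k ∈ jumps a) : minJump a ≤ k := by
  rw [minJump, dif_pos ⟨k, hk⟩]
  exact Finset.min'_le _ _ hk

theorem apply_eq_of_le_minJump {a : Fin n → Fin n} {k : Fin n} (hk : k ≤ minJump a) :
    a k = a 0 := by
  have h : ∀ (m : ℕ) (k : Fin n), k.val = m → k ≤ minJump a → a k = a 0 := by
    intro m
    induction m with
    | zero =>
      intro k hk _
      rw [show k = 0 from Fin.ext (by simpa using hk)]
    | succ m ih =>
      intro k hk hle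
      have hkn := k.isLt
      have h1 : (⟨m, by omega⟩ : Fin n) ∉ jumps a := by
        intro hmem
        have := minJump_le hmem
        rw [Fin.le_def] at this hle
        simp only at this
        omega
      rw [mem_jumps, not_not, nextEntry_eq (l := k) hk] at h1
      rw [← h1]
      refine ih _ rfl ?_
      rw [Fin.le_def] at hle ⊢
      simp only
      omega
  exact h _ k rfl hk

theorem apply_zero_ne {a : Fin n → Fin n} (h : jumps a ≠ ∅) : a 0 ≠ nextEntry a (minJump a) := by
  have h1 := mem_jumps.1 (minJump_mem h)
  rwa [apply_eq_of_le_minJump (a := a) le_rfl] at h1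

theorem flatten_of_le {a : Fin n → Fin n} {k : Fin n} (hk : k ≤ minJump a) :
    flatten a k = nextEntry a (minJump a) := if_pos hk

theorem flatten_of_lt {a : Fin n → Fin n} {k : Fin n} (hk : minJump a < k) :
    flatten a k = a k := if_neg (not_le.2 hk)

theorem nextEntry_flatten {a : Fin n → Fin n} {k : Fin n} (hk : minJump a ≤ k) :
    nextEntry (flatten a) k = nextEntry a k := by
  by_cases h : k.val + 1 < n
  · rw [nextEntry_eq (l := ⟨k.val + 1, h⟩) rfl, nextEntry_eq (l := ⟨k.val + 1, h⟩) rfl]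
    apply flatten_of_lt
    rw [Fin.lt_def]
    rw [Fin.le_def] at hk
    simp only
    omega
  · have := k.isLt
    rw [nextEntry_last (by omega), nextEntry_last (by omega)]

theorem mem_jumps_flatten {a : Fin n → Fin n} {k : Fin n} :
    k ∈ jumps (flatten a) ↔ k ∈ jumps a ∧ k ≠ minJump a := by
  rw [mem_jumps, mem_jumps]
  rcases lt_trichotomy k (minJump a) with h | rfl | h
  · have hk : k ∉ jumps a := fun hk => absurd (minJump_le hk) (not_le.2 h)
    rw [mem_jumps, not_not] at hk
    have hlt := (minJump a).isLt
    rw [Fin.lt_def] at h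
    have h1 : flatten a k = nextEntry (flatten a) k := by
      rw [nextEntry_eq (l := ⟨k.val + 1, by omega⟩) rfl, flatten_of_le (Fin.le_def.2 h.le),
        flatten_of_le]
      rw [Fin.le_def]
      simp only
      omega
    simp [← h1, ← hk]
  · simp [flatten_of_le le_rfl, nextEntry_flatten le_rfl]
  · rw [flatten_of_lt h, nextEntry_flatten h.le]
    simp [h.ne']

theorem jumps_flatten_subset (a : Fin n → Fin n) : jumps (flatten a) ⊆ jumps a :=
  fun _ hk => (mem_jumps_flatten.1 hk).1

theorem tiltedSim_iff {a : Fin n → Fin n} {u v : Equiv.Perm (Fin n)} :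
    TiltedSim a u v ↔ ∀ k ∈ jumps a,
      (firstSet u (k.val + 1) ∩ cyclicIco (a k) (nextEntry a k)).card =
        (firstSet v (k.val + 1) ∩ cyclicIco (a k) (nextEntry a k)).card := by
  simp only [TiltedSim, initialSet_eq]
  refine ⟨fun h k _ => h k, fun h k => ?_⟩
  by_cases hk : k ∈ jumps a
  · exact h k hk
  · rw [mem_jumps, not_not] at hk
    simp [← hk, cyclicIco]

theorem TiltedSim.congr {a : Fin n → Fin n} {u v u' v' : Equiv.Perm (Fin n)}
    (h : TiltedSim a u v)
    (hu : ∀ k ∈ jumps a, firstSet u' (k.val + 1) = firstSet u (k.val + 1))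
    (hv : ∀ k ∈ jumps a, firstSet v' (k.val + 1) = firstSet v (k.val + 1)) :
    TiltedSim a u' v' := by
  rw [tiltedSim_iff] at h ⊢
  intro k hk
  rw [hu k hk, hv k hk]
  exact h k hk

theorem firstSet_mul_swap_of_mem_jumps {a : Fin n → Fin n} {i : Fin (n - 1)}
    (hi : lo i ∉ jumps a) (w : Equiv.Perm (Fin n)) {k : Fin n} (hk : k ∈ jumps a) :
    firstSet (w * Equiv.swap (lo i) (TiltedDeodhar.hi i)) (k.val + 1) =
      firstSet w (k.val + 1) := by
  apply firstSet_mul_swap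
  intro h
  apply hi
  rwa [show lo i = k from Fin.ext (by rw [lo_val]; omega)]

theorem TiltedSim.flatten {a : Fin n → Fin n} {u v : Equiv.Perm (Fin n)}
    (h : TiltedSim a u v) : TiltedSim (flatten a) u v := by
  rw [tiltedSim_iff] at h ⊢
  intro k hk
  obtain ⟨hk1, hk2⟩ := mem_jumps_flatten.1 hk
  have hlt := lt_of_le_of_ne (minJump_le hk1) hk2.symm
  rw [flatten_of_lt hlt, nextEntry_flatten hlt.le]
  exact h k hk1

/-! ### Flattenable permutations -/

/-- The cyclic interval `[a_1, a_{q+1})_c` attached to the minimum jump `q` of `a`. -/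
def jumpInterval (a : Fin n → Fin n) : Finset (Fin n) :=
  cyclicIco (a 0) (nextEntry a (minJump a))

/-- `w` is `a`-flattenable, `p` entries being in the interval `[a_1, a_{q+1})_c`. -/
def FlattenableAt (a : Fin n → Fin n) (p : ℕ) (w : Equiv.Perm (Fin n)) : Prop :=
  p ≤ (minJump a).val + 1 ∧ ∀ i : Fin n, i ≤ minJump a → (w i ∈ jumpInterval a ↔ i.val < p)

theorem flattenable_iff {a : Fin n → Fin n} (ha : jumps a ≠ ∅) {w : Equiv.Perm (Fin n)} :
    Flattenable a w ↔ ∃ p, FlattenableAt a p w := by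
  refine exists_congr fun p => and_congr_right fun _ => forall₂_congr fun i _ => ?_
  rw [mem_cyclicIco_swap (apply_zero_ne ha)]
  change (i.val < p → w i ∈ jumpInterval a) ∧ (p ≤ i.val → w i ∉ jumpInterval a) ↔ _
  constructor
  · rintro ⟨h1, h2⟩
    exact ⟨fun h => not_le.1 fun h' => h2 h' h, h1⟩
  · intro h
    exact ⟨h.2, fun h' h3 => absurd (h.1 h3) (not_lt.2 h')⟩

theorem FlattenableAt.card_inter {a : Fin n → Fin n} {p : ℕ} {w : Equiv.Perm (Fin n)}
    (h : FlattenableAt a p w) {k : ℕ} (hk : k ≤ (minJump a).val + 1) :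
    (firstSet w k ∩ jumpInterval a).card = min k p := by
  have hlt := (minJump a).isLt
  have e : firstSet w k ∩ jumpInterval a = firstSet w (min k p) := by
    ext x
    obtain ⟨i, rfl⟩ := w.surjective x
    rw [Finset.mem_inter, apply_mem_firstSet, apply_mem_firstSet, lt_min_iff]
    refine and_congr_right fun hik => h.2 i ?_
    rw [Fin.le_def]
    omega
  rw [e, card_firstSet]
  have := h.1
  omega

theorem jump_card_eq {a : Fin n → Fin n} {u v : Equiv.Perm (Fin n)} (ha : jumps a ≠ ∅)
    (hsim : TiltedSim a u v) :
    (firstSet u ((minJump a).val + 1) ∩ jumpInterval a).card =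
      (firstSet v ((minJump a).val + 1) ∩ jumpInterval a).card := by
  have h := tiltedSim_iff.1 hsim _ (minJump_mem ha)
  rwa [apply_eq_of_le_minJump (a := a) le_rfl] at h

theorem FlattenableAt.eq {a : Fin n → Fin n} {u v : Equiv.Perm (Fin n)} (ha : jumps a ≠ ∅)
    (hsim : TiltedSim a u v) {p p' : ℕ} (hu : FlattenableAt a p u) (hv : FlattenableAt a p' v) :
    p = p' := by
  have h := jump_card_eq ha hsim
  rw [hu.card_inter le_rfl, hv.card_inter le_rfl] at h
  have h1 := hu.1
  have h2 := hv.1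
  omega

theorem card_inter_flatten {a : Fin n → Fin n} {u v : Equiv.Perm (Fin n)} {p : ℕ}
    (hu : FlattenableAt a p u) (hv : FlattenableAt a p v) (k : Fin n) :
    (firstSet u (k.val + 1) ∩ cyclicIco (a k) (flatten a k)).card =
      (firstSet v (k.val + 1) ∩ cyclicIco (a k) (flatten a k)).card := by
  rcases le_or_gt k (minJump a) with hk | hk
  · rw [apply_eq_of_le_minJump hk, flatten_of_le hk]
    have hk' : k.val + 1 ≤ (minJump a).val + 1 := Nat.succ_le_succ hk
    exact (hu.card_inter hk').trans (hv.card_inter hk').symm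
  · rw [flatten_of_lt hk]
    simp [cyclicIco]

theorem HasExtremes.flatten {a : Fin n → Fin n} {u v : Equiv.Perm (Fin n)} {p : ℕ}
    {g : GL (Fin n) ℂ} (h : HasExtremes u v a g) (hu : FlattenableAt a p u)
    (hv : FlattenableAt a p v) : HasExtremes u v (flatten a) g :=
  h.change_seq (card_inter_flatten hu hv)

theorem HasExtremes.of_flatten {a : Fin n → Fin n} {u v : Equiv.Perm (Fin n)} {p : ℕ}
    {g : GL (Fin n) ℂ} (h : HasExtremes u v (TiltedDeodhar.flatten a) g)
    (hu : FlattenableAt a p u) (hv : FlattenableAt a p v) : HasExtremes u v a g :=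
  h.change_seq_symm (card_inter_flatten hu hv)

/-- If the open tilted Richardson variety of `u`, `v` has a point and `v` is flattenable, then so
is `u`. -/
theorem FlattenableAt.of_hasExtremes {a : Fin n → Fin n} {u v : Equiv.Perm (Fin n)} {p : ℕ}
    {g : GL (Fin n) ℂ} (ha : jumps a ≠ ∅) (hsim : TiltedSim a u v) (h : HasExtremes u v a g)
    (hv : FlattenableAt a p v) : FlattenableAt a p u := by
  have hlt := (minJump a).isLt
  have hp := hv.1
  have hsub : firstSet u p ⊆ jumpInterval a := by
    rcases Nat.eq_zero_or_pos p with rfl | hpos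
    · rw [firstSet_zero]
      exact Finset.empty_subset _
    have h1 := h ⟨p - 1, by omega⟩
    have hle : (⟨p - 1, by omega⟩ : Fin n) ≤ minJump a := by
      rw [Fin.le_def]
      simp only
      omega
    rw [apply_eq_of_le_minJump hle] at h1
    simp only [Nat.sub_add_cancel hpos] at h1
    have hvs : firstSet v p ⊆ jumpInterval a := by
      intro x hx
      obtain ⟨i, rfl⟩ := v.surjective x
      rw [apply_mem_firstSet] at hx
      exact (hv.2 i (by rw [Fin.le_def]; omega)).2 hx
    rw [← h1.1] at hvs
    rw [← h1.2]
    apply leads_subset_of_le_coordSub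
    intro f hf
    exact mem_coordSub_of_leads (isLowerFor_keyUp _ _) hvs hf
  refine ⟨hp, fun i hi => ⟨fun hmem => ?_, fun hip => hsub (apply_mem_firstSet.2 hip)⟩⟩
  have hcard := jump_card_eq ha hsim
  rw [hv.card_inter le_rfl, min_eq_right hp] at hcard
  have heq : firstSet u p = firstSet u ((minJump a).val + 1) ∩ jumpInterval a := by
    apply Finset.eq_of_subset_of_card_le
    · intro x hx
      refine Finset.mem_inter.2 ⟨?_, hsub hx⟩
      rw [mem_firstSet] at hx ⊢
      omega
    · rw [hcard, card_firstSet u (by omega)]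
  rw [← apply_mem_firstSet (w := u), heq, Finset.mem_inter, apply_mem_firstSet]
  exact ⟨Nat.lt_succ_of_le hi, hmem⟩

/-! ### Simple steps -/

theorem tiltedLE_refl {n : ℕ} (a : Fin n → Fin n) (u : Equiv.Perm (Fin n)) : TiltedLE a u u :=
  fun _ => galeLE_refl _ _

theorem tiltedLE_mul_swap_iff {n : ℕ} {a : Fin n → Fin n} {u : Equiv.Perm (Fin n)} {i : Fin (n - 1)} :
    TiltedLE a u (u * Equiv.swap (lo i) (hi i)) ↔
      keyUp (a (lo i)) (u (lo i)) ≤ keyUp (a (lo i)) (u (hi i)) := by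
  have h1 : u (lo i) ∉ firstSet u i.val := by
    rw [apply_mem_firstSet, lo_val]
    omega
  have h2 : u (hi i) ∉ firstSet u i.val := by
    rw [apply_mem_firstSet, hi_val]
    omega
  constructor
  · intro h
    have := h (lo i)
    rwa [initialSet_eq, initialSet_eq, lo_val, firstSet_mul_swap_succ, firstSet_lo_succ,
      galeLE_insert_iff h1 h2] at this
  · intro h k
    by_cases hk : k = lo i
    · subst hk
      rwa [initialSet_eq, initialSet_eq, lo_val, firstSet_mul_swap_succ, firstSet_lo_succ,
        galeLE_insert_iff h1 h2]
    · have hk' : k.val + 1 ≠ i.val + 1 := fun e => hk (Fin.ext (by rw [lo_val]; omega))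
      rw [initialSet_eq, initialSet_eq, firstSet_mul_swap u i hk']
      exact galeLE_refl _ _

theorem keyUp_lo_ne_hi {n : ℕ} (r : Fin n) (u : Equiv.Perm (Fin n)) (i : Fin (n - 1)) :
    keyUp r (u (lo i)) ≠ keyUp r (u (hi i)) :=
  fun h => lo_ne_hi i (u.injective (keyUp_injective r h))

theorem tiltedLT_mul_swap_iff {n : ℕ} {a : Fin n → Fin n} {u : Equiv.Perm (Fin n)} {i : Fin (n - 1)} :
    TiltedLT a u (u * Equiv.swap (lo i) (hi i)) ↔
      keyUp (a (lo i)) (u (lo i)) < keyUp (a (lo i)) (u (hi i)) := by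
  rw [TiltedLT, tiltedLE_mul_swap_iff]
  exact ⟨fun h => lt_of_le_of_ne h.1 (keyUp_lo_ne_hi _ u i),
    fun h => ⟨h.le, (mul_swap_ne_self u i).symm⟩⟩

theorem mul_swap_tiltedLT_iff {n : ℕ} {a : Fin n → Fin n} {u : Equiv.Perm (Fin n)} {i : Fin (n - 1)} :
    TiltedLT a (u * Equiv.swap (lo i) (hi i)) u ↔
      keyUp (a (lo i)) (u (hi i)) < keyUp (a (lo i)) (u (lo i)) := by
  have := tiltedLT_mul_swap_iff (a := a) (u := u * Equiv.swap (lo i) (hi i)) (i := i)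
  rwa [mul_swap_mul_swap, mul_swap_lo, mul_swap_hi] at this

theorem TiltedSim.mul_swap_left {a : Fin n → Fin n} {u v : Equiv.Perm (Fin n)} {i : Fin (n - 1)}
    (hi : lo i ∉ jumps a) (h : TiltedSim a u v) :
    TiltedSim a (u * Equiv.swap (lo i) (TiltedDeodhar.hi i)) v :=
  h.congr (fun _ hk => firstSet_mul_swap_of_mem_jumps hi u hk) fun _ _ => rfl

theorem TiltedSim.mul_swap_right {a : Fin n → Fin n} {u v : Equiv.Perm (Fin n)} {i : Fin (n - 1)}
    (hi : lo i ∉ jumps a) (h : TiltedSim a u v) :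
    TiltedSim a u (v * Equiv.swap (lo i) (TiltedDeodhar.hi i)) :=
  h.congr (fun _ _ => rfl) fun _ hk => firstSet_mul_swap_of_mem_jumps hi v hk

theorem HasExtremes.leadsAround {a : Fin n → Fin n} {u v : Equiv.Perm (Fin n)} {i : Fin (n - 1)}
    {g : GL (Fin n) ℂ} (hi : lo i ∉ jumps a) (hsim : TiltedSim a u v) (h : HasExtremes u v a g) :
    LeadsAround (keyUp (a (lo i))) i v g ∧ LeadsAround (keyDown (a (lo i))) i u g := by
  have h0 := leads_prev hsim (l := lo i) (fun k _ => h k)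
  have h1 := h (lo i)
  have h2 := h (TiltedDeodhar.hi i)
  rw [apply_hi_eq hi] at h2
  exact ⟨⟨h0.1, h1.1, h2.1⟩, ⟨h0.2, h1.2, h2.2⟩⟩

theorem HasExtremes.of_isNeighbor {n : ℕ} {a : Fin n → Fin n} {u v u' v' : Equiv.Perm (Fin n)}
    {i : Fin (n - 1)} {g h : GL (Fin n) ℂ} (hg : HasExtremes u v a g) (hgh : IsNeighbor i g h)
    (hu : u' = u ∨ u' = u * Equiv.swap (lo i) (hi i))
    (hv : v' = v ∨ v' = v * Equiv.swap (lo i) (hi i))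
    (h1 : leads (keyUp (a (lo i))) (colSpan (h : Matrix (Fin n) (Fin n) ℂ) (i.val + 1)) =
      firstSet v' (i.val + 1))
    (h2 : leads (keyDown (a (lo i))) (colSpan (h : Matrix (Fin n) (Fin n) ℂ) (i.val + 1)) =
      firstSet u' (i.val + 1)) : HasExtremes u' v' a h := by
  have same : ∀ {w w' : Equiv.Perm (Fin n)}, w' = w ∨ w' = w * Equiv.swap (lo i) (hi i) →
      ∀ {k : ℕ}, k ≠ i.val + 1 → firstSet w' k = firstSet w k := by
    rintro w w' (rfl | rfl) k hk
    · rfl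
    · exact firstSet_mul_swap w i hk
  intro k
  by_cases hk : k = lo i
  · subst hk
    exact ⟨h1, h2⟩
  · have hk' : k.val + 1 ≠ i.val + 1 := fun e => hk (Fin.ext (by rw [lo_val]; omega))
    rw [← hgh _ hk', same hu hk', same hv hk']
    exact hg k

/-- Going down one step: the pencil of flags around a point of the variety of `u`, `v` contains a
further point whose upper extreme is `v s_i`. Its lower extreme `u'` satisfies the condition
`u ≤ u' s_i` for distinguished subwords. If `v` has a descent at `i`, this is the special point of
the pencil. -/
theorem HasExtremes.exists_down {a : Fin n → Fin n} {u v : Equiv.Perm (Fin n)} {i : Fin (n - 1)}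
    {g : GL (Fin n) ℂ} (hi : lo i ∉ jumps a) (hsim : TiltedSim a u v) (h : HasExtremes u v a g) :
    ∃ (h' : GL (Fin n) ℂ) (u' : Equiv.Perm (Fin n)),
      (u' = u ∨ u' = u * Equiv.swap (lo i) (TiltedDeodhar.hi i)) ∧
      RelPos (Equiv.swap (lo i) (TiltedDeodhar.hi i)) (toFlag h') (toFlag g) ∧
      HasExtremes u' (v * Equiv.swap (lo i) (TiltedDeodhar.hi i)) a h' ∧
      TiltedLE a u (u' * Equiv.swap (lo i) (TiltedDeodhar.hi i)) := by
  obtain ⟨hup, hdown⟩ := h.leadsAround hi hsim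
  obtain ⟨m, hm⟩ := hup.exists_lower (keyUp_injective _)
  have hnb := isNeighbor_mul_xMat_mul_sDot g i m
  refine ⟨g * (xMat i m * sDot i), ?_⟩
  have hrel : RelPos (Equiv.swap (lo i) (TiltedDeodhar.hi i))
      (toFlag (g * (xMat i m * sDot i))) (toFlag g) :=
    (relPos_mul_phi g (xMat_mul_sDot_coe i m) (by simp [Matrix.det_fin_two]) (by simp)).symm
  rcases lt_or_gt_of_ne (keyUp_lo_ne_hi (a (lo i)) u i) with hu | hu
  · rcases leadsAround_dichotomy (keyDown_injective _) hdown hnb with h1 | h1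
    · exact ⟨u, Or.inl rfl, hrel, h.of_isNeighbor hnb (Or.inl rfl) (Or.inr rfl) hm h1,
        tiltedLE_mul_swap_iff.2 hu.le⟩
    · refine ⟨_, Or.inr rfl, hrel, h.of_isNeighbor hnb (Or.inr rfl) (Or.inr rfl) hm h1, ?_⟩
      rw [mul_swap_mul_swap]
      exact tiltedLE_refl a u
  · have h1 := hdown.of_ne (keyDown_injective _) hnb
      (by simp only [keyDown_eq]; omega) (toFlag_mul_xMat_ne g i m)
    refine ⟨_, Or.inr rfl, hrel, h.of_isNeighbor hnb (Or.inr rfl) (Or.inr rfl) hm h1, ?_⟩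
    rw [mul_swap_mul_swap]
    exact tiltedLE_refl a u

/-- The neighbour in the previous cell is unique. -/
theorem down_unique {n : ℕ} {κ : Fin n → ℤ} (hκ : Function.Injective κ) {i : Fin (n - 1)}
    {v : Equiv.Perm (Fin n)} {h h' : GL (Fin n) ℂ}
    (hh : LeadsAround κ i v h) (hh' : LeadsAround κ i v h') (hnb : IsNeighbor i h h')
    (hlt : κ (v (lo i)) < κ (v (hi i))) : toFlag h = toFlag h' :=
  hh.unique hκ hnb hlt hh'.2.1

/-- Going up one step: if `v` has an ascent at `i`, a point of the variety of `u`, `v` is the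
special one of its pencil, and all other points of the pencil have the upper extreme `v s_i`. -/
theorem HasExtremes.up {a : Fin n → Fin n} {u v u' : Equiv.Perm (Fin n)} {i : Fin (n - 1)}
    {g h : GL (Fin n) ℂ} (hi : lo i ∉ jumps a) (hsim : TiltedSim a u v) (hg : HasExtremes u v a g)
    (hlt : keyUp (a (lo i)) (v (lo i)) < keyUp (a (lo i)) (v (TiltedDeodhar.hi i)))
    (hnb : IsNeighbor i g h) (hne : toFlag g ≠ toFlag h)
    (hu : u' = u ∨ u' = u * Equiv.swap (lo i) (TiltedDeodhar.hi i))
    (h2 : leads (keyDown (a (lo i))) (colSpan (h : Matrix (Fin n) (Fin n) ℂ) (i.val + 1)) =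
      firstSet u' (i.val + 1)) :
    HasExtremes u' (v * Equiv.swap (lo i) (TiltedDeodhar.hi i)) a h :=
  hg.of_isNeighbor hnb hu (Or.inr rfl)
    ((hg.leadsAround hi hsim).1.of_ne (keyUp_injective _) hnb hlt hne) h2

end

section

variable {n : ℕ} [NeZero n]

/-! ### Tilted words -/

theorem wordProd_append {n : ℕ} (w w' : List (Factor n)) :
    wordProd (w ++ w') = wordProd w * wordProd w' := by
  simp [wordProd]

theorem wordProd_nil {n : ℕ} : wordProd ([] : List (Factor n)) = 1 := rfl

theorem wordProd_singleton {n : ℕ} (x : Factor n) : wordProd [x] = x.perm := by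
  simp [wordProd]

theorem plainWord_append {n : ℕ} (t t' : List (Fin (n - 1))) :
    plainWord (t ++ t') = plainWord t ++ plainWord t' := List.map_append

theorem bar_notMem_plainWord {n : ℕ} (t : List (Fin (n - 1))) : Factor.bar ∉ plainWord t := by
  simp [plainWord]

theorem isTiltedWord_nil_iff {a : Fin n → Fin n} : IsTiltedWord a [] ↔ jumps a = ∅ := by
  constructor
  · intro h
    generalize hw : ([] : List (Factor n)) = w at h
    cases h with
    | base _ ha _ => exact ha
    | step _ _ w _ _ t _ => simp at hw
  · intro ha
    exact IsTiltedWord.base a ha []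

theorem isTiltedWord_concat_s {a : Fin n → Fin n} {w : List (Factor n)} {i : Fin (n - 1)} :
    IsTiltedWord a (w ++ [Factor.s i]) ↔ IsTiltedWord a w ∧ lo i ∉ jumps a := by
  constructor
  · intro h
    generalize hw : w ++ [Factor.s i] = w' at h
    cases h with
    | base _ ha t =>
      refine ⟨?_, by simp [ha]⟩
      obtain ⟨t₁, t₂, -, h1, -⟩ := List.map_eq_append_iff.1 hw.symm
      rw [← h1]
      exact IsTiltedWord.base a ha t₁
    | step _ ha x hx hf t ht =>
      rcases List.eq_nil_or_concat t with rfl | ⟨t', i', rfl⟩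
      · have := congrArg List.getLast? hw
        simp [plainWord] at this
      · rw [List.concat_eq_append, plainWord_append, ← List.cons_append, ← List.append_assoc] at hw
        have h1 := List.append_inj' hw (by simp [plainWord])
        have h2 : i = i' := by simpa [plainWord] using h1.2
        subst h2
        rw [h1.1]
        exact ⟨IsTiltedWord.step a ha x hx hf t' fun k hk => ht k (by simp [hk]),
          ht i (by simp)⟩
  · rintro ⟨h, hi⟩
    cases h with
    | base _ ha t =>
      have := IsTiltedWord.base a ha (t ++ [i])
      rwa [plainWord_append] at this
    | step _ ha x hx hf t ht =>
      have := IsTiltedWord.step a ha x hx hf (t ++ [i]) (by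
        intro k hk
        rcases List.mem_append.1 hk with hk | hk
        · exact ht k hk
        · rw [List.mem_singleton.1 hk]
          exact hi)
      rwa [plainWord_append, ← List.cons_append, ← List.append_assoc] at this

theorem isTiltedWord_concat_bar {a : Fin n → Fin n} {w : List (Factor n)} :
    IsTiltedWord a (w ++ [Factor.bar]) ↔
      jumps a ≠ ∅ ∧ IsTiltedWord (flatten a) w ∧ Flattenable a (wordProd w) := by
  constructor
  · intro h
    generalize hw : w ++ [Factor.bar] = w' at h
    cases h with
    | base _ ha t =>
      exfalso
      apply bar_notMem_plainWord t
      rw [← hw]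
      simp
    | step _ ha x hx hf t ht =>
      rcases List.eq_nil_or_concat t with rfl | ⟨t', i', rfl⟩
      · have h1 := List.append_inj' hw (by simp [plainWord])
        rw [h1.1]
        exact ⟨ha, hx, hf⟩
      · rw [List.concat_eq_append, plainWord_append, ← List.cons_append, ← List.append_assoc] at hw
        have h1 := List.append_inj' hw (by simp [plainWord])
        simp [plainWord] at h1
  · rintro ⟨ha, hx, hf⟩
    exact IsTiltedWord.step a ha w hx hf [] (by simp)

theorem not_isTiltedWord_concat_one {a : Fin n → Fin n} {w : List (Factor n)} :
    ¬ IsTiltedWord a (w ++ [Factor.one]) := by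
  intro h
  generalize hw : w ++ [Factor.one] = w' at h
  have hone : ∀ t : List (Fin (n - 1)), Factor.one ∉ plainWord t := by
    intro t
    simp [plainWord]
  cases h with
  | base _ ha t =>
    apply hone t
    rw [← hw]
    simp
  | step _ ha x hx hf t ht =>
    rcases List.eq_nil_or_concat t with rfl | ⟨t', i', rfl⟩
    · have := congrArg List.getLast? hw
      simp [plainWord] at this
    · rw [List.concat_eq_append, plainWord_append, ← List.cons_append, ← List.append_assoc] at hw
      have h1 := List.append_inj' hw (by simp [plainWord])
      simp [plainWord] at h1

theorem prefixProd_zero {n : ℕ} (w : List (Factor n)) : prefixProd w 0 = 1 := rfl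

theorem prefixProd_succ {n : ℕ} (w : List (Factor n)) {j : ℕ} (hj : j < w.length) :
    prefixProd w (j + 1) = prefixProd w j * (w[j]).perm := by
  rw [prefixProd, prefixProd, ← List.take_append_getElem hj, wordProd_append, wordProd_singleton]

theorem prefixProd_length {n : ℕ} (w : List (Factor n)) : prefixProd w w.length = wordProd w := by
  rw [prefixProd, List.take_length]

theorem seqAt_length (a : Fin n → Fin n) (w : List (Factor n)) : seqAt a w w.length = a := by
  simp [seqAt]

theorem seqAt_of_ne_bar (a : Fin n → Fin n) {w : List (Factor n)} {j : ℕ} (hj : j < w.length)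
    (h : w[j] ≠ Factor.bar) : seqAt a w j = seqAt a w (j + 1) := by
  rw [seqAt, seqAt, List.drop_eq_getElem_cons hj, List.count_cons_of_ne h]

theorem seqAt_of_eq_bar (a : Fin n → Fin n) {w : List (Factor n)} {j : ℕ} (hj : j < w.length)
    (h : w[j] = Factor.bar) : seqAt a w j = flatten (seqAt a w (j + 1)) := by
  rw [seqAt, seqAt, List.drop_eq_getElem_cons hj, h, List.count_cons_self,
    Function.iterate_succ_apply']

theorem IsTiltedWord.take {a : Fin n → Fin n} {w : List (Factor n)} (h : IsTiltedWord a w) :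
    ∀ j ≤ w.length, IsTiltedWord (seqAt a w j) (w.take j) := by
  intro j hj
  induction hj using Nat.decreasingInduction with
  | self =>
    rw [seqAt_length, List.take_length]
    exact h
  | of_succ j hj ih =>
    rw [← List.take_append_getElem hj] at ih
    cases hx : w[j] with
    | s i =>
      rw [hx, isTiltedWord_concat_s] at ih
      rw [seqAt_of_ne_bar a hj (by simp [hx])]
      exact ih.1
    | bar =>
      rw [hx, isTiltedWord_concat_bar] at ih
      rw [seqAt_of_eq_bar a hj hx]
      exact ih.2.1
    | one =>
      rw [hx] at ih
      exact absurd ih not_isTiltedWord_concat_one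

theorem IsTiltedWord.jumps_seqAt_zero {a : Fin n → Fin n} {w : List (Factor n)}
    (h : IsTiltedWord a w) : jumps (seqAt a w 0) = ∅ :=
  isTiltedWord_nil_iff.1 (h.take 0 (Nat.zero_le _))

theorem IsTiltedWord.lo_notMem_jumps {a : Fin n → Fin n} {w : List (Factor n)}
    (h : IsTiltedWord a w) {j : ℕ} (hj : j < w.length) {i : Fin (n - 1)}
    (hx : w[j] = Factor.s i) : lo i ∉ jumps (seqAt a w (j + 1)) := by
  have h1 := h.take (j + 1) hj
  rw [← List.take_append_getElem hj, hx, isTiltedWord_concat_s] at h1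
  exact h1.2

theorem IsTiltedWord.flattenable {a : Fin n → Fin n} {w : List (Factor n)}
    (h : IsTiltedWord a w) {j : ℕ} (hj : j < w.length) (hx : w[j] = Factor.bar) :
    jumps (seqAt a w (j + 1)) ≠ ∅ ∧ Flattenable (seqAt a w (j + 1)) (prefixProd w j) := by
  have h1 := h.take (j + 1) hj
  rw [← List.take_append_getElem hj, hx, isTiltedWord_concat_bar] at h1
  exact ⟨h1.1, h1.2.2⟩

theorem IsTiltedWord.ne_one {a : Fin n → Fin n} {w : List (Factor n)}
    (h : IsTiltedWord a w) {j : ℕ} (hj : j < w.length) : w[j] ≠ Factor.one := by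
  intro hx
  have h1 := h.take (j + 1) hj
  rw [← List.take_append_getElem hj, hx] at h1
  exact not_isTiltedWord_concat_one h1

/-! ### Subwords -/

/-- `U` arises from `V` by replacing some simple transpositions by `1`. -/
def IsReplacement {n : ℕ} (V U : List (Factor n)) : Prop :=
  List.Forall₂ (fun x y : Factor n => x = y ∨ (x = Factor.one ∧ ∃ i, y = Factor.s i)) U V

theorem IsReplacement.length_eq {n : ℕ} {V U : List (Factor n)} (h : IsReplacement V U) :
    U.length = V.length := List.Forall₂.length_eq h

theorem IsReplacement.getElem {n : ℕ} {V U : List (Factor n)} (h : IsReplacement V U) {j : ℕ}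
    (hj : j < V.length) :
    U[j]'(h.length_eq ▸ hj) = V[j] ∨
      (U[j]'(h.length_eq ▸ hj) = Factor.one ∧ ∃ i, V[j] = Factor.s i) :=
  (List.forall₂_iff_get.1 h).2 j (h.length_eq ▸ hj) hj

theorem filter_concat {n : ℕ} (U : List (Factor n)) {j : ℕ} (hj : j < U.length) :
    (U.take (j + 1)).filter (fun x => x ≠ Factor.one) =
      (U.take j).filter (fun x => x ≠ Factor.one) ++
        if U[j] = Factor.one then [] else [U[j]] := by
  rw [← List.take_append_getElem hj, List.filter_append]
  congr 1
  split_ifs with h <;> simp [h]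

theorem wordProd_filter {n : ℕ} (U : List (Factor n)) :
    wordProd (U.filter fun x => x ≠ Factor.one) = wordProd U := by
  induction U with
  | nil => rfl
  | cons x U ih =>
    have e : ∀ (y : Factor n) (W : List (Factor n)), wordProd (y :: W) = y.perm * wordProd W := by
      intro y W
      simp [wordProd]
    by_cases hx : x = Factor.one
    · subst hx
      rw [List.filter_cons_of_neg (by simp), ih, e]
      simp [Factor.perm]
    · rw [List.filter_cons_of_pos (by simp [hx]), e, e, ih]

/-- The condition that omitting the `1`'s of `U` gives a tilted word, one factor at a time. -/
theorem isTiltedWord_filter_succ_iff {a : Fin n → Fin n} {V U : List (Factor n)}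
    (hV : IsTiltedWord a V) (hU : IsReplacement V U) {j : ℕ} (hj : j < V.length) :
    IsTiltedWord (seqAt a V (j + 1)) ((U.take (j + 1)).filter fun x => x ≠ Factor.one) ↔
      IsTiltedWord (seqAt a V j) ((U.take j).filter fun x => x ≠ Factor.one) ∧
      (V[j] = Factor.bar → Flattenable (seqAt a V (j + 1)) (prefixProd U j)) := by
  have hjU : j < U.length := hU.length_eq ▸ hj
  rw [filter_concat U hjU]
  rcases hU.getElem hj with h | ⟨h, i, hi⟩
  · rw [h, if_neg (hV.ne_one hj)]
    cases hx : V[j] with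
    | s i =>
      rw [isTiltedWord_concat_s, seqAt_of_ne_bar a hj (by simp [hx])]
      simp [hV.lo_notMem_jumps hj hx]
    | bar =>
      rw [isTiltedWord_concat_bar, seqAt_of_eq_bar a hj hx, wordProd_filter]
      simp [(hV.flattenable hj hx).1, prefixProd]
    | one => exact absurd hx (hV.ne_one hj)
  · rw [h, if_pos rfl, List.append_nil, seqAt_of_ne_bar a hj (by simp [hi])]
    simp [hi]

/-- Since a subword keeps the bars, omitting its `1`'s gives a tilted word exactly if its prefixes
in front of the bars are flattenable. -/
theorem isTiltedWord_filter_iff {a : Fin n → Fin n} {V U : List (Factor n)}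
    (hV : IsTiltedWord a V) (hU : IsReplacement V U) :
    IsTiltedWord a (U.filter fun x => x ≠ Factor.one) ↔
      ∀ (j : ℕ) (hj : j < V.length), V[j] = Factor.bar →
        Flattenable (seqAt a V (j + 1)) (prefixProd U j) := by
  have key : ∀ m ≤ V.length,
      IsTiltedWord (seqAt a V m) ((U.take m).filter fun x => x ≠ Factor.one) ↔
      ∀ (j : ℕ) (hj : j < V.length), j < m → V[j] = Factor.bar →
        Flattenable (seqAt a V (j + 1)) (prefixProd U j) := by
    intro m
    induction m with
    | zero =>
      intro _
      simp [isTiltedWord_nil_iff, hV.jumps_seqAt_zero]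
    | succ m ih =>
      intro hm
      rw [isTiltedWord_filter_succ_iff hV hU hm, ih (Nat.le_of_succ_le hm)]
      constructor
      · rintro ⟨h1, h2⟩ j hj hjm
        rcases Nat.lt_succ_iff_lt_or_eq.1 hjm with h | rfl
        · exact h1 j hj h
        · exact h2
      · intro h
        exact ⟨fun j hj hjm => h j hj (Nat.lt_succ_of_lt hjm), h m hm (Nat.lt_succ_self m)⟩
  have := key V.length le_rfl
  rw [seqAt_length, List.take_of_length_le hU.length_eq.le] at this
  rw [this]
  exact ⟨fun h j hj => h j hj hj, fun h j hj _ => h j hj⟩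

theorem IsReplacement.prefixProd_succ_bar {n : ℕ} {V U : List (Factor n)} (hU : IsReplacement V U)
    {j : ℕ} (hj : j < V.length) (hx : V[j] = Factor.bar) :
    prefixProd U (j + 1) = prefixProd U j := by
  rw [prefixProd_succ U (hU.length_eq ▸ hj)]
  rcases hU.getElem hj with h | ⟨-, i, hi⟩
  · rw [h, hx]
    simp [Factor.perm]
  · simp [hx] at hi

theorem IsReplacement.prefixProd_succ_s {n : ℕ} {V U : List (Factor n)} (hU : IsReplacement V U)
    {j : ℕ} (hj : j < V.length) {i : Fin (n - 1)} (hx : V[j] = Factor.s i) :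
    prefixProd U (j + 1) = prefixProd U j ∨
      prefixProd U (j + 1) = prefixProd U j * Equiv.swap (lo i) (hi i) := by
  rw [prefixProd_succ U (hU.length_eq ▸ hj)]
  rcases hU.getElem hj with h | ⟨h, -⟩
  · rw [h, hx]
    exact Or.inr rfl
  · rw [h]
    simp [Factor.perm]

theorem prefixProd_succ_s {n : ℕ} {V : List (Factor n)} {j : ℕ} (hj : j < V.length)
    {i : Fin (n - 1)} (hx : V[j] = Factor.s i) :
    prefixProd V (j + 1) = prefixProd V j * Equiv.swap (lo i) (hi i) := by
  rw [prefixProd_succ V hj, hx]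
  rfl

theorem prefixProd_succ_bar {n : ℕ} {V : List (Factor n)} {j : ℕ} (hj : j < V.length)
    (hx : V[j] = Factor.bar) : prefixProd V (j + 1) = prefixProd V j := by
  rw [prefixProd_succ V hj, hx]
  exact mul_one _

/-- A subword is determined by its partial products. -/
theorem IsReplacement.eq_of_prefixProd {n : ℕ} {V U U' : List (Factor n)}
    (hU : IsReplacement V U) (hU' : IsReplacement V U')
    (h : ∀ j ≤ V.length, prefixProd U j = prefixProd U' j) : U = U' := by
  apply List.ext_getElem (hU.length_eq.trans hU'.length_eq.symm)
  intro j hj hj'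
  have hjV : j < V.length := hU.length_eq ▸ hj
  have h1 := h (j + 1) hjV
  rw [prefixProd_succ U hj, prefixProd_succ U' hj', h j hjV.le, mul_right_inj] at h1
  have hs : ∀ i : Fin (n - 1), (Factor.s i).perm ≠ 1 := by
    intro i hi
    exact mul_swap_ne_self 1 i (by rw [one_mul]; exact hi)
  rcases hU.getElem hjV with e | ⟨e, i, hi⟩ <;> rcases hU'.getElem hjV with e' | ⟨e', i', hi'⟩
  · rw [e, e']
  · rw [e, e', hi'] at h1
    exact absurd h1 (hs i')
  · rw [e, e', hi] at h1
    exact absurd h1.symm (hs i)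
  · rw [e, e']

/-- Neither simple transpositions away from the jumps nor flattenings destroy the relation `∼`, so
it holds for all prefixes if it holds for the whole words. -/
theorem tiltedSim_prefixProd {a : Fin n → Fin n} {V U : List (Factor n)}
    (hV : IsTiltedWord a V) (hU : IsReplacement V U)
    (h : TiltedSim a (wordProd U) (wordProd V)) :
    ∀ j ≤ V.length, TiltedSim (seqAt a V j) (prefixProd U j) (prefixProd V j) := by
  intro j hj
  induction hj using Nat.decreasingInduction with
  | self =>
    rw [seqAt_length, prefixProd_length, ← hU.length_eq, prefixProd_length]
    exact h
  | of_succ j hj ih =>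
    cases hx : V[j] with
    | s i =>
      have hi := hV.lo_notMem_jumps hj hx
      rw [prefixProd_succ_s hj hx] at ih
      rw [seqAt_of_ne_bar a hj (by simp [hx])]
      have h1 := ih.mul_swap_right hi
      rw [mul_swap_mul_swap] at h1
      rcases hU.prefixProd_succ_s hj hx with e | e
      · rwa [e] at h1
      · have h2 := h1.mul_swap_left hi
        rwa [e, mul_swap_mul_swap] at h2
    | bar =>
      rw [prefixProd_succ_bar hj hx, hU.prefixProd_succ_bar hj hx] at ih
      rw [seqAt_of_eq_bar a hj hx]
      exact ih.flatten
    | one => exact absurd hx (hV.ne_one hj)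

theorem jumps_seqAt_mono {a : Fin n → Fin n} {V : List (Factor n)} {j k : ℕ} (hjk : j ≤ k)
    (hk : k ≤ V.length) : jumps (seqAt a V j) ⊆ jumps (seqAt a V k) := by
  induction k, hjk using Nat.le_induction with
  | base => exact Finset.Subset.refl _
  | succ k hjk ih =>
    refine (ih (Nat.le_of_succ_le hk)).trans ?_
    by_cases hx : V[k] = Factor.bar
    · rw [seqAt_of_eq_bar a hk hx]
      exact jumps_flatten_subset _
    · rw [seqAt_of_ne_bar a hk hx]

end

section

variable {n : ℕ} [NeZero n]

/-! ### Tilted inversions and reduced words -/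

/-- The entries following position `k` of `w` that are smaller than `w_k` in the order `≤_r`. -/
def laterSmaller {n : ℕ} (r : Fin n) (w : Equiv.Perm (Fin n)) (k : Fin n) : Finset (Fin n) :=
  Finset.univ.filter fun x => x ∉ firstSet w (k.val + 1) ∧ keyUp r x < keyUp r (w k)

/-- The number of `a`-tilted inversions of `w`: pairs of positions `k < l` with
`w_l <_{a_k} w_k`. -/
def tiltedInv {n : ℕ} (a : Fin n → Fin n) (w : Equiv.Perm (Fin n)) : ℕ :=
  ∑ k, (laterSmaller (a k) w k).card

theorem mem_laterSmaller {n : ℕ} {r : Fin n} {w : Equiv.Perm (Fin n)} {k x : Fin n} :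
    x ∈ laterSmaller r w k ↔ x ∉ firstSet w (k.val + 1) ∧ keyUp r x < keyUp r (w k) := by
  simp [laterSmaller]

theorem sum_lo_hi {n : ℕ} (i : Fin (n - 1)) (f : Fin n → ℕ) :
    ∑ k, f k = f (lo i) + f (hi i) + ∑ k ∈ (Finset.univ.erase (lo i)).erase (hi i), f k := by
  rw [← Finset.add_sum_erase Finset.univ f (Finset.mem_univ (lo i)),
    ← Finset.add_sum_erase (Finset.univ.erase (lo i)) f
      (Finset.mem_erase.2 ⟨(lo_ne_hi i).symm, Finset.mem_univ _⟩), add_assoc]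

/-- An ascent away from the jumps creates one tilted inversion. -/
theorem tiltedInv_mul_swap {a : Fin n → Fin n} {w : Equiv.Perm (Fin n)} {i : Fin (n - 1)}
    (hj : lo i ∉ jumps a) (hlt : keyUp (a (lo i)) (w (lo i)) < keyUp (a (lo i)) (w (hi i))) :
    tiltedInv a (w * Equiv.swap (lo i) (hi i)) = tiltedInv a w + 1 := by
  have hA : ∀ {x}, x ∉ firstSet w (i.val + 2) ↔
      x ≠ w (lo i) ∧ x ≠ w (hi i) ∧ x ∉ firstSet w i.val := by
    intro x
    rw [firstSet_hi_succ, Finset.mem_insert, Finset.mem_insert, not_or, not_or]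
  have h1 : laterSmaller (a (lo i)) (w * Equiv.swap (lo i) (hi i)) (lo i) =
      insert (w (lo i)) (laterSmaller (a (hi i)) w (hi i)) := by
    ext x
    rw [Finset.mem_insert, mem_laterSmaller, mem_laterSmaller, lo_val, hi_val,
      firstSet_mul_swap_succ, mul_swap_lo, apply_hi_eq hj, hA, Finset.mem_insert, not_or]
    constructor
    · rintro ⟨⟨h1, h2⟩, h3⟩
      by_cases hx : x = w (lo i)
      · exact Or.inl hx
      · exact Or.inr ⟨⟨hx, h1, h2⟩, h3⟩
    · rintro (rfl | ⟨⟨-, h1, h2⟩, h3⟩)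
      · refine ⟨⟨fun h => lo_ne_hi i (w.injective h), ?_⟩, hlt⟩
        rw [apply_mem_firstSet, lo_val]
        omega
      · exact ⟨⟨h1, h2⟩, h3⟩
  have h2 : laterSmaller (a (hi i)) (w * Equiv.swap (lo i) (hi i)) (hi i) =
      laterSmaller (a (lo i)) w (lo i) := by
    ext x
    rw [mem_laterSmaller, mem_laterSmaller, lo_val, hi_val, apply_hi_eq hj, mul_swap_hi,
      firstSet_mul_swap w i (by omega), hA, firstSet_lo_succ, Finset.mem_insert, not_or]
    constructor
    · rintro ⟨⟨h1, -, h2⟩, h3⟩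
      exact ⟨⟨h1, h2⟩, h3⟩
    · rintro ⟨⟨h1, h2⟩, h3⟩
      refine ⟨⟨h1, ?_, h2⟩, h3⟩
      rintro rfl
      omega
  have h3 : w (lo i) ∉ laterSmaller (a (hi i)) w (hi i) := by
    rw [mem_laterSmaller, hi_val, hA]
    simp
  rw [tiltedInv, tiltedInv, sum_lo_hi i, sum_lo_hi i, h1, h2, Finset.card_insert_of_notMem h3]
  have h4 : ∀ k ∈ (Finset.univ.erase (lo i)).erase (hi i),
      (laterSmaller (a k) (w * Equiv.swap (lo i) (hi i)) k).card =
        (laterSmaller (a k) w k).card := by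
    intro k hk
    simp only [Finset.mem_erase, Finset.mem_univ, and_true] at hk
    rw [laterSmaller, laterSmaller, mul_swap_ne w hk.2 hk.1, firstSet_mul_swap]
    intro h
    exact hk.2 (Fin.ext (by rw [lo_val]; omega))
  rw [Finset.sum_congr rfl h4]
  ring

theorem keyUp_lt_iff {n : ℕ} {r s x y : Fin n} (h : x ∈ cyclicIco r s ↔ y ∈ cyclicIco r s) :
    keyUp r x < keyUp r y ↔ keyUp s x < keyUp s y := by
  rw [← not_le, ← not_le, keyUp_le_iff h.symm]

/-- For a flattenable permutation, flattening changes the number of tilted inversions by an amount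
depending only on the number `p` of entries in the jump interval. -/
theorem FlattenableAt.tiltedInv_add {a : Fin n → Fin n} {p : ℕ} {w : Equiv.Perm (Fin n)}
    (h : FlattenableAt a p w) :
    tiltedInv a w + ∑ k : Fin n, (if k ≤ minJump a ∧ k.val < p then
        (jumpInterval a)ᶜ.card else 0) =
      tiltedInv (flatten a) w + ∑ k : Fin n, (if k ≤ minJump a ∧ ¬ k.val < p then
        (jumpInterval a).card - p else 0) := by
  rw [tiltedInv, tiltedInv, ← Finset.sum_add_distrib, ← Finset.sum_add_distrib]
  refine Finset.sum_congr rfl fun k _ => ?_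
  rcases lt_or_ge (minJump a) k with hk | hk
  · simp [flatten_of_lt hk, not_le.2 hk]
  rw [apply_eq_of_le_minJump hk, flatten_of_le hk]
  by_cases hkp : k.val < p
  · simp only [hk, hkp, not_true, and_self, and_false, if_true, if_false, add_zero]
    have hwk : w k ∈ jumpInterval a := (h.2 k hk).2 hkp
    have hF : ∀ x ∈ firstSet w (k.val + 1), x ∈ jumpInterval a := by
      intro x hx
      obtain ⟨j, rfl⟩ := w.surjective x
      rw [apply_mem_firstSet] at hx
      refine (h.2 j ?_).2 (by omega)
      rw [Fin.le_def] at hk ⊢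
      omega
    rw [← Finset.card_union_of_disjoint]
    · congr 1
      ext x
      rw [Finset.mem_union, Finset.mem_compl, mem_laterSmaller, mem_laterSmaller]
      by_cases hx : x ∈ jumpInterval a
      · simp [hx, keyUp_lt_iff (r := a 0) (s := nextEntry a (minJump a)) (x := x) (y := w k)
          ⟨fun _ => hwk, fun _ => hx⟩]
      · simp only [hx, not_false_eq_true, or_true, true_iff]
        exact ⟨fun hxF => hx (hF x hxF), keyUp_lt_of_notMem hx hwk⟩
    · rw [Finset.disjoint_left]
      intro x hx hx'
      rw [Finset.mem_compl] at hx'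
      exact absurd (keyUp_lt_of_mem hwk hx') (not_lt.2 (mem_laterSmaller.1 hx).2.le)
  · simp only [hk, hkp, not_false_eq_true, and_self, and_false, if_true, if_false, add_zero]
    have hwk : w k ∉ jumpInterval a := fun hmem => hkp ((h.2 k hk).1 hmem)
    have hcard : (jumpInterval a \ firstSet w (k.val + 1)).card = (jumpInterval a).card - p := by
      rw [Finset.card_sdiff, h.card_inter (Nat.succ_le_succ hk), min_eq_right (by omega)]
    rw [← hcard, ← Finset.card_union_of_disjoint]
    · congr 1
      ext x
      rw [Finset.mem_union, Finset.mem_sdiff, mem_laterSmaller, mem_laterSmaller]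
      by_cases hx : x ∈ jumpInterval a
      · simp only [hx, true_and]
        constructor
        · exact fun hh => Or.inr hh.1
        · rintro (hh | hh)
          · exact ⟨hh.1, keyUp_lt_of_mem hx hwk⟩
          · exact ⟨hh, keyUp_lt_of_mem hx hwk⟩
      · simp [hx, keyUp_lt_iff (r := a 0) (s := nextEntry a (minJump a)) (x := x) (y := w k)
          ⟨fun h => absurd h hx, fun h => absurd h hwk⟩]
    · rw [Finset.disjoint_left]
      intro x hx hx'
      rw [Finset.mem_sdiff] at hx'
      exact absurd (keyUp_lt_of_notMem hwk hx'.1) (not_lt.2 (mem_laterSmaller.1 hx).2.le)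

/-- Tilted words all of whose simple transpositions are ascents. -/
inductive IsAscendingWord : (Fin n → Fin n) → List (Factor n) → Prop
  | nil (a : Fin n → Fin n) (ha : jumps a = ∅) : IsAscendingWord a []
  | s (a : Fin n → Fin n) (w : List (Factor n)) (i : Fin (n - 1)) (hw : IsAscendingWord a w)
      (hj : lo i ∉ jumps a)
      (hlt : keyUp (a (lo i)) (wordProd w (lo i)) < keyUp (a (lo i)) (wordProd w (hi i))) :
      IsAscendingWord a (w ++ [Factor.s i])
  | bar (a : Fin n → Fin n) (ha : jumps a ≠ ∅) (w : List (Factor n))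
      (hw : IsAscendingWord (flatten a) w) (hf : Flattenable a (wordProd w)) :
      IsAscendingWord a (w ++ [Factor.bar])

theorem IsAscendingWord.isTiltedWord {a : Fin n → Fin n} {w : List (Factor n)}
    (h : IsAscendingWord a w) : IsTiltedWord a w := by
  induction h with
  | nil a ha => exact isTiltedWord_nil_iff.2 ha
  | s a w i _ hj _ ih => exact isTiltedWord_concat_s.2 ⟨ih, hj⟩
  | bar a ha w _ hf ih => exact isTiltedWord_concat_bar.2 ⟨ha, ih, hf⟩

theorem wordProd_concat_s {n : ℕ} (w : List (Factor n)) (i : Fin (n - 1)) :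
    wordProd (w ++ [Factor.s i]) = wordProd w * Equiv.swap (lo i) (hi i) := by
  rw [wordProd_append, wordProd_singleton]
  rfl

theorem wordProd_concat_bar {n : ℕ} (w : List (Factor n)) :
    wordProd (w ++ [Factor.bar]) = wordProd w := by
  rw [wordProd_append, wordProd_singleton]
  exact mul_one _

theorem IsAscendingWord.ascent {a : Fin n → Fin n} {w : List (Factor n)}
    (h : IsAscendingWord a w) {j : ℕ} (hj : j < w.length) {i : Fin (n - 1)}
    (hx : w[j] = Factor.s i) :
    keyUp (seqAt a w (j + 1) (lo i)) (prefixProd w j (lo i)) <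
      keyUp (seqAt a w (j + 1) (lo i)) (prefixProd w j (hi i)) := by
  have seq : ∀ (a : Fin n → Fin n) (w : List (Factor n)) (x : Factor n), j < w.length →
      seqAt a (w ++ [x]) (j + 1) = seqAt (flatten^[[x].count Factor.bar] a) w (j + 1) := by
    intro a w x hjw
    rw [seqAt, seqAt, List.drop_append_of_le_length hjw, List.count_append,
      Function.iterate_add_apply]
  induction h with
  | nil a ha => simp at hj
  | s a w i' hw hj' hlt ih =>
    rcases Nat.lt_succ_iff_lt_or_eq.1 (by simpa using hj : j < w.length + 1) with hjw | rfl
    · rw [List.getElem_append_left hjw] at hx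
      rw [seq a w _ hjw, prefixProd, List.take_append_of_le_length hjw.le]
      exact ih hjw hx
    · have e : i = i' := by simpa using hx.symm
      subst e
      rw [prefixProd, List.take_left, seqAt, List.drop_of_length_le (by simp)]
      exact hlt
  | bar a ha w hw hf ih =>
    rcases Nat.lt_succ_iff_lt_or_eq.1 (by simpa using hj : j < w.length + 1) with hjw | rfl
    · rw [List.getElem_append_left hjw] at hx
      rw [seq a w _ hjw, prefixProd, List.take_append_of_le_length hjw.le]
      exact ih hjw hx
    · simp at hx

/-- The length minus the number of tilted inversions is at least as large for `w'` as for `w`, and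
if they are equal, `w'` is ascending. -/
def WordsCompare (a : Fin n → Fin n) (w w' : List (Factor n)) : Prop :=
  w.length + tiltedInv a (wordProd w') ≤ w'.length + tiltedInv a (wordProd w) ∧
    (w.length + tiltedInv a (wordProd w') = w'.length + tiltedInv a (wordProd w) →
      IsAscendingWord a w')

theorem WordsCompare.concat_s {a : Fin n → Fin n} {w w' : List (Factor n)} {i : Fin (n - 1)}
    (h : WordsCompare a w w') (hj : lo i ∉ jumps a) : WordsCompare a w (w' ++ [Factor.s i]) := by
  rw [WordsCompare, wordProd_concat_s, List.length_append, List.length_singleton]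
  rcases lt_or_gt_of_ne (keyUp_lo_ne_hi (a (lo i)) (wordProd w') i) with hlt | hlt
  · rw [tiltedInv_mul_swap hj hlt]
    refine ⟨by have := h.1; omega, fun e => ?_⟩
    exact IsAscendingWord.s a w' i (h.2 (by omega)) hj hlt
  · have h1 := tiltedInv_mul_swap (w := wordProd w' * Equiv.swap (lo i) (hi i)) hj
      (by rwa [mul_swap_lo, mul_swap_hi])
    rw [mul_swap_mul_swap] at h1
    have h2 := h.1
    exact ⟨by omega, fun e => by omega⟩

/-- The number of factors of a tilted word minus the number of its tilted inversions is minimal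
for ascending words, and only for these. -/
theorem IsAscendingWord.compare {a : Fin n → Fin n} {w : List (Factor n)}
    (h : IsAscendingWord a w) : ∀ w', IsTiltedWord a w' →
      (∀ k ∈ jumps a, firstSet (wordProd w) (k.val + 1) = firstSet (wordProd w') (k.val + 1)) →
      WordsCompare a w w' := by
  induction h with
  | nil a ha =>
    intro w'
    induction w' using List.reverseRecOn with
    | nil => exact fun _ _ => ⟨le_rfl, fun _ => IsAscendingWord.nil a ha⟩
    | append_singleton w' x ih =>
      intro hw' _
      cases x with
      | s i =>
        rw [isTiltedWord_concat_s] at hw'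
        exact (ih hw'.1 (by simp [ha])).concat_s hw'.2
      | bar =>
        rw [isTiltedWord_concat_bar] at hw'
        exact absurd ha hw'.1
      | one => exact absurd hw' not_isTiltedWord_concat_one
  | s a w i hw hj hlt ih =>
    intro w' hw' hk
    rw [wordProd_concat_s] at hk
    have h1 := ih w' hw' fun k hkj => by
      rw [← hk k hkj, firstSet_mul_swap_of_mem_jumps hj _ hkj]
    rw [WordsCompare, wordProd_concat_s, tiltedInv_mul_swap hj hlt, List.length_append,
      List.length_singleton]
    refine ⟨by have := h1.1; omega, fun e => h1.2 (by omega)⟩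
  | bar a ha w hw hf ih =>
    intro w'
    induction w' using List.reverseRecOn with
    | nil =>
      intro hw' _
      exact absurd (isTiltedWord_nil_iff.1 hw') ha
    | append_singleton w' x ih' =>
      intro hw' hk
      cases x with
      | s i =>
        -- letters of `w'` behind its last bar only weaken the inequality
        rw [isTiltedWord_concat_s] at hw'
        rw [wordProd_concat_s] at hk
        exact (ih' hw'.1 fun k hkj => by
          rw [hk k hkj, firstSet_mul_swap_of_mem_jumps hw'.2 _ hkj]).concat_s hw'.2
      | bar =>
        rw [isTiltedWord_concat_bar] at hw'
        rw [wordProd_concat_bar, wordProd_concat_bar] at hk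
        have h1 := ih w' hw'.2.1 fun k hkj => hk k (jumps_flatten_subset a hkj)
        obtain ⟨p, hp⟩ := (flattenable_iff ha).1 hf
        obtain ⟨p', hp'⟩ := (flattenable_iff ha).1 hw'.2.2
        have hpp : p = p' := hp.eq ha
          (tiltedSim_iff.2 fun k hkj => by rw [hk k hkj]) hp'
        subst hpp
        have e1 := hp.tiltedInv_add
        have e2 := hp'.tiltedInv_add
        rw [WordsCompare, wordProd_concat_bar, wordProd_concat_bar, List.length_append,
          List.length_append, List.length_singleton]
        refine ⟨by have := h1.1; omega, fun e => ?_⟩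
        exact IsAscendingWord.bar a ha w' (h1.2 (by omega)) hw'.2.2
      | one => exact absurd hw' not_isTiltedWord_concat_one

/-- Without descents away from the jumps, the entries of a block between two jumps increase. -/
theorem keyUp_monotone_of_no_descent {a : Fin n → Fin n} {v : Equiv.Perm (Fin n)}
    (h : ∀ i : Fin (n - 1), lo i ∉ jumps a →
      ¬ keyUp (a (lo i)) (v (hi i)) < keyUp (a (lo i)) (v (lo i)))
    {j k : Fin n} (hjk : j ≤ k) (hk : ∀ l < k, l ∉ jumps a) :
    keyUp (a j) (v j) ≤ keyUp (a j) (v k) ∧ a k = a j := by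
  obtain ⟨m, hm⟩ : ∃ m, k.val = j.val + m := ⟨k.val - j.val, by rw [Fin.le_def] at hjk; omega⟩
  induction m generalizing k with
  | zero => rw [show k = j from Fin.ext (by omega)]; exact ⟨le_rfl, rfl⟩
  | succ m ih =>
    have hkn := k.isLt
    obtain ⟨i, hi'⟩ : ∃ i : Fin (n - 1), i.val = j.val + m := ⟨⟨j.val + m, by omega⟩, rfl⟩
    have hhi : hi i = k := Fin.ext (by rw [hi_val]; omega)
    have hlt : lo i < k := by
      rw [Fin.lt_def, lo_val]
      omega
    have h1 := ih (k := lo i) (by rw [Fin.le_def, lo_val]; omega)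
      (fun l hl => hk l (hl.trans hlt)) hi'
    have h2 := h i (hk _ hlt)
    have h3 := apply_hi_eq (hk _ hlt)
    rw [hhi] at h2 h3
    rw [h1.2] at h2 h3
    exact ⟨h1.1.trans (not_lt.1 h2), h3⟩

theorem keyUp_zero (x : Fin n) : keyUp 0 x = x.val := by
  rw [keyUp, sub_zero]

/-- Every permutation has an ascending word. -/
theorem exists_isAscendingWord (a : Fin n → Fin n) (v : Equiv.Perm (Fin n)) :
    ∃ w, IsAscendingWord a w ∧ wordProd w = v := by
  obtain ⟨c, hc⟩ : ∃ c, (jumps a).card = c := ⟨_, rfl⟩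
  induction c using Nat.strong_induction_on generalizing a v with
  | _ c ihc =>
  obtain ⟨l, hl⟩ : ∃ l, tiltedInv a v = l := ⟨_, rfl⟩
  induction l using Nat.strong_induction_on generalizing v with
  | _ l ihl =>
  by_cases hdes : ∃ i : Fin (n - 1), lo i ∉ jumps a ∧
      keyUp (a (lo i)) (v (hi i)) < keyUp (a (lo i)) (v (lo i))
  · obtain ⟨i, hj, hlt⟩ := hdes
    have hlt' : keyUp (a (lo i)) ((v * Equiv.swap (lo i) (hi i)) (lo i)) <
        keyUp (a (lo i)) ((v * Equiv.swap (lo i) (hi i)) (hi i)) := by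
      rwa [mul_swap_lo, mul_swap_hi]
    have h1 := tiltedInv_mul_swap hj hlt'
    rw [mul_swap_mul_swap] at h1
    obtain ⟨w, hw, hwv⟩ := ihl _ (by omega) (v * Equiv.swap (lo i) (hi i)) rfl
    rw [← hwv] at hlt'
    refine ⟨w ++ [Factor.s i], IsAscendingWord.s a w i hw hj hlt', ?_⟩
    rw [wordProd_concat_s, hwv, mul_swap_mul_swap]
  push Not at hdes
  have hmono := fun j k hjk hk => keyUp_monotone_of_no_descent (a := a) (v := v) (j := j) (k := k)
    (fun i hj => not_lt.2 (hdes i hj)) hjk hk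
  by_cases ha : jumps a = ∅
  · have hv : v = 1 := by
      have hsm : StrictMono v := by
        intro j k hjk
        have h1 := (hmono j k hjk.le (by simp [ha])).1
        rw [eq_zero_of_jumps_eq_empty ha j, keyUp_zero, keyUp_zero, Nat.cast_le] at h1
        exact lt_of_le_of_ne (Fin.le_def.2 h1) fun e => hjk.ne (v.injective e)
      have h2 := (hsm.range_inj strictMono_id).1 (by simp [v.surjective.range_eq])
      ext k
      rw [congrFun h2 k]
      rfl
    exact ⟨[], IsAscendingWord.nil a ha, by rw [hv, wordProd_nil]⟩
  · -- the entries up to the first jump increase, so those in the jump interval come first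
    have hfl : Flattenable a v := by
      classical
      rw [flattenable_iff ha]
      have hex : ∃ m : ℕ, m = (minJump a).val + 1 ∨
          ∃ i : Fin n, i.val = m ∧ v i ∉ jumpInterval a := ⟨_, Or.inl rfl⟩
      have hp := Nat.find_spec hex
      have hmin := fun m => Nat.find_min hex (m := m)
      refine ⟨Nat.find hex, Nat.find_min' hex (Or.inl rfl), fun i hi => ⟨fun hmem => ?_, ?_⟩⟩
      · by_contra hlt
        rcases hp with hp | ⟨i', hi', hv⟩
        · rw [Fin.le_def] at hi
          omega
        · have h1 := (hmono i' i (by rw [Fin.le_def]; omega) (fun l hl hlj => by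
            exact absurd (minJump_le hlj) (not_le.2 (hl.trans_le hi)))).1
          have hi'' : i' ≤ minJump a := by
            rw [Fin.le_def] at hi ⊢
            omega
          rw [apply_eq_of_le_minJump hi''] at h1
          exact absurd (keyUp_lt_of_mem hmem hv) (not_lt.2 h1)
      · intro hlt
        by_contra hv
        exact hmin _ hlt (Or.inr ⟨i, rfl, hv⟩)
    have hlt : (jumps (flatten a)).card < c := by
      rw [← hc]
      apply Finset.card_lt_card
      refine ⟨jumps_flatten_subset a, fun h => ?_⟩
      exact (mem_jumps_flatten.1 (h (minJump_mem ha))).2 rfl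
    obtain ⟨w, hw, hwv⟩ := ihc _ hlt (flatten a) v rfl
    refine ⟨w ++ [Factor.bar], IsAscendingWord.bar a ha w hw (by rwa [hwv]), ?_⟩
    rw [wordProd_concat_bar, hwv]

/-- In a reduced word all simple transpositions are ascents. -/
theorem IsTiltedReducedWord.isAscendingWord {a : Fin n → Fin n} {v : Equiv.Perm (Fin n)}
    {V : List (Factor n)} (h : IsTiltedReducedWord a v V) : IsAscendingWord a V := by
  obtain ⟨w, hw, hwv⟩ := exists_isAscendingWord a v
  have h1 := hw.compare V h.1.1 (by rw [hwv, h.1.2]; exact fun _ _ => rfl)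
  have h2 := h.2 w hw.isTiltedWord hwv
  rw [WordsCompare, hwv, h.1.2] at h1
  exact h1.2 (by have := h1.1; omega)

/-! ### Reduced words of bi-Grassmannian permutations -/

theorem IsAscendingWord.length_le {a : Fin n → Fin n} {w : List (Factor n)}
    (h : IsAscendingWord a w) (ha : jumps a = ∅) : w.length ≤ tiltedInv a (wordProd w) := by
  induction h with
  | nil a ha => exact Nat.zero_le _
  | s a w i hw hj hlt ih =>
    rw [wordProd_concat_s, tiltedInv_mul_swap hj hlt, List.length_append, List.length_singleton]
    exact Nat.succ_le_succ (ih ha)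
  | bar a ha' => exact absurd ha ha'

theorem jumps_zero : jumps (fun _ : Fin n => (0 : Fin n)) = ∅ := by
  ext k
  simp [mem_jumps, nextEntry]

/-- For the constant sequence, tilted words are plain words and tilted inversions are inversions;
the permutation has an ascending word, whose length is the number of inversions. -/
theorem IsReducedPlainWord.length_le_tiltedInv {t : List (Fin (n - 1))}
    (h : IsReducedPlainWord t) :
    t.length ≤ tiltedInv (fun _ => 0) (wordProd (plainWord t)) := by
  obtain ⟨w, hw, hwv⟩ := exists_isAscendingWord (fun _ => 0) (wordProd (plainWord t))
  have h1 := hw.length_le jumps_zero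
  rw [hwv] at h1
  refine le_trans ?_ h1
  cases hw.isTiltedWord with
  | base _ _ t' =>
    have := h t' hwv
    simpa [plainWord] using this
  | step _ ha => exact absurd jumps_zero ha

/-- The inversions of a bi-Grassmannian permutation are among the pairs of positions in its two
blocks. -/
theorem IsBiGrassmannian.tiltedInv_le {b p : ℕ} {x : Equiv.Perm (Fin n)}
    (h : IsBiGrassmannian b p x) (hp : p ≤ n) : tiltedInv (fun _ => 0) x ≤ p * b := by
  have h1 : ∀ k : Fin n, (laterSmaller 0 x k).card ≤ if k.val < p then b else 0 := by
    intro k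
    have hk := h k
    split_ifs with hkp
    · calc (laterSmaller 0 x k).card ≤
          (Finset.univ.filter fun y : Fin n => y.val < b).card := by
            apply Finset.card_le_card
            intro y hy
            rw [mem_laterSmaller, keyUp_zero, keyUp_zero] at hy
            obtain ⟨j, rfl⟩ := x.surjective y
            rw [apply_mem_firstSet] at hy
            simp only [Finset.mem_filter, Finset.mem_univ, true_and]
            have hj := h j
            split_ifs at hj hk <;> omega
        _ ≤ b := by
            rw [Fin.card_filter_val_lt]
            exact min_le_right _ _
    · rw [Nat.le_zero, Finset.card_eq_zero, Finset.eq_empty_iff_forall_notMem]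
      intro y hy
      rw [mem_laterSmaller, keyUp_zero, keyUp_zero] at hy
      obtain ⟨j, rfl⟩ := x.surjective y
      rw [apply_mem_firstSet] at hy
      have hj := h j
      split_ifs at hj hk <;> omega
  refine (Finset.sum_le_sum fun k _ => h1 k).trans ?_
  rw [← Finset.sum_filter, Finset.sum_const, Fin.card_filter_val_lt, smul_eq_mul,
    min_eq_right hp]

end

section

variable {n : ℕ}

/-! ### Counting crossings along a sequence of adjacent transpositions -/

/-- The pairs `(o, z) ∈ O × Z` such that `o` precedes `z` in the one-line notation of `w`. -/
def crossings (O Z : Finset (Fin n)) (w : Equiv.Perm (Fin n)) : Finset (Fin n × Fin n) :=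
  (O ×ˢ Z).filter fun x => w⁻¹ x.1 < w⁻¹ x.2

/-- An adjacent transposition creates at most one crossing. -/
theorem crossings_mul_swap_subset {O Z : Finset (Fin n)} (hOZ : Disjoint O Z)
    (w : Equiv.Perm (Fin n)) (i : Fin (n - 1)) :
    crossings O Z (w * Equiv.swap (lo i) (hi i)) ⊆
      insert (w (hi i), w (lo i)) (crossings O Z w) := by
  rintro ⟨o, z⟩ hoz
  simp only [crossings, Finset.mem_insert, Finset.mem_filter, Finset.mem_product] at hoz ⊢
  obtain ⟨⟨ho, hz⟩, hlt⟩ := hoz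
  obtain ⟨k, rfl⟩ := w.surjective o
  obtain ⟨l, rfl⟩ := w.surjective z
  have hkl : k ≠ l := by
    rintro rfl
    exact Finset.disjoint_left.1 hOZ ho hz
  have he : ∀ x, w⁻¹ (w x) = x := fun x => by simp
  simp only [_root_.mul_inv_rev, Equiv.swap_inv, Equiv.Perm.mul_apply, he] at hlt ⊢
  by_cases hlt' : k < l
  · exact Or.inr ⟨⟨ho, hz⟩, hlt'⟩
  · left
    have hlk : l < k := lt_of_le_of_ne (not_lt.1 hlt') hkl.symm
    rw [Fin.lt_def] at hlt hlk
    rw [Equiv.swap_apply_def, Equiv.swap_apply_def] at hlt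
    have key : k = hi i ∧ l = lo i := by
      simp only [Fin.ext_iff] at hlt ⊢
      split_ifs at hlt <;> simp only [lo_val, hi_val] at * <;> omega
    rw [key.1, key.2]

theorem card_crossings_step_le {O Z : Finset (Fin n)} (hOZ : Disjoint O Z)
    {w w' : Equiv.Perm (Fin n)} {i : Fin (n - 1)}
    (h : w' = w ∨ w' = w * Equiv.swap (lo i) (hi i)) :
    (crossings O Z w').card ≤ (crossings O Z w).card + 1 := by
  rcases h with rfl | rfl
  · exact Nat.le_succ _
  · exact (Finset.card_le_card (crossings_mul_swap_subset hOZ w i)).trans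
      (Finset.card_insert_le _ _)

theorem card_crossings_step_le_of_not {O Z : Finset (Fin n)} (hOZ : Disjoint O Z)
    {w w' : Equiv.Perm (Fin n)} {i : Fin (n - 1)}
    (h : w' = w ∨ w' = w * Equiv.swap (lo i) (hi i))
    (hn : ¬ (w' = w * Equiv.swap (lo i) (hi i) ∧ w (lo i) ∈ Z ∧ w (hi i) ∈ O)) :
    (crossings O Z w').card ≤ (crossings O Z w).card := by
  rcases h with rfl | rfl
  · exact le_rfl
  · apply Finset.card_le_card
    intro x hx
    rcases Finset.mem_insert.1 (crossings_mul_swap_subset hOZ w i hx) with rfl | h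
    · simp only [crossings, Finset.mem_filter, Finset.mem_product] at hx
      exact absurd ⟨rfl, hx.1.2, hx.1.1⟩ hn
    · exact h

/-- If at most `|O| |Z|` adjacent transpositions suffice to move all elements of `O`, initially
behind those of `Z`, in front of `Z`, each of them exchanges an element of `Z` with an element of
`O`. -/
theorem crossing_at_every_step {O Z : Finset (Fin n)} (hOZ : Disjoint O Z)
    {w : ℕ → Equiv.Perm (Fin n)} {i : ℕ → Fin (n - 1)} {L : ℕ} (hL : L ≤ O.card * Z.card)
    (hw : ∀ m < L, w (m + 1) = w m ∨ w (m + 1) = w m * Equiv.swap (lo (i m)) (hi (i m)))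
    (h0 : ∀ o ∈ O, ∀ z ∈ Z, (w 0)⁻¹ z < (w 0)⁻¹ o)
    (hL' : ∀ o ∈ O, ∀ z ∈ Z, (w L)⁻¹ o < (w L)⁻¹ z) {m : ℕ} (hm : m < L) :
    w (m + 1) = w m * Equiv.swap (lo (i m)) (hi (i m)) ∧ w m (lo (i m)) ∈ Z ∧
      w m (hi (i m)) ∈ O := by
  by_contra hn
  have h1 : ∀ l ≤ L, (crossings O Z (w l)).card + (if m < l then 1 else 0) ≤ l := by
    intro l
    induction l with
    | zero =>
      intro _
      rw [if_neg (Nat.not_lt_zero _), add_zero, Nat.le_zero, Finset.card_eq_zero,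
        crossings, Finset.filter_eq_empty_iff]
      rintro ⟨o, z⟩ hoz
      rw [Finset.mem_product] at hoz
      exact not_lt.2 (h0 o hoz.1 z hoz.2).le
    | succ l ih =>
      intro hl
      have h2 := ih (Nat.le_of_succ_le hl)
      have h3 := card_crossings_step_le hOZ (hw l hl)
      rcases lt_trichotomy m l with hml | rfl | hml
      · rw [if_pos hml] at h2
        rw [if_pos (by omega)]
        omega
      · have h4 := card_crossings_step_le_of_not hOZ (hw m hl) hn
        rw [if_neg (lt_irrefl _)] at h2
        rw [if_pos (by omega)]
        omega
      · rw [if_neg (by omega)] at h2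
        rw [if_neg (by omega)]
        omega
  have h2 := h1 L le_rfl
  rw [if_pos hm] at h2
  have h3 : crossings O Z (w L) = O ×ˢ Z := by
    rw [crossings, Finset.filter_eq_self]
    rintro ⟨o, z⟩ hoz
    rw [Finset.mem_product] at hoz
    exact hL' o hoz.1 z hoz.2
  rw [h3, Finset.card_product] at h2
  omega

/-- All letters of a short word for a bi-Grassmannian permutation act on the first `p + b`
positions. -/
theorem IsBiGrassmannian.letter_lt {b p : ℕ} {t : List (Fin (n - 1))}
    (h : IsBiGrassmannian b p (wordProd (plainWord t))) (hpb : b + p ≤ n)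
    (ht : t.length ≤ p * b) {m : ℕ} (hm : m < t.length) : t[m].val + 1 < b + p := by
  have hlen : (plainWord t).length = t.length := by simp [plainWord]
  have hget : ∀ {m : ℕ} (hm : m < t.length),
      (plainWord t)[m]'(hlen ▸ hm) = Factor.s t[m] := by
    intro m hm
    simp [plainWord]
  let Z : Finset (Fin n) := Finset.univ.filter fun y => y.val < b
  let O : Finset (Fin n) := Finset.univ.filter fun y => b ≤ y.val ∧ y.val < b + p
  have hZ : ∀ y, y ∈ Z ↔ y.val < b := by simp [Z]
  have hO : ∀ y, y ∈ O ↔ b ≤ y.val ∧ y.val < b + p := by simp [O]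
  have hOZ : Disjoint O Z := by
    rw [Finset.disjoint_left]
    intro y hy hy'
    rw [hO] at hy
    rw [hZ] at hy'
    omega
  have hZc : Z.card = b := by
    simp only [Z]
    rw [Fin.card_filter_val_lt]
    omega
  have hOc : O.card = p := by
    have h1 : O ∪ Z = Finset.univ.filter fun y : Fin n => y.val < b + p := by
      ext y
      rw [Finset.mem_union, hO, hZ]
      simp only [Finset.mem_filter, Finset.mem_univ, true_and]
      omega
    have h2 := Finset.card_union_of_disjoint hOZ
    rw [h1, Fin.card_filter_val_lt, hZc] at h2
    omega
  have hstep : ∀ {m : ℕ} (hm : m < t.length), prefixProd (plainWord t) (m + 1) =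
      prefixProd (plainWord t) m * Equiv.swap (lo t[m]) (hi t[m]) := fun hm =>
    prefixProd_succ_s (hlen ▸ hm) (hget hm)
  have key : ∀ (m : ℕ) (hm : m < t.length), prefixProd (plainWord t) m (lo t[m]) ∈ Z ∧
      prefixProd (plainWord t) m (hi t[m]) ∈ O := by
    intro m hm
    have hi0 : t.length ≠ 0 := by omega
    have h1 := crossing_at_every_step hOZ (w := prefixProd (plainWord t))
      (i := fun m => if hm : m < t.length then t[m] else t[0]'(by omega)) (L := t.length)
      (by rw [hOc, hZc]; exact ht) ?_ ?_ ?_ hm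
    · simp only [dif_pos hm] at h1
      exact h1.2
    · intro m hm
      right
      simp only [dif_pos hm]
      exact hstep hm
    · intro o ho z hz
      rw [prefixProd_zero, inv_one, Equiv.Perm.one_apply, Equiv.Perm.one_apply, Fin.lt_def]
      rw [hO] at ho
      rw [hZ] at hz
      omega
    · intro o ho z hz
      rw [← hlen, prefixProd_length, Fin.lt_def]
      rw [hO] at ho
      rw [hZ] at hz
      have h2 := h ((wordProd (plainWord t))⁻¹ o)
      have h3 := h ((wordProd (plainWord t))⁻¹ z)
      have he : ∀ x, wordProd (plainWord t) ((wordProd (plainWord t))⁻¹ x) = x :=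
        fun x => by simp
      rw [he] at h2 h3
      split_ifs at h2 h3 <;> omega
  have hfix : ∀ m ≤ t.length, ∀ y : Fin n, b + p ≤ y.val →
      prefixProd (plainWord t) m y = y := by
    intro m
    induction m with
    | zero =>
      intro _ y _
      rfl
    | succ m ih =>
      intro hm y hy
      have ih' := ih (Nat.le_of_succ_le hm)
      have hk := key m hm
      rw [hZ, hO] at hk
      rw [hstep hm, mul_swap_ne]
      · exact ih' y hy
      · rintro rfl
        rw [ih' _ hy] at hk
        omega
      · rintro rfl
        rw [ih' _ hy] at hk
        omega
  by_contra hge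
  have hk := (key m hm).2
  rw [hfix m hm.le (hi t[m]) (by rw [hi_val]; omega), hO, hi_val] at hk
  omega

end

section

variable {n : ℕ} [NeZero n]

/-! ### The partial products of the parametrization -/

/-- The conditions on a subword `U` of an ascending word `V` that make it distinguished. -/
structure DistinguishedData (a : Fin n → Fin n) (V U : List (Factor n)) : Prop where
  asc : IsAscendingWord a V
  repl : IsReplacement V U
  sim : TiltedSim a (wordProd U) (wordProd V)
  flat : ∀ (j : ℕ) (hj : j < V.length), V[j] = Factor.bar →
    Flattenable (seqAt a V (j + 1)) (prefixProd U j)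
  dist : ∀ (j : ℕ) (hj : j < V.length) (i : Fin (n - 1)), V[j] = Factor.s i →
    TiltedLE (seqAt a V (j + 1)) (prefixProd U (j + 1))
      (prefixProd U j * Equiv.swap (lo i) (hi i))

theorem isDistinguished_iff {a : Fin n → Fin n} {V U : List (Factor n)}
    {u : Equiv.Perm (Fin n)} (hV : IsAscendingWord a V) :
    IsDistinguished a V U u ↔ DistinguishedData a V U ∧ wordProd U = u := by
  constructor
  · rintro ⟨⟨h1, h2, rfl, h4⟩, h5⟩
    exact ⟨⟨hV, h1, h4, (isTiltedWord_filter_iff hV.isTiltedWord h1).1 h2,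
      fun j hj i hx => h5 ⟨j, hj⟩ i hx⟩, rfl⟩
  · rintro ⟨h, rfl⟩
    exact ⟨⟨h.repl, (isTiltedWord_filter_iff hV.isTiltedWord h.repl).2 h.flat, rfl, h.sim⟩,
      fun j i hx => h.dist j j.isLt i hx⟩

variable {a : Fin n → Fin n} {V U : List (Factor n)}

theorem DistinguishedData.sim_at (D : DistinguishedData a V U) {j : ℕ} (hj : j ≤ V.length) :
    TiltedSim (seqAt a V j) (prefixProd U j) (prefixProd V j) :=
  tiltedSim_prefixProd D.asc.isTiltedWord D.repl D.sim j hj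

/-- The three kinds of simple steps of a distinguished subword, in terms of the two entries that are
exchanged or kept. The fourth possibility, keeping the two entries of a descent, is not
distinguished. -/
theorem DistinguishedData.mem_cases (D : DistinguishedData a V U) {j : ℕ} (hj : j < V.length)
    {i : Fin (n - 1)} (hx : V[j] = Factor.s i) :
    (prefixProd U (j + 1) = prefixProd U j * Equiv.swap (lo i) (hi i) ∧
      keyUp (seqAt a V (j + 1) (lo i)) (prefixProd U j (lo i)) <
        keyUp (seqAt a V (j + 1) (lo i)) (prefixProd U j (hi i)) ∧
      (⟨j, hj⟩ : Fin V.length) ∈ JPlus a V U) ∨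
    (prefixProd U (j + 1) = prefixProd U j ∧
      keyUp (seqAt a V (j + 1) (lo i)) (prefixProd U j (lo i)) <
        keyUp (seqAt a V (j + 1) (lo i)) (prefixProd U j (hi i)) ∧
      (⟨j, hj⟩ : Fin V.length) ∉ JPlus a V U ∧ (⟨j, hj⟩ : Fin V.length) ∈ JZero V U) ∨
    (prefixProd U (j + 1) = prefixProd U j * Equiv.swap (lo i) (hi i) ∧
      keyUp (seqAt a V (j + 1) (lo i)) (prefixProd U j (hi i)) <
        keyUp (seqAt a V (j + 1) (lo i)) (prefixProd U j (lo i)) ∧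
      (⟨j, hj⟩ : Fin V.length) ∉ JPlus a V U ∧ (⟨j, hj⟩ : Fin V.length) ∉ JZero V U ∧
      (⟨j, hj⟩ : Fin V.length) ∈ JMinus a V U) := by
  have hd := D.dist j hj i hx
  rcases D.repl.prefixProd_succ_s hj hx with h | h
  · right; left
    rw [h] at hd
    refine ⟨h, lt_of_le_of_ne (tiltedLE_mul_swap_iff.1 hd) (keyUp_lo_ne_hi _ _ _), ?_, ?_⟩
    · rintro ⟨_, h2⟩
      exact h2.2 h.symm
    · exact ⟨⟨i, hx⟩, h.symm⟩
  · rcases lt_or_gt_of_ne (keyUp_lo_ne_hi (seqAt a V (j + 1) (lo i)) (prefixProd U j) i)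
      with hlt | hlt
    · left
      refine ⟨h, hlt, ⟨i, hx⟩, ?_⟩
      simp only [h]
      exact tiltedLT_mul_swap_iff.2 hlt
    · right; right
      refine ⟨h, hlt, ?_, ?_, ⟨i, hx⟩, ?_⟩
      · rintro ⟨_, h2⟩
        simp only [h] at h2
        exact lt_asymm hlt (tiltedLT_mul_swap_iff.1 h2)
      · rintro ⟨_, h2⟩
        simp only [h] at h2
        exact mul_swap_ne_self _ _ h2.symm
      · simp only [h]
        exact mul_swap_tiltedLT_iff.2 hlt

theorem xMat_mul_sDot_inv_coe {n : ℕ} (i : Fin (n - 1)) (m : ℂ) :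
    ((xMat i m * (sDot i)⁻¹ : GL (Fin n) ℂ) : Matrix (Fin n) (Fin n) ℂ) =
      phi i !![-m, 1; -1, 0] := by
  have hA : (!![-m, 1; -1, 0] : Matrix (Fin 2) (Fin 2) ℂ).det ≠ 0 := by
    simp [Matrix.det_fin_two]
  have h : phiUnit i !![-m, 1; -1, 0] hA * sDot i = xMat i m := by
    apply Units.ext
    rw [Units.val_mul, phiUnit_coe, sDot_coe, xMat_coe, ← phi_mul]
    simp
  rw [← h, mul_inv_cancel_right, phiUnit_coe]

theorem factorMatrix_plus (t : Params a V U) {j : Fin V.length} {i : Fin (n - 1)}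
    (hx : V[j] = Factor.s i) (h : j ∈ JPlus a V U) : factorMatrix a V U t j = sDot i := by
  unfold factorMatrix
  split <;> simp_all

theorem factorMatrix_zero (t : Params a V U) {j : Fin V.length} {i : Fin (n - 1)}
    (hx : V[j] = Factor.s i) (h : j ∉ JPlus a V U) (h0 : j ∈ JZero V U) :
    factorMatrix a V U t j = yMat i (t.1 ⟨j, h0⟩) := by
  unfold factorMatrix
  split <;> simp_all

theorem factorMatrix_minus (t : Params a V U) {j : Fin V.length} {i : Fin (n - 1)}
    (hx : V[j] = Factor.s i) (h : j ∉ JPlus a V U) (h0 : j ∉ JZero V U)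
    (h1 : j ∈ JMinus a V U) :
    factorMatrix a V U t j = xMat i (t.2 ⟨j, h1⟩) * (sDot i)⁻¹ := by
  unfold factorMatrix
  split <;> simp_all

theorem factorMatrix_bar (t : Params a V U) {j : Fin V.length}
    (hx : V[j] = Factor.bar) : factorMatrix a V U t j = 1 := by
  unfold factorMatrix
  split <;> simp_all

/-- The product of the first `j` factors `g_1 ⋯ g_j`. -/
noncomputable def partialMatrix (a : Fin n → Fin n) (V U : List (Factor n)) (t : Params a V U)
    (j : ℕ) : GL (Fin n) ℂ :=
  ((List.ofFn (factorMatrix a V U t)).take j).prod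

theorem partialMatrix_zero (t : Params a V U) : partialMatrix a V U t 0 = 1 := rfl

theorem partialMatrix_length (t : Params a V U) :
    partialMatrix a V U t V.length = cellMatrix a V U t := by
  rw [partialMatrix, cellMatrix, List.take_of_length_le (by simp)]

theorem partialMatrix_succ (t : Params a V U) {j : ℕ} (hj : j < V.length) :
    partialMatrix a V U t (j + 1) = partialMatrix a V U t j * factorMatrix a V U t ⟨j, hj⟩ := by
  rw [partialMatrix, partialMatrix, List.prod_take_succ _ _ (by simpa using hj)]
  simp

/-- The `k`-th column of `z` has a nonzero entry in row `u k`, and its other nonzero entries are in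
rows that are larger with respect to `≤_{a_k}`. -/
def IsLow {n : ℕ} (u : Equiv.Perm (Fin n)) (a : Fin n → Fin n) (z : Matrix (Fin n) (Fin n) ℂ) :
    Prop :=
  ∀ k, z (u k) k ≠ 0 ∧ ∀ r, z r k ≠ 0 → keyUp (a k) (u k) ≤ keyUp (a k) r

theorem isLow_one {n : ℕ} (a : Fin n → Fin n) : IsLow 1 a (1 : Matrix (Fin n) (Fin n) ℂ) := by
  intro k
  refine ⟨by rw [Equiv.Perm.one_apply, Matrix.one_apply_eq]; exact one_ne_zero, fun r hr => ?_⟩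
  have : r = k := by
    by_contra h
    exact hr (Matrix.one_apply_ne h)
  rw [this, Equiv.Perm.one_apply]

theorem IsLow.apply_eq_zero {n : ℕ} {u : Equiv.Perm (Fin n)} {a : Fin n → Fin n}
    {z : Matrix (Fin n) (Fin n) ℂ} (h : IsLow u a z) {r k : Fin n}
    (hr : keyUp (a k) r < keyUp (a k) (u k)) : z r k = 0 := by
  by_contra hne
  exact not_lt.2 ((h k).2 r hne) hr

/-- Up to nonzero factors, the step exchanges two columns after adding to the second one a multiple
of the first. The columns become low for `u s_i` if `i` is a descent of `u` or the multiple is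
zero. -/
theorem IsLow.mul_phi_swap {n : ℕ} {u : Equiv.Perm (Fin n)} {a : Fin n → Fin n}
    {z : Matrix (Fin n) (Fin n) ℂ} (h : IsLow u a z) {i : Fin (n - 1)}
    (ha : a (hi i) = a (lo i)) {A : Matrix (Fin 2) (Fin 2) ℂ} (h10 : A 1 0 ≠ 0) (h01 : A 0 1 ≠ 0)
    (h11 : A 1 1 = 0)
    (h00 : A 0 0 = 0 ∨ keyUp (a (lo i)) (u (hi i)) < keyUp (a (lo i)) (u (lo i))) :
    IsLow (u * Equiv.swap (lo i) (hi i)) a (z * phi i A) := by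
  intro k
  rcases eq_or_ne k (lo i) with rfl | hlo
  · rw [mul_swap_lo]
    have hz := h (hi i)
    rw [ha] at hz
    constructor
    · rw [mul_phi_lo]
      rcases h00 with h00 | h00
      · rw [h00, mul_zero, zero_add]
        exact mul_ne_zero hz.1 h10
      · rw [h.apply_eq_zero h00, zero_mul, zero_add]
        exact mul_ne_zero hz.1 h10
    · intro r hr
      rw [mul_phi_lo] at hr
      by_contra hlt
      have h1 : z r (hi i) = 0 := by
        by_contra hne
        exact hlt (hz.2 r hne)
      rw [h1, zero_mul, add_zero] at hr
      rcases h00 with h00 | h00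
      · rw [h00, mul_zero] at hr
        exact hr rfl
      · exact hlt (h00.le.trans ((h (lo i)).2 r (left_ne_zero_of_mul hr)))
  rcases eq_or_ne k (hi i) with rfl | hhi
  · have hz := h (lo i)
    rw [mul_swap_hi, ha]
    simp only [mul_phi_hi, h11, mul_zero, add_zero]
    exact ⟨mul_ne_zero hz.1 h01, fun r hr => hz.2 r (left_ne_zero_of_mul hr)⟩
  · rw [mul_swap_ne u hlo hhi]
    simp only [mul_phi_ne _ _ _ _ hlo hhi]
    exact h k

/-- Up to nonzero factors, the step adds to the column `i` a multiple of the column `i + 1`. The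
columns remain low for `u` if `i` is an ascent of `u`. -/
theorem IsLow.mul_phi_stay {n : ℕ} {u : Equiv.Perm (Fin n)} {a : Fin n → Fin n}
    {z : Matrix (Fin n) (Fin n) ℂ} (h : IsLow u a z) {i : Fin (n - 1)}
    (ha : a (hi i) = a (lo i)) {A : Matrix (Fin 2) (Fin 2) ℂ} (h00 : A 0 0 ≠ 0) (h11 : A 1 1 ≠ 0)
    (h01 : A 0 1 = 0)
    (hlt : keyUp (a (lo i)) (u (lo i)) < keyUp (a (lo i)) (u (hi i))) :
    IsLow u a (z * phi i A) := by
  intro k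
  rcases eq_or_ne k (lo i) with rfl | hlo
  · have hz := h (lo i)
    simp only [mul_phi_lo]
    constructor
    · rw [h.apply_eq_zero (k := hi i) (by rwa [ha]), zero_mul, add_zero]
      exact mul_ne_zero hz.1 h00
    · intro r hr
      by_contra hn
      have h1 : z r (lo i) = 0 := by
        by_contra hne
        exact hn (hz.2 r hne)
      have h2 : z r (hi i) = 0 := by
        by_contra hne
        have := (h (hi i)).2 r hne
        rw [ha] at this
        exact hn (hlt.le.trans this)
      rw [h1, h2, zero_mul, zero_mul, add_zero] at hr
      exact hr rfl
  rcases eq_or_ne k (hi i) with rfl | hhi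
  · have hz := h (hi i)
    simp only [mul_phi_hi, h01, mul_zero, zero_add]
    exact ⟨mul_ne_zero hz.1 h11, fun r hr => hz.2 r (left_ne_zero_of_mul hr)⟩
  · simp only [mul_phi_ne _ _ _ _ hlo hhi]
    exact h k

/-- If the columns of a product remain low after a step at `s_i`, the step has the expected effect
on the extreme bases. -/
theorem HasExtremes.mul_phi {b : Fin n → Fin n} {x v x' : Equiv.Perm (Fin n)} {i : Fin (n - 1)}
    (hi : lo i ∉ jumps b) (hsim : TiltedSim b x v) {z h : GL (Fin n) ℂ}
    (hz : HasExtremes x v b z)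
    (hlt : keyUp (b (lo i)) (v (lo i)) < keyUp (b (lo i)) (v (TiltedDeodhar.hi i)))
    {A : Matrix (Fin 2) (Fin 2) ℂ} (hh : (h : Matrix (Fin n) (Fin n) ℂ) = phi i A)
    (hdet : A.det = 1) (hA : A 1 0 ≠ 0)
    (hx' : x' = x ∨ x' = x * Equiv.swap (lo i) (TiltedDeodhar.hi i))
    (hlow : IsLow x' b ((z * h : GL (Fin n) ℂ) : Matrix (Fin n) (Fin n) ℂ)) :
    HasExtremes x' (v * Equiv.swap (lo i) (TiltedDeodhar.hi i)) b (z * h) := by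
  have hnb := relPos_isNeighbor (relPos_mul_phi z hh hdet hA)
  refine hz.up hi hsim hlt hnb.1 hnb.2 hx' ?_
  have h1 := (hz.leadsAround hi hsim).2.1
  rw [hnb.1 i.val (by omega)] at h1
  have h2 : firstSet x' i.val = firstSet x i.val := by
    rcases hx' with rfl | rfl
    · rfl
    · exact firstSet_mul_swap x i (by omega)
  have h3 := leads_sup_span (keyDown_injective (b (lo i)))
    (E := colSpan ((z * h : GL (Fin n) ℂ) : Matrix (Fin n) (Fin n) ℂ) i.val)
    (c := fun r => ((z * h : GL (Fin n) ℂ) : Matrix (Fin n) (Fin n) ℂ) r (lo i))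
    (w := x' (lo i)) (hlow (lo i)).1 ?_ ?_
  · have h4 := colSpan_succ ((z * h : GL (Fin n) ℂ) : Matrix (Fin n) (Fin n) ℂ) (lo i)
    rw [lo_val] at h4
    rw [h4, h3, h1, firstSet_lo_succ, h2]
  · intro y hy
    have := (hlow (lo i)).2 y hy
    rw [keyDown_eq, keyDown_eq]
    omega
  · rw [h1, ← h2, apply_mem_firstSet, lo_val]
    exact lt_irrefl _

/-! ### Passing a bar -/

/-- Flattening preserves lowness provided that the columns `p+1, …, q` live on the complement of the
interval between the two base points. -/
theorem IsLow.of_flatten {b : Fin n → Fin n} {p : ℕ}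
    {x : Equiv.Perm (Fin n)} {z : Matrix (Fin n) (Fin n) ℂ} (h : IsLow x (flatten b) z)
    (hx : FlattenableAt b p x)
    (hcol : ∀ k ≤ minJump b, p ≤ k.val → (fun r => z r k) ∈ coordSub (jumpInterval b)ᶜ) :
    IsLow x b z := by
  intro k
  have hk := h k
  rcases lt_or_ge (minJump b) k with hlt | hle
  · rwa [flatten_of_lt hlt] at hk
  · rw [flatten_of_le hle] at hk
    rw [apply_eq_of_le_minJump hle]
    refine ⟨hk.1, fun r hr => ?_⟩
    have hr' := hk.2 r hr
    refine (keyUp_le_iff (s := nextEntry b (minJump b)) ?_).2 hr'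
    have hxk := hx.2 k hle
    rw [jumpInterval] at hxk
    by_cases hkp : k.val < p
    · refine iff_of_true (hxk.2 hkp) ?_
      by_contra hn
      exact not_lt.2 hr' (keyUp_lt_of_notMem hn (hxk.2 hkp))
    · refine iff_of_false (fun h' => hkp (hxk.1 h')) fun h' => ?_
      have h1 := mem_coordSub.1 (hcol k hle (not_lt.1 hkp)) r
      rw [jumpInterval, Finset.mem_compl, not_not] at h1
      exact hr (h1 h')

/-- Let `q` be a jump of `a^{(j)}`. It stays a jump of all later sequences, hence no letter behind
the `j`-th one moves an entry across the position `q`. -/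
theorem firstSet_prefixProd_eq {a : Fin n → Fin n} {V w : List (Factor n)} (hV : IsTiltedWord a V)
    (hw : IsReplacement V w) {j : ℕ} {q : Fin n} (hq : q ∈ jumps (seqAt a V j)) :
    ∀ l, j ≤ l → l ≤ V.length →
      firstSet (prefixProd w l) (q.val + 1) = firstSet (prefixProd w j) (q.val + 1) := by
  intro l hjl
  induction l, hjl using Nat.le_induction with
  | base => intro _; rfl
  | succ l hjl ih =>
    intro hl
    rw [← ih (Nat.le_of_succ_le hl)]
    have hl' : l < V.length := hl
    cases hx : V[l] with
    | s i =>
      rcases hw.prefixProd_succ_s hl' hx with h | h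
      · rw [h]
      · rw [h]
        exact firstSet_mul_swap_of_mem_jumps (hV.lo_notMem_jumps hl' hx) _
          (jumps_seqAt_mono (by omega) hl hq)
    | bar => rw [hw.prefixProd_succ_bar hl' hx]
    | one => exact absurd hx (hV.ne_one hl')

theorem isReplacement_refl {n : ℕ} (V : List (Factor n)) : IsReplacement V V := by
  rw [IsReplacement, List.forall₂_same]
  exact fun x _ => Or.inl rfl

/-- The situation at a bar of a regular word. The prefixes of the word and of the subword in front
of the bar are flattenable with the same `p`, and the prefix of the word ends with a segment `t` of
at most `p (q - p)` letters, acting on the first `q` positions, whose product is bi-Grassmannian. -/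
theorem DistinguishedData.regular_segment (D : DistinguishedData a V U)
    (hreg : IsRegularWord a (wordProd V) V) {j : ℕ} (hj : j < V.length) (hx : V[j] = Factor.bar) :
    ∃ (p k : ℕ) (t : List (Fin (n - 1))), k + t.length = j ∧
      (∀ (m : ℕ) (hm : m < t.length) (hkm : k + m < V.length),
        V[k + m] = Factor.s t[m] ∧ t[m].val + 1 < (minJump (seqAt a V (j + 1))).val + 1) ∧
      t.length ≤ p * ((minJump (seqAt a V (j + 1))).val + 1 - p) ∧
      FlattenableAt (seqAt a V (j + 1)) p (prefixProd V j) ∧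
      FlattenableAt (seqAt a V (j + 1)) p (prefixProd U j) ∧
      IsBiGrassmannian ((minJump (seqAt a V (j + 1))).val + 1 - p) p (wordProd (plainWord t)) ∧
      prefixProd V j = prefixProd V k * wordProd (plainWord t) := by
  obtain ⟨hne, hfV⟩ := D.asc.isTiltedWord.flattenable hj hx
  have hfU := D.flat j hj hx
  rw [flattenable_iff hne] at hfV hfU
  obtain ⟨p, hp⟩ := hfV
  obtain ⟨p', hp'⟩ := hfU
  have hsim := D.sim_at (j := j + 1) hj
  rw [D.repl.prefixProd_succ_bar hj hx, prefixProd_succ_bar hj hx] at hsim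
  obtain rfl := FlattenableAt.eq hne hsim hp' hp
  obtain ⟨k, t, hkj, ht, hred, hbi⟩ := hreg ⟨j, hj⟩ hx
  have hpe : (initialSet (wordProd V) (minJump (seqAt a V (j + 1))) ∩
      cyclicIco (seqAt a V (j + 1) 0) (nextEntry (seqAt a V (j + 1))
        (minJump (seqAt a V (j + 1))))).card = p' := by
    rw [initialSet_eq, ← prefixProd_length, firstSet_prefixProd_eq D.asc.isTiltedWord
      (isReplacement_refl V) (minJump_mem hne) V.length hj le_rfl, prefixProd_succ_bar hj hx]
    have := hp.card_inter le_rfl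
    rw [jumpInterval] at this
    rw [this]
    exact min_eq_right hp.1
  simp only at hbi hkj ht
  rw [hpe] at hbi
  have hp1 := hp.1
  have hq := (minJump (seqAt a V (j + 1))).isLt
  have hlen : t.length ≤ p' * ((minJump (seqAt a V (j + 1))).val + 1 - p') :=
    hred.length_le_tiltedInv.trans (hbi.tiltedInv_le (by omega))
  have hlen' : k + t.length = j := by
    have := congrArg List.length ht
    simp only [plainWord, List.length_drop, List.length_take, List.length_map] at this
    omega
  refine ⟨p', k, t, hlen', ?_, hlen, hp, hp', hbi, ?_⟩
  · intro m hm hkm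
    constructor
    · have h1 : ((V.take j).drop k)[m]? = (plainWord t)[m]? := by rw [ht]
      rw [List.getElem?_drop, List.getElem?_take_of_lt (by omega),
        List.getElem?_eq_getElem hkm] at h1
      simpa [plainWord, List.getElem?_eq_getElem hm] using h1
    · have := hbi.letter_lt (by omega) hlen hm
      omega
  · rw [prefixProd, prefixProd, ← wordProd_append, ← ht]
    have : V.take k = (V.take j).take k := by rw [List.take_take, min_eq_left hkj]
    rw [this, List.take_append_drop]

end

section

variable {n : ℕ} [NeZero n]
variable {a : Fin n → Fin n} {V U : List (Factor n)}

theorem hasExtremes_one {n : ℕ} (a : Fin n → Fin n) : HasExtremes 1 1 a (1 : GL (Fin n) ℂ) := by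
  have key : ∀ (κ : Fin n → ℤ), Function.Injective κ → ∀ k : Fin n,
      leads κ (colSpan ((1 : GL (Fin n) ℂ) : Matrix (Fin n) (Fin n) ℂ) (k.val + 1)) =
        firstSet 1 (k.val + 1) := by
    intro κ hκ k
    symm
    apply Finset.eq_of_subset_of_card_le
    · intro x hx
      have hx' : x.val < k.val + 1 := by simpa [mem_firstSet] using hx
      refine mem_leads.2 ⟨_, col_mem_colSpan _ hx', ?_, ?_⟩
      · rw [Units.val_one, Matrix.one_apply_eq]
        exact one_ne_zero
      · intro y hy
        rw [Units.val_one] at hy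
        have : y = x := by
          by_contra h
          exact hy (Matrix.one_apply_ne h)
        rw [this]
    · rw [card_leads_colSpan hκ _ k.isLt, card_firstSet _ k.isLt]
  exact fun k => ⟨key _ (keyUp_injective _) k, key _ (keyDown_injective _) k⟩

/-- The invariants of the partial products `g_1 ⋯ g_j`: the flag lies in the tilted Richardson
variety of the prefixes, and its columns are low for the prefix of the subword. -/
def PartialInvariant (a : Fin n → Fin n) (V U : List (Factor n)) (t : Params a V U) (j : ℕ) :
    Prop :=
  HasExtremes (prefixProd U j) (prefixProd V j) (seqAt a V j) (partialMatrix a V U t j) ∧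
    IsLow (prefixProd U j) (seqAt a V j)
      (partialMatrix a V U t j : Matrix (Fin n) (Fin n) ℂ)

/-- The matrix `g_j` of a simple step, as an element of an embedded `SL_2`. -/
theorem DistinguishedData.exists_phi (D : DistinguishedData a V U) (t : Params a V U) {j : ℕ}
    (hj : j < V.length) {i : Fin (n - 1)} (hx : V[j] = Factor.s i) :
    ∃ A : Matrix (Fin 2) (Fin 2) ℂ,
      (factorMatrix a V U t ⟨j, hj⟩ : Matrix (Fin n) (Fin n) ℂ) = phi i A ∧
      A.det = 1 ∧ A 1 0 ≠ 0 ∧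
      ∀ z : Matrix (Fin n) (Fin n) ℂ, IsLow (prefixProd U j) (seqAt a V (j + 1)) z →
        IsLow (prefixProd U (j + 1)) (seqAt a V (j + 1)) (z * phi i A) := by
  have hb := apply_hi_eq (D.asc.isTiltedWord.lo_notMem_jumps hj hx)
  rcases D.mem_cases hj hx with ⟨h, hlt, hp⟩ | ⟨h, hlt, hp, h0⟩ | ⟨h, hlt, hp, h0, hm⟩
  · refine ⟨!![0, -1; 1, 0], ?_, by simp [Matrix.det_fin_two], by simp, fun z hz => ?_⟩
    · rw [factorMatrix_plus t hx hp, sDot_coe]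
    · rw [h]
      exact hz.mul_phi_swap hb (by simp) (by simp) (by simp) (Or.inl (by simp))
  · refine ⟨!![1, 0; (t.1 ⟨⟨j, hj⟩, h0⟩ : ℂ), 1], ?_, by simp [Matrix.det_fin_two], by simp,
      fun z hz => ?_⟩
    · rw [factorMatrix_zero t hx hp h0, yMat_coe]
    · rw [h]
      exact hz.mul_phi_stay hb (by simp) (by simp) (by simp) hlt
  · refine ⟨!![-t.2 ⟨⟨j, hj⟩, hm⟩, 1; -1, 0], ?_, by simp [Matrix.det_fin_two], by simp,
      fun z hz => ?_⟩
    · rw [factorMatrix_minus t hx hp h0 hm, xMat_mul_sDot_inv_coe]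
    · rw [h]
      exact hz.mul_phi_swap hb (by simp) (by simp) (by simp) (Or.inr hlt)

theorem DistinguishedData.invariant_s (D : DistinguishedData a V U) (t : Params a V U) {j : ℕ}
    (hj : j < V.length) {i : Fin (n - 1)} (hx : V[j] = Factor.s i)
    (h : PartialInvariant a V U t j) : PartialInvariant a V U t (j + 1) := by
  obtain ⟨A, hA, hdet, h10, hlow⟩ := D.exists_phi t hj hx
  have hseq := seqAt_of_ne_bar a hj (by rw [hx]; simp)
  obtain ⟨h1, h2⟩ := h
  rw [hseq] at h1 h2
  have h3 : IsLow (prefixProd U (j + 1)) (seqAt a V (j + 1))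
      (partialMatrix a V U t (j + 1) : Matrix (Fin n) (Fin n) ℂ) := by
    rw [partialMatrix_succ t hj, Units.val_mul, hA]
    exact hlow _ h2
  refine ⟨?_, h3⟩
  have hsim := D.sim_at hj.le
  rw [hseq] at hsim
  rw [partialMatrix_succ t hj] at h3 ⊢
  rw [prefixProd_succ_s hj hx]
  exact h1.mul_phi (D.asc.isTiltedWord.lo_notMem_jumps hj hx) hsim (D.asc.ascent hj hx) hA hdet
    h10 (D.repl.prefixProd_succ_s hj hx) h3

/-- Regularity of the word makes lowness survive a bar: in the segment in front of the bar every
step exchanges an entry outside the interval with an entry inside, so that it contributes `ṡ_i`,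
and the columns belonging to the former entries are only permuted. -/
theorem DistinguishedData.isLow_bar (D : DistinguishedData a V U)
    (hreg : IsRegularWord a (wordProd V) V) (t : Params a V U) {j : ℕ}
    (hj : j < V.length) (hx : V[j] = Factor.bar)
    (ih : ∀ l ≤ j, PartialInvariant a V U t l) :
    IsLow (prefixProd U j) (seqAt a V (j + 1))
      (partialMatrix a V U t j : Matrix (Fin n) (Fin n) ℂ) := by
  obtain ⟨p, k, w, hkj, hw, hlen, hpV, hpU, hbi, hprod⟩ := D.regular_segment hreg hj hx
  have hseqj := seqAt_of_eq_bar a hj hx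
  have hlow := (ih j le_rfl).2
  rw [hseqj] at hlow
  refine hlow.of_flatten hpU ?_
  generalize hb : seqAt a V (j + 1) = b at *
  set Q := (minJump b).val + 1 with hQ
  set S := jumpInterval b with hS
  set c := nextEntry b (minJump b) with hc
  have hQn : Q ≤ n := (minJump b).isLt
  have hpQ : p ≤ Q := hpU.1
  have hSc : IsLowerFor (keyUp c) Sᶜ := isLowerFor_keyUp_compl (b 0) c
  have hletter : ∀ m (hm : m < w.length), V[k + m]'(by omega) = Factor.s w[m] ∧
      w[m].val + 1 < Q := fun m hm => hw m hm (by omega)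
  have hseq : ∀ m ≤ w.length, seqAt a V (k + m) = flatten b := by
    have h1 : ∀ m ≤ w.length, seqAt a V (k + m) = seqAt a V k := by
      intro m
      induction m with
      | zero => intro _; rfl
      | succ m ihm =>
        intro hm
        rw [← ihm (by omega)]
        refine (seqAt_of_ne_bar a (j := k + m) (by omega) ?_).symm
        rw [(hletter m hm).1]
        simp
    intro m hm
    rw [h1 m hm, ← h1 w.length le_rfl, hkj, hseqj]
  have hstep : ∀ m (hm : m < w.length),
      prefixProd U (k + m + 1) = prefixProd U (k + m) ∨ prefixProd U (k + m + 1) =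
        prefixProd U (k + m) * Equiv.swap (lo w[m]) (hi w[m]) := fun m hm =>
    D.repl.prefixProd_succ_s (by omega) (hletter m hm).1
  have hfirst : ∀ m ≤ w.length, firstSet (prefixProd U (k + m)) Q =
      firstSet (prefixProd U k) Q := by
    intro m
    induction m with
    | zero => intro _; rfl
    | succ m ihm =>
      intro hm
      rw [← ihm (by omega), ← add_assoc]
      rcases hstep m hm with h | h
      · rw [h]
      · rw [h]
        exact firstSet_mul_swap _ _ (by have := (hletter m hm).2; omega)
  have hmemS : ∀ {l : Fin n}, l.val < Q → (prefixProd U j l ∈ S ↔ l.val < p) :=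
    fun {l} hl => hpU.2 l (by rw [Fin.le_def]; omega)
  -- the entries inside and outside the interval at the positions up to the jump
  let O := firstSet (prefixProd U j) p
  let Z := firstSet (prefixProd U j) Q \ O
  have hOQ : O ⊆ firstSet (prefixProd U j) Q := by
    intro y hy
    rw [mem_firstSet] at hy ⊢
    omega
  have hOS : ∀ y ∈ O, y ∈ S := by
    intro y hy
    obtain ⟨l, rfl⟩ := (prefixProd U j).surjective y
    rw [apply_mem_firstSet] at hy
    exact (hmemS (by omega)).2 hy
  have hZS : ∀ y ∈ Z, y ∉ S := by
    intro y hy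
    obtain ⟨l, rfl⟩ := (prefixProd U j).surjective y
    rw [Finset.mem_sdiff, apply_mem_firstSet, apply_mem_firstSet] at hy
    rw [hmemS hy.1]
    exact hy.2
  have hOc : O.card = p := card_firstSet _ (by omega)
  have hZc : Z.card = Q - p := by
    rw [Finset.card_sdiff_of_subset hOQ, hOc, card_firstSet _ hQn]
  -- at the start of the segment the first `q - p` columns live outside the interval
  have hspan : colSpan (partialMatrix a V U t k : Matrix (Fin n) (Fin n) ℂ) (Q - p) ≤
      coordSub Sᶜ ∧ firstSet (prefixProd U k) (Q - p) ⊆ Sᶜ := by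
    rcases Nat.eq_zero_or_pos (Q - p) with h0 | hpos
    · rw [h0, colSpan_zero, firstSet_zero]
      exact ⟨bot_le, Finset.empty_subset _⟩
    have hk := (ih k (by omega)).1 ⟨Q - p - 1, by omega⟩
    have hseqk := hseq 0 (Nat.zero_le _)
    rw [add_zero] at hseqk
    rw [hseqk, flatten_of_le (by rw [Fin.le_def]; simp only; omega)] at hk
    simp only [show Q - p - 1 + 1 = Q - p by omega] at hk
    have hle : colSpan (partialMatrix a V U t k : Matrix (Fin n) (Fin n) ℂ) (Q - p) ≤
        coordSub Sᶜ := by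
      intro f hf
      refine mem_coordSub_of_leads hSc ?_ hf
      rw [hk.1]
      intro y hy
      obtain ⟨l, rfl⟩ := (prefixProd V k).surjective y
      rw [apply_mem_firstSet] at hy
      have hσ : wordProd (plainWord w) ⟨l.val + p, by omega⟩ = l := by
        apply Fin.ext
        rw [hbi ⟨l.val + p, by omega⟩]
        simp only
        rw [if_neg (by omega), if_pos (by omega)]
        omega
      have h1 := hpV.2 ⟨l.val + p, by omega⟩ (by rw [Fin.le_def]; simp only; omega)
      rw [hprod, Equiv.Perm.mul_apply, hσ] at h1
      rw [Finset.mem_compl, h1]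
      simp only
      omega
    exact ⟨hle, hk.2 ▸ leads_subset_of_le_coordSub hle⟩
  have hfk : firstSet (prefixProd U k) Q = firstSet (prefixProd U j) Q := by
    rw [← hfirst w.length le_rfl, hkj]
  have hZk : firstSet (prefixProd U k) (Q - p) = Z := by
    apply Finset.eq_of_subset_of_card_le
    · intro y hy
      rw [Finset.mem_sdiff, ← hfk]
      refine ⟨?_, fun hyO => Finset.mem_compl.1 (hspan.2 hy) (hOS y hyO)⟩
      rw [mem_firstSet] at hy ⊢
      omega
    · rw [hZc, card_firstSet _ (by omega)]
  -- moving the `p` entries of `O` past the `q - p` entries of `Z` takes all letters of the segment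
  have hcross : ∀ m (hm : m < w.length), prefixProd U (k + m + 1) =
      prefixProd U (k + m) * Equiv.swap (lo w[m]) (hi w[m]) ∧
      prefixProd U (k + m) (lo w[m]) ∈ Z ∧ prefixProd U (k + m) (hi w[m]) ∈ O := by
    intro m hm
    have h1 := crossing_at_every_step (O := O) (Z := Z) Finset.disjoint_sdiff
      (w := fun m => prefixProd U (k + m))
      (i := fun m => if hm : m < w.length then w[m] else w[0]'(by omega)) (L := w.length)
      (by rw [hOc, hZc]; exact hlen) ?_ ?_ ?_ hm
    · simp only [dif_pos hm] at h1
      exact h1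
    · intro m hm
      simp only [dif_pos hm]
      exact hstep m hm
    · intro o ho z hz
      rw [← hZk, mem_firstSet] at hz
      have ho' : o ∉ Z := fun h => hZS o h (hOS o ho)
      rw [← hZk, mem_firstSet] at ho'
      rw [Fin.lt_def, add_zero]
      omega
    · intro o ho z hz
      simp only [hkj]
      rw [mem_firstSet] at ho
      rw [Finset.mem_sdiff, mem_firstSet, mem_firstSet] at hz
      rw [Fin.lt_def]
      omega
  -- the entries of `Z` precede those of `O` in the flattened order, so every step is in `J⁺`, and
  -- the columns belonging to `Z` are moved along with their entries
  have hcols : ∀ m ≤ w.length, ∀ l, prefixProd U (k + m) l ∈ Z →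
      (fun r => (partialMatrix a V U t (k + m) : Matrix (Fin n) (Fin n) ℂ) r l) ∈
        coordSub Sᶜ := by
    intro m
    induction m with
    | zero =>
      intro _ l hl
      rw [← hZk, add_zero, apply_mem_firstSet] at hl
      exact hspan.1 (col_mem_colSpan _ hl)
    | succ m ihm =>
      intro hm l hl
      have ihm' := ihm (by omega)
      obtain ⟨h1, h2, h3⟩ := hcross m hm
      have hkm : k + m < V.length := by omega
      have hplus : (⟨k + m, hkm⟩ : Fin V.length) ∈ JPlus a V U := by
        rcases D.mem_cases hkm (hletter m hm).1 with ⟨_, _, h⟩ | ⟨h, _⟩ | ⟨_, h, _⟩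
        · exact h
        · rw [h1] at h
          exact absurd h (mul_swap_ne_self _ _)
        · have h4 : seqAt a V (k + m + 1) (lo w[m]) = c := by
            have := hseq (m + 1) hm
            rw [← add_assoc] at this
            rw [this, flatten_of_le]
            rw [Fin.le_def, lo_val]
            have := (hletter m hm).2
            omega
          rw [h4] at h
          exact absurd h (lt_asymm (hSc _ (Finset.mem_compl.2 (hZS _ h2)) _
            fun h5 => Finset.mem_compl.1 h5 (hOS _ h3)))
      rw [← add_assoc] at hl ⊢
      rw [h1] at hl
      rw [partialMatrix_succ t hkm, factorMatrix_plus t (hletter m hm).1 hplus, Units.val_mul,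
        sDot_coe]
      rcases eq_or_ne l (lo w[m]) with rfl | hlo
      · rw [mul_swap_lo] at hl
        exact absurd h3 (Finset.mem_sdiff.1 hl).2
      rcases eq_or_ne l (hi w[m]) with rfl | hhi
      · rw [mul_swap_hi] at hl
        have h5 := ihm' _ hl
        rw [mem_coordSub] at h5 ⊢
        intro r hr
        rw [mul_phi_hi, h5 r hr]
        simp
      · rw [mul_swap_ne _ hlo hhi] at hl
        simp only [mul_phi_ne _ _ _ _ hlo hhi]
        exact ihm' _ hl
  intro l hl hpl
  have h1 := hcols w.length le_rfl l
  rw [hkj] at h1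
  rw [Fin.le_def] at hl
  refine h1 (Finset.mem_sdiff.2 ⟨apply_mem_firstSet.2 (by omega), ?_⟩)
  rw [apply_mem_firstSet]
  omega

theorem DistinguishedData.invariant_bar (D : DistinguishedData a V U)
    (hreg : IsRegularWord a (wordProd V) V) (t : Params a V U) {j : ℕ}
    (hj : j < V.length) (hx : V[j] = Factor.bar)
    (ih : ∀ l ≤ j, PartialInvariant a V U t l) : PartialInvariant a V U t (j + 1) := by
  have hlow := D.isLow_bar hreg t hj hx ih
  obtain ⟨p, _, _, _, _, _, hpV, hpU, _⟩ := D.regular_segment hreg hj hx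
  have h := (ih j le_rfl).1
  rw [seqAt_of_eq_bar a hj hx] at h
  rw [PartialInvariant, partialMatrix_succ t hj, factorMatrix_bar t (j := ⟨j, hj⟩) hx, mul_one,
    D.repl.prefixProd_succ_bar hj hx, prefixProd_succ_bar hj hx]
  exact ⟨h.of_flatten hpU hpV, hlow⟩

/-- All partial products of the parametrization lie in the varieties of the prefixes. -/
theorem DistinguishedData.invariant (D : DistinguishedData a V U)
    (hreg : IsRegularWord a (wordProd V) V) (t : Params a V U) {j : ℕ} (hj : j ≤ V.length) :
    PartialInvariant a V U t j := by
  induction j using Nat.strong_induction_on with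
  | _ j ih =>
    rcases j with _ | j
    · exact ⟨hasExtremes_one _, isLow_one _⟩
    · have hj' : j < V.length := hj
      cases hx : V[j] with
      | s i => exact D.invariant_s t hj' hx (ih j (by omega) hj'.le)
      | bar => exact D.invariant_bar hreg t hj' hx fun l hl => ih l (by omega) (by omega)
      | one => exact absurd hx (D.asc.isTiltedWord.ne_one hj')

end

section

variable {n : ℕ} [NeZero n]
variable {a : Fin n → Fin n} {V U : List (Factor n)}

/-! ### Chains of flags -/

/-- A chain of flags `y_0 = B, …, y_ℓ` as in the definition of a Deodhar cell, given by
representatives, the cell conditions being expressed by extreme bases. -/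
structure IsFlagChain (a : Fin n → Fin n) (V U : List (Factor n)) (y : ℕ → GL (Fin n) ℂ) :
    Prop where
  zero : toFlag (y 0) = toFlag 1
  extremes : ∀ j ≤ V.length,
    HasExtremes (prefixProd U j) (prefixProd V j) (seqAt a V j) (y j)
  step : ∀ (j : ℕ) (hj : j < V.length), StepRel V[j] (toFlag (y j)) (toFlag (y (j + 1)))

/-- In the definition of a Deodhar cell, the intersections of tilted Schubert cells can be replaced
by the conditions on extreme bases, because `u^{(j)} ∼ v^{(j)}` for all `j`. -/
theorem DistinguishedData.mem_deodharCell_iff (D : DistinguishedData a V U)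
    (huv : TiltedLE a (wordProd U) (wordProd V)) {F : Flag n} :
    F ∈ deodharCell a V U ↔ ∃ y, IsFlagChain a V U y ∧ toFlag (y V.length) = F := by
  constructor
  · rintro ⟨_, y, h0, hl, hc, hs⟩
    have hsurj : ∀ F : Flag n, ∃ g, toFlag g = F := QuotientGroup.mk_surjective
    choose r hr using hsurj
    have hy : ∀ j (hj : j ≤ V.length),
        toFlag (r (y ⟨min j V.length, by omega⟩)) = y ⟨j, by omega⟩ := by
      intro j hj
      rw [hr]
      congr 1
      exact Fin.ext (min_eq_left hj)
    refine ⟨fun j => r (y ⟨min j V.length, by omega⟩), ⟨?_, ?_, ?_⟩, ?_⟩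
    · exact (hy 0 (Nat.zero_le _)).trans h0
    · intro j hj
      have h1 := hc ⟨j, by omega⟩
      rw [← hy j hj] at h1
      exact hasExtremes_of_mem_cells (D.sim_at hj) h1.1 h1.2
    · intro j hj
      rw [hy j hj.le, hy (j + 1) hj]
      exact hs ⟨j, hj⟩
    · exact (hy V.length le_rfl).trans hl
  · rintro ⟨y, hy, rfl⟩
    refine ⟨?_, fun j => toFlag (y j), hy.zero, rfl, fun j => ?_, fun j => hy.step j j.isLt⟩
    · rw [mem_openTiltedRichardson huv]
      have h := hy.extremes V.length le_rfl
      have hU : prefixProd U V.length = wordProd U := by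
        rw [← D.repl.length_eq, prefixProd_length]
      rwa [seqAt_length, prefixProd_length, hU] at h
    · exact (hy.extremes j (by omega)).mem_cells

/-- The parametrization takes values in the Deodhar cell. -/
theorem isFlagChain_partialMatrix (D : DistinguishedData a V U)
    (hreg : IsRegularWord a (wordProd V) V) (t : Params a V U) :
    IsFlagChain a V U (partialMatrix a V U t) where
  zero := rfl
  extremes j hj := (D.invariant hreg t hj).1
  step j hj := by
    rw [partialMatrix_succ t hj]
    cases hx : V[j] with
    | s i =>
      obtain ⟨A, hA, hdet, h10, _⟩ := D.exists_phi t hj hx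
      exact relPos_mul_phi _ hA hdet h10
    | bar =>
      rw [factorMatrix_bar t (j := ⟨j, hj⟩) hx, mul_one]
      rfl
    | one => exact absurd hx (D.asc.isTiltedWord.ne_one hj)

/-- The flags of a chain are determined by the last one: the word is ascending, and so every flag is
the unique flag of the cell of `v^{(j)}` among its neighbours. -/
theorem IsFlagChain.toFlag_eq {U' : List (Factor n)} (D : DistinguishedData a V U)
    (D' : DistinguishedData a V U') {y y' : ℕ → GL (Fin n) ℂ} (h : IsFlagChain a V U y)
    (h' : IsFlagChain a V U' y') (hl : toFlag (y V.length) = toFlag (y' V.length)) {j : ℕ}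
    (hj : j ≤ V.length) : toFlag (y j) = toFlag (y' j) := by
  induction hj using Nat.decreasingInduction with
  | self => exact hl
  | of_succ j hj ih =>
    have hs := h.step j hj
    have hs' := h'.step j hj
    cases hx : V[j] with
    | s i =>
      rw [hx] at hs hs'
      have hseq := seqAt_of_ne_bar a hj (by rw [hx]; simp)
      have hlo := D.asc.isTiltedWord.lo_notMem_jumps hj hx
      have e := h.extremes j hj.le
      have e' := h'.extremes j hj.le
      have s := D.sim_at hj.le
      have s' := D'.sim_at hj.le
      rw [hseq] at e e' s s'
      refine down_unique (keyUp_injective _) (e.leadsAround hlo s).1 (e'.leadsAround hlo s').1 ?_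
        (D.asc.ascent hj hx)
      exact (relPos_isNeighbor hs).1.trans
        ((isNeighbor_of_toFlag_eq i ih).trans (relPos_isNeighbor hs').1.symm)
    | bar =>
      rw [hx] at hs hs'
      exact Eq.trans hs (ih.trans (Eq.symm hs'))
    | one => exact absurd hx (D.asc.isTiltedWord.ne_one hj)

/-- The cells are disjoint: the chain is determined by its last flag, and the lower extremes of its
flags are the partial products of the subword. -/
theorem IsFlagChain.subword_eq {U' : List (Factor n)} (D : DistinguishedData a V U)
    (D' : DistinguishedData a V U') {y y' : ℕ → GL (Fin n) ℂ} (h : IsFlagChain a V U y)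
    (h' : IsFlagChain a V U' y') (hl : toFlag (y V.length) = toFlag (y' V.length)) : U = U' := by
  refine D.repl.eq_of_prefixProd D'.repl fun j hj => ?_
  exact ((h.extremes j hj).congr (h.toFlag_eq D D' h' hl hj)).left_unique (h'.extremes j hj)

/-! ### Every flag lies in a cell -/

/-- Dependent choice, running backwards from `L` to `0`. -/
theorem exists_backward {α : Type*} {P : ℕ → α → Prop} {R : ℕ → α → α → Prop} {L : ℕ} {s : α}
    (hs : P L s) (h : ∀ j < L, ∀ s', P (j + 1) s' → ∃ s, P j s ∧ R j s s') :
    ∃ f : ℕ → α, f L = s ∧ (∀ j ≤ L, P j (f j)) ∧ ∀ j < L, R j (f j) (f (j + 1)) := by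
  induction L generalizing s with
  | zero =>
    refine ⟨fun _ => s, rfl, fun j hj => ?_, fun j hj => absurd hj (Nat.not_lt_zero j)⟩
    rwa [Nat.le_zero.1 hj]
  | succ L ih =>
    obtain ⟨s₀, hs₀, hR⟩ := h L (Nat.lt_succ_self L) s hs
    obtain ⟨f, hf, hP, hRf⟩ := ih hs₀ fun j hj => h j (by omega)
    have hne : ∀ j ≤ L, Function.update f (L + 1) s j = f j := fun j hj =>
      Function.update_of_ne (by omega) _ _
    refine ⟨Function.update f (L + 1) s, Function.update_self _ _ _, fun j hj => ?_,
      fun j hj => ?_⟩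
    · rcases Nat.lt_or_ge L j with hlt | hle
      · obtain rfl : j = L + 1 := by omega
        rwa [Function.update_self]
      · rw [hne j hle]
        exact hP j hle
    · rcases Nat.lt_or_ge j L with hlt | hle
      · rw [hne j hlt.le, hne (j + 1) hlt]
        exact hRf j hlt
      · obtain rfl : j = L := by omega
        rw [hne j le_rfl, Function.update_self, hf]
        exact hR

/-- For the constant sequence, the cell of the identity permutation is the base point. -/
theorem HasExtremes.toFlag_eq_one {b : Fin n → Fin n} (hb : ∀ k, b k = 0)
    {x : Equiv.Perm (Fin n)} {g : GL (Fin n) ℂ} (h : HasExtremes x 1 b g) :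
    toFlag g = toFlag 1 := by
  have hg : g ∈ borel n := by
    rw [mem_borel]
    intro r k hkr
    have h1 := (h k).1
    rw [hb] at h1
    have hS : IsLowerFor (keyUp (0 : Fin n)) (firstSet (1 : Equiv.Perm (Fin n)) (k.val + 1)) := by
      intro x hx y hy
      rw [mem_firstSet, inv_one, Equiv.Perm.one_apply] at hx hy
      rw [keyUp_zero, keyUp_zero]
      omega
    have h2 := mem_coordSub_of_leads hS (Finset.subset_of_eq h1)
      (col_mem_colSpan (g : Matrix (Fin n) (Fin n) ℂ) (Nat.lt_succ_self k.val))
    refine mem_coordSub.1 h2 r ?_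
    rw [mem_firstSet, inv_one, Equiv.Perm.one_apply]
    rw [Fin.lt_def] at hkr
    omega
  rw [← toFlag_mul_borel 1 hg, one_mul]

/-- The subword of `V` whose prefixes have the products `x 0, x 1, …`. -/
def subwordOf {n : ℕ} (V : List (Factor n)) (x : ℕ → Equiv.Perm (Fin n)) : List (Factor n) :=
  List.ofFn fun j : Fin V.length =>
    if V[j] ≠ Factor.bar ∧ x j = x (j + 1) then Factor.one else V[j]

theorem isReplacement_subwordOf {n : ℕ} {V : List (Factor n)} (x : ℕ → Equiv.Perm (Fin n))
    (hV : ∀ (j : ℕ) (hj : j < V.length), V[j] ≠ Factor.one) :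
    IsReplacement V (subwordOf V x) := by
  rw [IsReplacement, List.forall₂_iff_get]
  refine ⟨by simp [subwordOf], fun j h1 h2 => ?_⟩
  simp only [subwordOf, List.get_eq_getElem, List.getElem_ofFn, Fin.getElem_fin]
  split_ifs with h
  · right
    refine ⟨rfl, ?_⟩
    cases hx : V[j] with
    | s i => exact ⟨i, rfl⟩
    | bar => exact absurd hx h.1
    | one => exact absurd hx (hV j h2)
  · exact Or.inl rfl

theorem prefixProd_subwordOf {n : ℕ} {V : List (Factor n)} {x : ℕ → Equiv.Perm (Fin n)}
    (h0 : x 0 = 1)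
    (hs : ∀ (j : ℕ) (hj : j < V.length) (i : Fin (n - 1)), V[j] = Factor.s i →
      x j = x (j + 1) ∨ x j = x (j + 1) * Equiv.swap (lo i) (hi i))
    (hb : ∀ (j : ℕ) (hj : j < V.length), V[j] = Factor.bar → x j = x (j + 1))
    (hV : ∀ (j : ℕ) (hj : j < V.length), V[j] ≠ Factor.one) :
    ∀ j ≤ V.length, prefixProd (subwordOf V x) j = x j := by
  intro j
  induction j with
  | zero => intro _; rw [h0, prefixProd_zero]
  | succ j ih =>
    intro hj
    have hj' : j < V.length := hj
    rw [prefixProd_succ _ (by simpa [subwordOf] using hj'), ih hj'.le]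
    simp only [subwordOf, List.getElem_ofFn, Fin.getElem_fin]
    cases hx : V[j] with
    | s i =>
      rcases hs j hj' i hx with h | h
      · rw [if_pos ⟨by simp, h⟩, ← h]
        exact mul_one _
      · have hne : x j ≠ x (j + 1) := by
          rw [h]
          exact mul_swap_ne_self _ _
        rw [if_neg (fun h' => hne h'.2), h]
        exact mul_swap_mul_swap _ _
    | bar =>
      rw [if_neg (fun h' => h'.1 rfl), ← hb j hj' hx]
      exact mul_one _
    | one => exact absurd hx (hV j hj')

/-- Going down along the word from a flag of the tilted Richardson variety produces a distinguished
subword and a chain. -/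
theorem exists_isFlagChain (hV : IsAscendingWord a V) {u : Equiv.Perm (Fin n)}
    (hsim : TiltedSim a u (wordProd V)) {g : GL (Fin n) ℂ}
    (hg : HasExtremes u (wordProd V) a g) :
    ∃ U, DistinguishedData a V U ∧ wordProd U = u ∧ ∃ y, IsFlagChain a V U y ∧
      toFlag (y V.length) = toFlag g := by
  have hT := hV.isTiltedWord
  -- the states are pairs of a flag and its lower extreme
  obtain ⟨f, hfL, hP, hR⟩ := exists_backward
    (P := fun j (s : GL (Fin n) ℂ × Equiv.Perm (Fin n)) =>
      HasExtremes s.2 (prefixProd V j) (seqAt a V j) s.1 ∧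
        TiltedSim (seqAt a V j) s.2 (prefixProd V j))
    (R := fun j s s' => ∀ hj : j < V.length,
      StepRel V[j] (toFlag s.1) (toFlag s'.1) ∧
      (V[j] = Factor.bar → s.2 = s'.2 ∧ Flattenable (seqAt a V (j + 1)) s.2) ∧
      ∀ i, V[j] = Factor.s i → (s.2 = s'.2 ∨ s.2 = s'.2 * Equiv.swap (lo i) (hi i)) ∧
        TiltedLE (seqAt a V (j + 1)) s'.2 (s.2 * Equiv.swap (lo i) (hi i)))
    (L := V.length) (s := (g, u))
    (by rw [prefixProd_length, seqAt_length]; exact ⟨hg, hsim⟩) (by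
      rintro j hj ⟨h, x⟩ ⟨h1, h2⟩
      simp only at h1 h2
      cases hx : V[j] with
      | s i =>
        have hlo := hT.lo_notMem_jumps hj hx
        obtain ⟨h', x', hx', hrel, hex, hle⟩ := h1.exists_down hlo h2
        rw [prefixProd_succ_s hj hx, mul_swap_mul_swap] at hex
        rw [prefixProd_succ_s hj hx] at h2
        have h3 := h2.mul_swap_right hlo
        rw [mul_swap_mul_swap] at h3
        refine ⟨(h', x'), ?_, fun _ => ⟨by rw [hx]; exact hrel, by simp [hx], ?_⟩⟩
        · rw [seqAt_of_ne_bar a hj (by rw [hx]; simp)]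
          refine ⟨hex, ?_⟩
          rcases hx' with rfl | rfl
          · exact h3
          · exact h3.mul_swap_left hlo
        · intro i' hi'
          rw [hx] at hi'
          obtain rfl := Factor.s.inj hi'
          exact ⟨hx', hle⟩
      | bar =>
        obtain ⟨hne, hf⟩ := hT.flattenable hj hx
        rw [prefixProd_succ_bar hj hx] at h1 h2
        rw [flattenable_iff hne] at hf
        obtain ⟨p, hp⟩ := hf
        have hp' := hp.of_hasExtremes hne h2 h1
        refine ⟨(h, x), ?_, fun _ => ⟨by rw [hx]; rfl, fun _ => ⟨rfl, ?_⟩, by simp [hx]⟩⟩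
        · rw [seqAt_of_eq_bar a hj hx]
          exact ⟨h1.flatten hp' hp, h2.flatten⟩
        · exact (flattenable_iff hne).2 ⟨p, hp'⟩
      | one => exact absurd hx (hT.ne_one hj))
  have hz : ∀ k, seqAt a V 0 k = 0 := eq_zero_of_jumps_eq_empty hT.jumps_seqAt_zero
  have h0 := (hP 0 (Nat.zero_le _)).1
  rw [prefixProd_zero] at h0
  have hbase := h0.toFlag_eq_one hz
  have hx0 : (f 0).2 = 1 := (h0.congr hbase).left_unique (hasExtremes_one _)
  have hne : ∀ (j : ℕ) (hj : j < V.length), V[j] ≠ Factor.one := fun j hj => hT.ne_one hj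
  have hpre := prefixProd_subwordOf (V := V) (x := fun j => (f j).2) hx0
    (fun j hj i hx => ((hR j hj hj).2.2 i hx).1) (fun j hj hx => ((hR j hj hj).2.1 hx).1) hne
  have hrepl := isReplacement_subwordOf (V := V) (fun j => (f j).2) hne
  have hprod : wordProd (subwordOf V fun j => (f j).2) = u := by
    rw [← prefixProd_length, hrepl.length_eq, hpre _ le_rfl, hfL]
  refine ⟨subwordOf V fun j => (f j).2, ⟨hV, hrepl, hprod ▸ hsim, ?_, ?_⟩, hprod,
    fun j => (f j).1, ⟨hbase, ?_, fun j hj => (hR j hj hj).1⟩,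
    congrArg (fun s => toFlag s.1) hfL⟩
  · intro j hj hx
    rw [hpre j hj.le]
    exact ((hR j hj hj).2.1 hx).2
  · intro j hj i hx
    rw [hpre j hj.le, hpre (j + 1) hj]
    exact ((hR j hj hj).2.2 i hx).2
  · intro j hj
    rw [hpre j hj]
    exact (hP j hj).1

end

section

variable {n : ℕ} [NeZero n]
variable {a : Fin n → Fin n} {V U : List (Factor n)}

/-! ### The parametrization is onto -/

theorem partialMatrix_congr {t t' : Params a V U} {K : ℕ} (hK : K ≤ V.length)
    (h : ∀ j : Fin V.length, j.val < K → factorMatrix a V U t j = factorMatrix a V U t' j) :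
    ∀ j ≤ K, partialMatrix a V U t j = partialMatrix a V U t' j := by
  intro j
  induction j with
  | zero => intro _; rw [partialMatrix_zero, partialMatrix_zero]
  | succ j ih =>
    intro hj
    have hj' : j < V.length := by omega
    rw [partialMatrix_succ t hj', partialMatrix_succ t' hj', ih (by omega), h ⟨j, hj'⟩ hj]

theorem factorMatrix_congr {t t' : Params a V U} {j : Fin V.length}
    (h0 : ∀ h : j ∈ JZero V U, t.1 ⟨j, h⟩ = t'.1 ⟨j, h⟩)
    (h1 : ∀ h : j ∈ JMinus a V U, t.2 ⟨j, h⟩ = t'.2 ⟨j, h⟩) :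
    factorMatrix a V U t j = factorMatrix a V U t' j := by
  unfold factorMatrix
  split
  · split_ifs with h2 h3 h4
    · rfl
    · rw [h0 h3]
    · rw [h1 h4]
    · rfl
  · rfl
  · rfl

theorem toFlag_mul_xMat_sDot_inv {n : ℕ} (z : GL (Fin n) ℂ) (i : Fin (n - 1)) (m : ℂ) :
    toFlag (z * (xMat i m * (sDot i)⁻¹)) = toFlag (z * (xMat i m * sDot i)) := by
  have hA : (!![-1, 0; 0, -1] : Matrix (Fin 2) (Fin 2) ℂ).det ≠ 0 := by
    simp [Matrix.det_fin_two]
  have h : xMat i m * sDot i * phiUnit i _ hA = xMat i m * (sDot i)⁻¹ := by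
    apply Units.ext
    rw [Units.val_mul, phiUnit_coe, xMat_mul_sDot_coe, xMat_mul_sDot_inv_coe, ← phi_mul]
    simp
  rw [← h, ← mul_assoc z _ (phiUnit i _ hA)]
  exact toFlag_mul_borel _ (phi_mem_borel i (by simp) (phiUnit_coe i _ hA))

theorem toFlag_mul_yMat {n : ℕ} (z : GL (Fin n) ℂ) (i : Fin (n - 1)) {m : ℂ} (hm : m ≠ 0) :
    toFlag (z * yMat i m⁻¹) = toFlag (z * (xMat i m * sDot i)) := by
  have hA : (!![m⁻¹, 1; 0, m] : Matrix (Fin 2) (Fin 2) ℂ).det ≠ 0 := by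
    simp [Matrix.det_fin_two, hm]
  have h : xMat i m * sDot i * phiUnit i _ hA = yMat i m⁻¹ := by
    apply Units.ext
    rw [Units.val_mul, phiUnit_coe, xMat_mul_sDot_coe, yMat_coe, ← phi_mul]
    simp [hm]
  rw [← h, ← mul_assoc z _ (phiUnit i _ hA)]
  exact toFlag_mul_borel _ (phi_mem_borel i (by simp) (phiUnit_coe i _ hA))

/-- A neighbour of `zB` with the prescribed extreme bases is obtained from `z` by the factor `g_j`
for a suitable value of the parameter. -/
theorem DistinguishedData.exists_params_step (D : DistinguishedData a V U) {j : ℕ}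
    (hj : j < V.length) {i : Fin (n - 1)} (hx : V[j] = Factor.s i) (t : Params a V U)
    (hz : PartialInvariant a V U t j) {y : GL (Fin n) ℂ}
    (hy : HasExtremes (prefixProd U (j + 1)) (prefixProd V (j + 1)) (seqAt a V (j + 1)) y)
    (hrel : RelPos (Equiv.swap (lo i) (hi i)) (toFlag (partialMatrix a V U t j)) (toFlag y)) :
    ∃ t' : Params a V U, (∀ l : Fin V.length, l.val < j →
      factorMatrix a V U t l = factorMatrix a V U t' l) ∧
      toFlag (partialMatrix a V U t j * factorMatrix a V U t' ⟨j, hj⟩) = toFlag y := by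
  classical
  have hlo := D.asc.isTiltedWord.lo_notMem_jumps hj hx
  have hb := apply_hi_eq hlo
  have hseq := seqAt_of_ne_bar a hj (by rw [hx]; simp)
  obtain ⟨h1, h2⟩ := id hz
  rw [hseq] at h1 h2
  have hsim := D.sim_at hj.le
  rw [hseq] at hsim
  obtain ⟨m, hm⟩ := exists_of_relPos hrel
  rcases D.mem_cases hj hx with ⟨h, hlt, hp⟩ | ⟨h, hlt, hp, h0⟩ | ⟨h, hlt, hp, h0, hmin⟩
  · refine ⟨t, fun _ _ => rfl, ?_⟩
    have hz' := (D.invariant_s t hj hx hz).1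
    rw [partialMatrix_succ t hj] at hz'
    have hnb : IsNeighbor i (partialMatrix a V U t j * factorMatrix a V U t ⟨j, hj⟩) y := by
      obtain ⟨A, hA, -⟩ := D.exists_phi t hj hx
      exact (isNeighbor_mul_phi _ hA).symm.trans (relPos_isNeighbor hrel).1
    refine down_unique (keyDown_injective _) (hz'.leadsAround hlo (D.sim_at hj)).2
      (hy.leadsAround hlo (D.sim_at hj)).2 hnb ?_
    rw [h, mul_swap_lo, mul_swap_hi, keyDown_eq, keyDown_eq]
    omega
  · -- for `m = 0` the step would be `ṡ_i`, which moves the lower extreme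
    have hm0 : m ≠ 0 := by
      rintro rfl
      have hx0 : xMat i 0 * sDot i = (sDot i : GL (Fin n) ℂ) := by
        apply Units.ext
        rw [xMat_mul_sDot_coe, sDot_coe]
      rw [hx0] at hm
      have h3 := h1.mul_phi (x' := prefixProd U j * Equiv.swap (lo i) (hi i)) hlo hsim
        (D.asc.ascent hj hx) (sDot_coe i) (by simp [Matrix.det_fin_two]) (by simp) (Or.inr rfl) (by
          rw [Units.val_mul, sDot_coe]
          exact h2.mul_phi_swap hb (by simp) (by simp) (by simp) (Or.inl (by simp)))
      rw [← prefixProd_succ_s hj hx] at h3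
      have h4 := (h3.congr hm.symm).left_unique hy
      rw [h] at h4
      exact mul_swap_ne_self _ _ h4
    refine ⟨(Function.update t.1 ⟨⟨j, hj⟩, h0⟩ (Units.mk0 m⁻¹ (inv_ne_zero hm0)), t.2),
      fun l hl => factorMatrix_congr (fun h' => ?_) fun _ => rfl, ?_⟩
    · refine (Function.update_of_ne (fun he => ?_) _ _).symm
      have := congrArg (fun x => x.1.val) he
      simp only at this
      omega
    · rw [factorMatrix_zero _ hx hp h0, hm]
      simp only [Function.update_self, Units.val_mk0]
      exact toFlag_mul_yMat _ i hm0
  · refine ⟨(t.1, Function.update t.2 ⟨⟨j, hj⟩, hmin⟩ m),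
      fun l hl => factorMatrix_congr (fun _ => rfl) fun h' => ?_, ?_⟩
    · refine (Function.update_of_ne (fun he => ?_) _ _).symm
      have := congrArg (fun x => x.1.val) he
      simp only at this
      omega
    · rw [factorMatrix_minus _ hx hp h0 hmin, hm]
      simp only [Function.update_self]
      exact toFlag_mul_xMat_sDot_inv _ i m

/-- Every flag of the Deodhar cell is in the image of the parametrization. -/
theorem IsFlagChain.exists_params (D : DistinguishedData a V U)
    (hreg : IsRegularWord a (wordProd V) V) {y : ℕ → GL (Fin n) ℂ} (h : IsFlagChain a V U y) :
    ∃ t : Params a V U, toFlag (cellMatrix a V U t) = toFlag (y V.length) := by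
  suffices hK : ∀ K ≤ V.length, ∃ t : Params a V U, toFlag (partialMatrix a V U t K) =
      toFlag (y K) by
    obtain ⟨t, ht⟩ := hK V.length le_rfl
    exact ⟨t, partialMatrix_length t ▸ ht⟩
  intro K
  induction K with
  | zero => exact fun _ => ⟨(1, 0), h.zero.symm⟩
  | succ K ih =>
    intro hK
    have hK' : K < V.length := hK
    obtain ⟨t, ht⟩ := ih hK'.le
    have hs := h.step K hK'
    rw [← ht] at hs
    cases hx : V[K] with
    | s i =>
      rw [hx] at hs
      obtain ⟨t', h1, h2⟩ := D.exists_params_step hK' hx t (D.invariant hreg t hK'.le)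
        (h.extremes (K + 1) hK) hs
      refine ⟨t', ?_⟩
      rw [partialMatrix_succ t' hK', ← partialMatrix_congr hK'.le h1 K le_rfl, h2]
    | bar =>
      rw [hx] at hs
      refine ⟨t, ?_⟩
      rw [partialMatrix_succ t hK', factorMatrix_bar t (j := ⟨K, hK'⟩) hx, mul_one]
      exact hs
    | one => exact absurd hx (D.asc.isTiltedWord.ne_one hK')

theorem DistinguishedData.range_toFlag (D : DistinguishedData a V U)
    (huv : TiltedLE a (wordProd U) (wordProd V)) (hreg : IsRegularWord a (wordProd V) V) :
    Set.range (fun t : Params a V U => toFlag (cellMatrix a V U t)) = deodharCell a V U := by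
  ext F
  rw [D.mem_deodharCell_iff huv]
  constructor
  · rintro ⟨t, rfl⟩
    exact ⟨_, isFlagChain_partialMatrix D hreg t, by rw [partialMatrix_length]⟩
  · rintro ⟨y, hy, rfl⟩
    exact hy.exists_params D hreg

end

section

/-! ### Rational functions of a system of coordinates -/

/-- The functions that are quotients of polynomials in the coordinates `c`, the denominator having
no zeros. -/
def ratFns {X σ : Type*} (c : X → σ → ℂ) : Subalgebra ℂ (X → ℂ) where
  carrier := {f | ∃ P Q : MvPolynomial σ ℂ, ∀ x, MvPolynomial.eval (c x) Q ≠ 0 ∧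
    f x = MvPolynomial.eval (c x) P / MvPolynomial.eval (c x) Q}
  mul_mem' := by
    rintro f g ⟨P, Q, h⟩ ⟨P', Q', h'⟩
    refine ⟨P * P', Q * Q', fun x => ?_⟩
    rw [map_mul, map_mul, Pi.mul_apply, (h x).2, (h' x).2]
    exact ⟨mul_ne_zero (h x).1 (h' x).1, div_mul_div_comm _ _ _ _⟩
  add_mem' := by
    rintro f g ⟨P, Q, h⟩ ⟨P', Q', h'⟩
    refine ⟨P * Q' + Q * P', Q * Q', fun x => ?_⟩
    simp only [map_mul, map_add, Pi.add_apply]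
    rw [(h x).2, (h' x).2]
    exact ⟨mul_ne_zero (h x).1 (h' x).1, div_add_div _ _ (h x).1 (h' x).1⟩
  algebraMap_mem' r := ⟨MvPolynomial.C r, 1, fun x => by simp⟩

section

variable {X σ : Type*} {c : X → σ → ℂ}

theorem coord_mem_ratFns (i : σ) : (fun x => c x i) ∈ ratFns c :=
  ⟨MvPolynomial.X i, 1, fun x => by simp⟩

theorem inv_mem_ratFns {f : X → ℂ} (hf : f ∈ ratFns c) (h0 : ∀ x, f x ≠ 0) :
    (fun x => (f x)⁻¹) ∈ ratFns c := by
  obtain ⟨P, Q, h⟩ := hf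
  refine ⟨Q, P, fun x => ⟨fun hP => h0 x ?_, ?_⟩⟩
  · rw [(h x).2, hP, zero_div]
  · simp only [(h x).2, inv_div]

theorem div_mem_ratFns {f g : X → ℂ} (hf : f ∈ ratFns c) (hg : g ∈ ratFns c)
    (h0 : ∀ x, g x ≠ 0) : (fun x => f x / g x) ∈ ratFns c := by
  have := (ratFns c).mul_mem hf (inv_mem_ratFns hg h0)
  have h : (fun x => f x / g x) = f * fun x => (g x)⁻¹ := by
    ext x
    rw [Pi.mul_apply, div_eq_mul_inv]
  rwa [h]

variable {R : Subalgebra ℂ (X → ℂ)}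

theorem const_mem (r : ℂ) : (fun _ : X => r) ∈ R := R.algebraMap_mem r

theorem finset_sum_mem {ι : Type*} {s : Finset ι} {f : ι → X → ℂ} (h : ∀ i ∈ s, f i ∈ R) :
    (fun x => ∑ i ∈ s, f i x) ∈ R := by
  have : (fun x => ∑ i ∈ s, f i x) = ∑ i ∈ s, f i := by
    ext x
    rw [Finset.sum_apply]
  rw [this]
  exact R.sum_mem h

theorem finset_prod_mem {ι : Type*} {s : Finset ι} {f : ι → X → ℂ} (h : ∀ i ∈ s, f i ∈ R) :
    (fun x => ∏ i ∈ s, f i x) ∈ R := by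
  have : (fun x => ∏ i ∈ s, f i x) = ∏ i ∈ s, f i := by
    ext x
    rw [Finset.prod_apply]
  rw [this]
  exact R.prod_mem h

theorem eval_mem {τ : Type*} {d : X → τ → ℂ} (hd : ∀ i, (fun x => d x i) ∈ R)
    (P : MvPolynomial τ ℂ) : (fun x => MvPolynomial.eval (d x) P) ∈ R := by
  induction P using MvPolynomial.induction_on with
  | C r =>
    simp only [MvPolynomial.eval_C]
    exact const_mem r
  | add p q hp hq =>
    simp only [map_add]
    exact R.add_mem hp hq
  | mul_X p i hp =>
    simp only [map_mul, MvPolynomial.eval_X]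
    exact R.mul_mem hp (hd i)

/-- The entries of the matrix valued function `A` belong to `R`. -/
def EntriesIn {m m' : Type*} (R : Subalgebra ℂ (X → ℂ)) (A : X → Matrix m m' ℂ) : Prop :=
  ∀ r s, (fun x => A x r s) ∈ R

theorem EntriesIn.mul {m m' m'' : Type*} [Fintype m'] {A : X → Matrix m m' ℂ}
    {B : X → Matrix m' m'' ℂ} (hA : EntriesIn R A) (hB : EntriesIn R B) :
    EntriesIn R fun x => A x * B x := by
  intro r s
  simp only [Matrix.mul_apply]
  exact finset_sum_mem fun k _ => R.mul_mem (hA r k) (hB k s)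

theorem EntriesIn.const {m m' : Type*} (A : Matrix m m' ℂ) : EntriesIn R fun _ => A :=
  fun _ _ => const_mem _

theorem EntriesIn.det {m : Type*} [Fintype m] [DecidableEq m] {A : X → Matrix m m ℂ}
    (hA : EntriesIn R A) : (fun x => (A x).det) ∈ R := by
  simp only [Matrix.det_apply']
  exact finset_sum_mem fun σ _ => R.mul_mem (const_mem _) (finset_prod_mem fun i _ => hA _ _)

theorem EntriesIn.adjugate {m : Type*} [Fintype m] [DecidableEq m] {A : X → Matrix m m ℂ}
    (hA : EntriesIn R A) : EntriesIn R fun x => (A x).adjugate := by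
  intro r s
  simp only [Matrix.adjugate_apply]
  refine EntriesIn.det fun r' s' => ?_
  by_cases h : r' = s
  · subst h
    simp only [Matrix.updateRow_self]
    exact const_mem _
  · simp only [Matrix.updateRow_ne h]
    exact hA r' s'

variable {n : ℕ}

theorem EntriesIn.inv {z : X → GL (Fin n) ℂ}
    (hz : EntriesIn (ratFns c) fun x => (z x : Matrix (Fin n) (Fin n) ℂ)) :
    EntriesIn (ratFns c) fun x => ((z x)⁻¹ : GL (Fin n) ℂ).val := by
  intro r s
  simp only [Matrix.coe_units_inv, Matrix.inv_def, Matrix.smul_apply, smul_eq_mul,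
    Ring.inverse_eq_inv']
  refine (ratFns c).mul_mem (inv_mem_ratFns hz.det fun x => ?_) (hz.adjugate r s)
  exact ((Matrix.isUnit_iff_isUnit_det _).1 (z x).isUnit).ne_zero

theorem EntriesIn.phi {A : X → Matrix (Fin 2) (Fin 2) ℂ} (hA : EntriesIn R A) (i : Fin (n - 1)) :
    EntriesIn R fun x => TiltedDeodhar.phi i (A x) := by
  intro r s
  simp only [TiltedDeodhar.phi, Matrix.of_apply]
  split_ifs
  · exact hA _ _
  · exact hA _ _
  · exact hA _ _
  · exact hA _ _
  · exact const_mem _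
  · exact const_mem _

theorem EntriesIn.flagMinor {g : X → GL (Fin n) ℂ}
    (hg : EntriesIn R fun x => (g x : Matrix (Fin n) (Fin n) ℂ)) (k : Fin n) (r : Fin n → Fin n) :
    (fun x => TiltedDeodhar.flagMinor (g x) k r) ∈ R :=
  EntriesIn.det (A := fun x => ((g x : Matrix (Fin n) (Fin n) ℂ).submatrix
    (fun j : {j : Fin n // j ≤ k} => r j.val) fun j : {j : Fin n // j ≤ k} => j.val))
    fun _ _ => hg _ _

theorem EntriesIn.canon {g : X → GL (Fin n) ℂ}
    (hg : EntriesIn (ratFns c) fun x => (g x : Matrix (Fin n) (Fin n) ℂ))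
    {w : Equiv.Perm (Fin n)} (hw : ∀ x k, TiltedDeodhar.flagMinor (g x) k w ≠ 0) :
    EntriesIn (ratFns c) fun x => TiltedDeodhar.canon w (g x) := fun _ k =>
  div_mem_ratFns (hg.flagMinor k _) (hg.flagMinor k w) fun x => hw x k

end

/-! ### The parameters are rational functions of the flag -/

variable {n : ℕ} [NeZero n]
variable {a : Fin n → Fin n} {V U : List (Factor n)}

/-- The coordinates of the chart `Δ_w ≠ 0` of the flag variety: the entries of the canonical
matrix. -/
noncomputable def canonCoord {n : ℕ} (w : Equiv.Perm (Fin n)) (g : GL (Fin n) ℂ)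
    (ij : Fin n × Fin n) : ℂ := canon w g ij.1 ij.2

theorem HasExtremes.flagMinor_ne_zero {n : ℕ} {u v : Equiv.Perm (Fin n)} {b : Fin n → Fin n}
    {g : GL (Fin n) ℂ} (h : HasExtremes u v b g) (k : Fin n) : flagMinor g k v ≠ 0 :=
  flagMinor_ne_zero_of_leads (h k).1

/-- Going down a simple step of an ascending word: the previous flag is obtained by right
multiplication of the canonical matrix with `ṡ_i`. -/
theorem HasExtremes.toFlag_mul_sDot {b : Fin n → Fin n} {x v x' : Equiv.Perm (Fin n)}
    {i : Fin (n - 1)} (hi : lo i ∉ jumps b) (hsim : TiltedSim b x v) {z z' C : GL (Fin n) ℂ}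
    (hz : HasExtremes x v b z)
    (hz' : HasExtremes x' (v * Equiv.swap (lo i) (TiltedDeodhar.hi i)) b z')
    (hlt : keyUp (b (lo i)) (v (lo i)) < keyUp (b (lo i)) (v (TiltedDeodhar.hi i)))
    (hnb : IsNeighbor i z z')
    (hC : (C : Matrix (Fin n) (Fin n) ℂ) =
      canon (v * Equiv.swap (lo i) (TiltedDeodhar.hi i)) z') (hC' : toFlag C = toFlag z') :
    toFlag z = toFlag (C * sDot i) := by
  have hnb' : IsNeighbor i z (C * sDot i) :=
    hnb.trans ((isNeighbor_of_toFlag_eq i hC'.symm).trans (isNeighbor_mul_phi C (sDot_coe i)))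
  have hz1 := (hz.leadsAround hi hsim).1
  refine hz1.unique (keyUp_injective _) hnb' hlt ?_
  have h0 := hz1.1
  rw [hnb' i.val (by omega)] at h0
  have hcol : (fun r => ((C * sDot i : GL (Fin n) ℂ) : Matrix (Fin n) (Fin n) ℂ) r (lo i)) =
      fun r => (C : Matrix (Fin n) (Fin n) ℂ) r (TiltedDeodhar.hi i) := by
    ext r
    rw [Units.val_mul, sDot_coe, mul_phi_lo]
    simp
  have h1 := colSpan_succ ((C * sDot i : GL (Fin n) ℂ) : Matrix (Fin n) (Fin n) ℂ) (lo i)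
  rw [lo_val, hcol] at h1
  rw [h1, leads_sup_span (keyUp_injective _) (w := v (lo i)), h0, firstSet_lo_succ]
  · have h2 := (isCanonical_canon hz'.flagMinor_ne_zero (TiltedDeodhar.hi i)).1
    rw [mul_swap_hi] at h2
    rw [hC, h2]
    exact one_ne_zero
  · intro y hy
    by_contra hlt'
    have h2 := (mem_tiltedSchubertCell.1 hz'.mem_cells.1).2 (TiltedDeodhar.hi i) y
    rw [mul_swap_hi, apply_hi_eq hi] at h2
    rw [hC] at hy
    exact hy (h2 (not_le.1 hlt'))
  · rw [h0, apply_mem_firstSet, lo_val]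
    exact lt_irrefl _

/-- The canonical matrices of all flags of a chain are rational functions of the canonical matrix of
the last flag. -/
theorem DistinguishedData.canon_partialMatrix_mem (D : DistinguishedData a V U)
    (hreg : IsRegularWord a (wordProd V) V) {j : ℕ} (hj : j ≤ V.length) :
    EntriesIn (ratFns fun t : Params a V U => canonCoord (wordProd V) (cellMatrix a V U t))
      fun t => canon (prefixProd V j) (partialMatrix a V U t j) := by
  induction hj using Nat.decreasingInduction with
  | self =>
    intro r k
    simp only [prefixProd_length, partialMatrix_length]
    exact coord_mem_ratFns (c := fun t : Params a V U =>
      canonCoord (wordProd V) (cellMatrix a V U t)) (r, k)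
  | of_succ j hj ih =>
    cases hx : V[j] with
    | s i =>
      have hlo := D.asc.isTiltedWord.lo_notMem_jumps hj hx
      have hseq := seqAt_of_ne_bar a hj (by rw [hx]; simp)
      have hsim := D.sim_at hj.le
      rw [hseq] at hsim
      have he : ∀ t, HasExtremes _ _ _ (partialMatrix a V U t j) := fun t =>
        (D.invariant hreg t hj.le).1
      have he' : ∀ t, HasExtremes _ _ _ (partialMatrix a V U t (j + 1)) := fun t =>
        (D.invariant hreg t hj).1
      have hC : ∀ t, ∃ C : GL (Fin n) ℂ, (C : Matrix (Fin n) (Fin n) ℂ) =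
          canon (prefixProd V (j + 1)) (partialMatrix a V U t (j + 1)) ∧
          toFlag C = toFlag (partialMatrix a V U t (j + 1)) := fun t =>
        exists_canonical (he' t).flagMinor_ne_zero
      choose C hC hC' using hC
      have hflag : ∀ t, toFlag (partialMatrix a V U t j) = toFlag (C t * sDot i) := by
        intro t
        have h1 := he t
        have h2 := he' t
        have h3 := hC t
        rw [hseq] at h1
        rw [prefixProd_succ_s hj hx] at h2 h3
        refine h1.toFlag_mul_sDot hlo hsim h2 (D.asc.ascent hj hx) ?_ h3 (hC' t)
        obtain ⟨A, hA, -⟩ := D.exists_phi t hj hx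
        rw [partialMatrix_succ t hj]
        exact isNeighbor_mul_phi _ hA
      simp only [← hC] at ih
      have h := EntriesIn.canon (g := fun t => C t * sDot i)
        (by simpa only [Units.val_mul] using ih.mul (EntriesIn.const _))
        (w := prefixProd V j)
        fun t k => (flagMinor_ne_zero_congr (hflag t) k _).1 ((he t).flagMinor_ne_zero k)
      intro r k
      simpa only [canon_congr _ (hflag _)] using h r k
    | bar =>
      intro r k
      have h := ih r k
      simpa only [partialMatrix_succ _ hj, factorMatrix_bar _ (j := ⟨j, hj⟩) hx, mul_one,
        prefixProd_succ_bar hj hx] using h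
    | one => exact absurd hx (D.asc.isTiltedWord.ne_one hj)

theorem phi_mul_lo {n : ℕ} (i : Fin (n - 1)) (A : Matrix (Fin 2) (Fin 2) ℂ)
    (M : Matrix (Fin n) (Fin n) ℂ) (c : Fin n) :
    (phi i A * M) (lo i) c = A 0 0 * M (lo i) c + A 0 1 * M (hi i) c := by
  rw [Matrix.mul_apply, sum_eq_lo_add_hi i]
  · simp [phi, (lo_ne_hi i).symm]
  · intro k h1 h2
    simp [phi, lo_ne_hi i, h1, h2, h1.symm]

theorem phi_mul_hi {n : ℕ} (i : Fin (n - 1)) (A : Matrix (Fin 2) (Fin 2) ℂ)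
    (M : Matrix (Fin n) (Fin n) ℂ) (c : Fin n) :
    (phi i A * M) (hi i) c = A 1 0 * M (lo i) c + A 1 1 * M (hi i) c := by
  rw [Matrix.mul_apply, sum_eq_lo_add_hi i]
  · simp [phi, (lo_ne_hi i).symm]
  · intro k h1 h2
    simp [phi, (lo_ne_hi i).symm, h1, h2, h2.symm]

theorem diag_ne_zero_of_mem_borel {n : ℕ} {b : GL (Fin n) ℂ} (hb : b ∈ borel n) (k : Fin n) :
    (b : Matrix (Fin n) (Fin n) ℂ) k k ≠ 0 := by
  have h1 : (b : Matrix (Fin n) (Fin n) ℂ).det ≠ 0 :=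
    ((Matrix.isUnit_iff_isUnit_det _).1 b.isUnit).ne_zero
  have h2 : (b : Matrix (Fin n) (Fin n) ℂ).BlockTriangular id := hb
  rw [Matrix.det_of_isUpperTriangular h2] at h1
  exact Finset.prod_ne_zero_iff.1 h1 k (Finset.mem_univ k)

/-- If `zgB = CB` and `g` is in the `i`-th embedded `SL_2`, the first column of `g` can be read off,
up to a nonzero factor, from the matrix `z⁻¹C`. -/
theorem exists_column_eq {n : ℕ} {z g C : GL (Fin n) ℂ} {i : Fin (n - 1)}
    {A : Matrix (Fin 2) (Fin 2) ℂ} (hg : (g : Matrix (Fin n) (Fin n) ℂ) = phi i A)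
    (hC : toFlag C = toFlag (z * g)) :
    ∃ β : ℂ, β ≠ 0 ∧ ((z⁻¹ * C : GL (Fin n) ℂ) : Matrix (Fin n) (Fin n) ℂ) (lo i) (lo i) =
      A 0 0 * β ∧ ((z⁻¹ * C : GL (Fin n) ℂ) : Matrix (Fin n) (Fin n) ℂ) (hi i) (lo i) =
      A 1 0 * β := by
  have hb : (z * g)⁻¹ * C ∈ borel n := QuotientGroup.eq.1 hC.symm
  have h0 := mem_borel.1 hb (hi i) (lo i) (by rw [Fin.lt_def, lo_val, hi_val]; omega)
  refine ⟨_, diag_ne_zero_of_mem_borel hb (lo i), ?_⟩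
  have h1 : z⁻¹ * C = g * ((z * g)⁻¹ * C) := by group
  rw [h1, Units.val_mul g, hg, phi_mul_lo, phi_mul_hi, h0, mul_zero, mul_zero, add_zero, add_zero]
  exact ⟨rfl, rfl⟩

/-- If the partial product `z_j` depends rationally on the last flag, so do the parameter of the next
step, read off from the canonical matrix of the next flag, and with it `z_{j+1}`. -/
theorem DistinguishedData.params_mem_step (D : DistinguishedData a V U)
    (hreg : IsRegularWord a (wordProd V) V) {j : ℕ} (hj : j < V.length)
    (hz : EntriesIn (ratFns fun t : Params a V U => canonCoord (wordProd V) (cellMatrix a V U t))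
      fun t => (partialMatrix a V U t j : Matrix (Fin n) (Fin n) ℂ)) :
    (∀ h : (⟨j, hj⟩ : Fin V.length) ∈ JZero V U, (fun t : Params a V U => (t.1 ⟨⟨j, hj⟩, h⟩ : ℂ)) ∈
        ratFns fun t : Params a V U => canonCoord (wordProd V) (cellMatrix a V U t)) ∧
      (∀ h : (⟨j, hj⟩ : Fin V.length) ∈ JMinus a V U, (fun t : Params a V U => t.2 ⟨⟨j, hj⟩, h⟩) ∈
        ratFns fun t : Params a V U => canonCoord (wordProd V) (cellMatrix a V U t)) ∧
      EntriesIn (ratFns fun t : Params a V U => canonCoord (wordProd V) (cellMatrix a V U t))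
        fun t => (partialMatrix a V U t (j + 1) : Matrix (Fin n) (Fin n) ℂ) := by
  set R := ratFns fun t : Params a V U => canonCoord (wordProd V) (cellMatrix a V U t)
  cases hx : V[j] with
  | s i =>
    have hC : ∀ t, ∃ C : GL (Fin n) ℂ, (C : Matrix (Fin n) (Fin n) ℂ) =
        canon (prefixProd V (j + 1)) (partialMatrix a V U t (j + 1)) ∧
        toFlag C = toFlag (partialMatrix a V U t (j + 1)) := fun t =>
      exists_canonical (D.invariant hreg t hj).1.flagMinor_ne_zero
    choose C hC hC' using hC
    have hCR : EntriesIn R fun t => (C t : Matrix (Fin n) (Fin n) ℂ) := by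
      simp only [hC]
      exact D.canon_partialMatrix_mem hreg hj
    have hh : EntriesIn R fun t => ((partialMatrix a V U t j)⁻¹ * C t : GL (Fin n) ℂ).val := by
      simpa only [Units.val_mul] using (EntriesIn.inv hz).mul hCR
    have hh' : ∀ r s, (fun t => ((partialMatrix a V U t j)⁻¹ * C t : GL (Fin n) ℂ).val r s) ∈ R :=
      hh
    have hcol : ∀ t (A : Matrix (Fin 2) (Fin 2) ℂ),
        (factorMatrix a V U t ⟨j, hj⟩ : Matrix (Fin n) (Fin n) ℂ) = phi i A → _ := fun t A hA =>
      exists_column_eq (z := partialMatrix a V U t j) (C := C t) hA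
        ((hC' t).trans (by rw [partialMatrix_succ t hj]))
    have hsucc : ∀ {A : Params a V U → Matrix (Fin 2) (Fin 2) ℂ}, EntriesIn R A →
        (∀ t, (factorMatrix a V U t ⟨j, hj⟩ : Matrix (Fin n) (Fin n) ℂ) = phi i (A t)) →
        EntriesIn R fun t => (partialMatrix a V U t (j + 1) : Matrix (Fin n) (Fin n) ℂ) := by
      intro A hA hA'
      simp only [partialMatrix_succ _ hj, Units.val_mul, hA']
      exact hz.mul (hA.phi i)
    rcases D.mem_cases hj hx with ⟨h, hlt, hp⟩ | ⟨h, hlt, hp, h0⟩ | ⟨h, hlt, hp, h0, hm⟩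
    · refine ⟨fun h' => ?_, fun h' => ?_, ?_⟩
      · exact absurd h'.2 hp.2.2
      · have h1 := h'.2
        simp only [h] at h1
        exact absurd (mul_swap_tiltedLT_iff.1 h1) (lt_asymm hlt)
      · refine hsucc (A := fun _ => !![0, -1; 1, 0]) (EntriesIn.const _) fun t => ?_
        rw [factorMatrix_plus t hx hp, sDot_coe]
    · have hA : ∀ t, (factorMatrix a V U t ⟨j, hj⟩ : Matrix (Fin n) (Fin n) ℂ) =
          phi i !![1, 0; (t.1 ⟨⟨j, hj⟩, h0⟩ : ℂ), 1] := fun t => by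
        rw [factorMatrix_zero t hx hp h0, yMat_coe]
      have hpar : (fun t : Params a V U => (t.1 ⟨⟨j, hj⟩, h0⟩ : ℂ)) ∈ R := by
        have h1 := div_mem_ratFns (hh' (hi i) (lo i)) (hh' (lo i) (lo i)) (fun t => by
          obtain ⟨β, hβ, h1, h2⟩ := hcol t _ (hA t)
          rw [h1]
          simpa using hβ)
        convert h1 using 2 with t
        obtain ⟨β, hβ, h1, h2⟩ := hcol t _ (hA t)
        rw [h1, h2]
        simp [hβ]
      refine ⟨fun _ => hpar, fun h' => absurd h.symm h'.2.2.symm, hsucc ?_ hA⟩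
      intro r s
      fin_cases r <;> fin_cases s
      · exact const_mem _
      · exact const_mem _
      · exact hpar
      · exact const_mem _
    · have hA : ∀ t, (factorMatrix a V U t ⟨j, hj⟩ : Matrix (Fin n) (Fin n) ℂ) =
          phi i !![-t.2 ⟨⟨j, hj⟩, hm⟩, 1; -1, 0] := fun t => by
        rw [factorMatrix_minus t hx hp h0 hm, xMat_mul_sDot_inv_coe]
      have hpar : (fun t : Params a V U => t.2 ⟨⟨j, hj⟩, hm⟩) ∈ R := by
        have h1 := div_mem_ratFns (hh' (lo i) (lo i)) (hh' (hi i) (lo i)) (fun t => by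
          obtain ⟨β, hβ, h1, h2⟩ := hcol t _ (hA t)
          rw [h2]
          simpa using hβ)
        convert h1 using 2 with t
        obtain ⟨β, hβ, h1, h2⟩ := hcol t _ (hA t)
        rw [h1, h2]
        simp [hβ]
      refine ⟨fun h' => absurd h' h0, fun _ => hpar, hsucc ?_ hA⟩
      intro r s
      fin_cases r <;> fin_cases s
      · exact R.neg_mem hpar
      · exact const_mem _
      · exact const_mem _
      · exact const_mem _
  | bar =>
    refine ⟨fun h => ?_, fun h => ?_, ?_⟩
    · obtain ⟨i, hi⟩ := h.1
      simp [hx] at hi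
    · obtain ⟨i, hi⟩ := h.1
      simp [hx] at hi
    · simpa only [partialMatrix_succ _ hj, factorMatrix_bar _ (j := ⟨j, hj⟩) hx, mul_one] using hz
  | one => exact absurd hx (D.asc.isTiltedWord.ne_one hj)

theorem DistinguishedData.partialMatrix_mem (D : DistinguishedData a V U)
    (hreg : IsRegularWord a (wordProd V) V) : ∀ j ≤ V.length,
    EntriesIn (ratFns fun t : Params a V U => canonCoord (wordProd V) (cellMatrix a V U t))
      fun t => (partialMatrix a V U t j : Matrix (Fin n) (Fin n) ℂ) := by
  intro j
  induction j with
  | zero =>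
    intro _
    simp only [partialMatrix_zero]
    exact EntriesIn.const _
  | succ j ih => exact fun hj => (D.params_mem_step hreg hj (ih (Nat.le_of_succ_le hj))).2.2

/-- The coordinates on the parameter space. -/
def paramCoord (t : Params a V U) : JZero V U ⊕ JMinus a V U → ℂ :=
  Sum.elim (fun i => (t.1 i : ℂ)) t.2

theorem DistinguishedData.paramCoord_mem (D : DistinguishedData a V U)
    (hreg : IsRegularWord a (wordProd V) V) (i : JZero V U ⊕ JMinus a V U) :
    (fun t : Params a V U => paramCoord t i) ∈
      ratFns fun t : Params a V U => canonCoord (wordProd V) (cellMatrix a V U t) := by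
  rcases i with ⟨j, h⟩ | ⟨j, h⟩
  · exact (D.params_mem_step hreg j.isLt (D.partialMatrix_mem hreg j j.isLt.le)).1 h
  · exact (D.params_mem_step hreg j.isLt (D.partialMatrix_mem hreg j j.isLt.le)).2.1 h

/-- The parameters of a point are functions of its flag. -/
theorem DistinguishedData.toFlag_injective (D : DistinguishedData a V U)
    (hreg : IsRegularWord a (wordProd V) V) :
    Function.Injective fun t : Params a V U => toFlag (cellMatrix a V U t) := by
  intro t t' htt
  have h : ∀ i, paramCoord t i = paramCoord t' i := by
    intro i
    obtain ⟨P, Q, hPQ⟩ := D.paramCoord_mem hreg i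
    have h1 := (hPQ t).2
    have h2 := (hPQ t').2
    have h3 : canonCoord (wordProd V) (cellMatrix a V U t) =
        canonCoord (wordProd V) (cellMatrix a V U t') := by
      ext ij
      exact congrFun (congrFun (canon_congr _ htt) ij.1) ij.2
    simp only at h1 h2
    rw [h1, h2, h3]
  refine Prod.ext (funext fun i => Units.ext (h (Sum.inl i))) (funext fun i => h (Sum.inr i))

theorem factorMatrix_mem (j : Fin V.length) :
    EntriesIn (ratFns (paramCoord (a := a) (V := V) (U := U)))
      fun t => (factorMatrix a V U t j : Matrix (Fin n) (Fin n) ℂ) := by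
  have h0 : ∀ h : j ∈ JZero V U, (fun t : Params a V U => (t.1 ⟨j, h⟩ : ℂ)) ∈
      ratFns (paramCoord (a := a) (V := V) (U := U)) := fun h =>
    coord_mem_ratFns (c := paramCoord) (Sum.inl ⟨j, h⟩)
  have h1 : ∀ h : j ∈ JMinus a V U, (fun t : Params a V U => t.2 ⟨j, h⟩) ∈
      ratFns (paramCoord (a := a) (V := V) (U := U)) := fun h =>
    coord_mem_ratFns (c := paramCoord) (Sum.inr ⟨j, h⟩)
  unfold factorMatrix
  split
  · split_ifs with h2 h3 h4
    · exact EntriesIn.const _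
    · simp only [yMat_coe]
      refine EntriesIn.phi (fun r s => ?_) _
      fin_cases r <;> fin_cases s
      · exact const_mem _
      · exact const_mem _
      · exact h0 h3
      · exact const_mem _
    · simp only [xMat_mul_sDot_inv_coe]
      refine EntriesIn.phi (fun r s => ?_) _
      fin_cases r <;> fin_cases s
      · exact Subalgebra.neg_mem _ (h1 h4)
      · exact const_mem _
      · exact const_mem _
      · exact const_mem _
    · exact EntriesIn.const _
  · exact EntriesIn.const _
  · exact EntriesIn.const _

/-- The product of the factors depends polynomially on the parameters. -/
theorem cellMatrix_mem :
    EntriesIn (ratFns (paramCoord (a := a) (V := V) (U := U)))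
      fun t => (cellMatrix a V U t : Matrix (Fin n) (Fin n) ℂ) := by
  suffices h : ∀ j ≤ V.length, EntriesIn (ratFns (paramCoord (a := a) (V := V) (U := U)))
      fun t => (partialMatrix a V U t j : Matrix (Fin n) (Fin n) ℂ) by
    simpa only [partialMatrix_length] using h V.length le_rfl
  intro j
  induction j with
  | zero =>
    intro _
    simp only [partialMatrix_zero]
    exact EntriesIn.const _
  | succ j ih =>
    intro hj
    have hj' : j < V.length := hj
    simp only [partialMatrix_succ _ hj', Units.val_mul]
    exact (ih hj'.le).mul (factorMatrix_mem _)

end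

section

/-! ### Open sets and regular functions -/

section

variable {X Y σ τ : Type*} {c : X → σ → ℂ} {d : Y → τ → ℂ}

/-- The principal open sets are a basis and not only a subbasis, as they are closed under
intersections. -/
theorem isTopologicalBasis_affineStructure (c : X → σ → ℂ) :
    @TopologicalSpace.IsTopologicalBasis X (affineStructure c).top
      {S | ∃ Q : MvPolynomial σ ℂ, S = {x | MvPolynomial.eval (c x) Q ≠ 0}} := by
  let _ : TopologicalSpace X := (affineStructure c).top
  refine ⟨?_, ?_, rfl⟩
  · rintro _ ⟨P, rfl⟩ _ ⟨Q, rfl⟩ x hx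
    refine ⟨_, ⟨P * Q, rfl⟩, ?_, fun y hy => ?_⟩
    · rw [Set.mem_ofPred_eq, map_mul]
      exact mul_ne_zero hx.1 hx.2
    · rw [Set.mem_ofPred_eq, map_mul] at hy
      exact ⟨left_ne_zero_of_mul hy, right_ne_zero_of_mul hy⟩
  · exact Set.eq_univ_of_forall fun x =>
      Set.mem_sUnion.2 ⟨_, ⟨1, rfl⟩, by simp⟩

theorem isOpen_ne_zero {f : X → ℂ} (hf : f ∈ ratFns c) :
    IsOpen[(affineStructure c).top] {x | f x ≠ 0} := by
  obtain ⟨P, Q, h⟩ := hf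
  have : {x | f x ≠ 0} = {x | MvPolynomial.eval (c x) P ≠ 0} := by
    ext x
    rw [Set.mem_ofPred_eq, Set.mem_ofPred_eq, (h x).2, ne_eq, div_eq_zero_iff, not_or]
    exact and_iff_left (h x).1
  rw [this]
  exact TopologicalSpace.isOpen_generateFrom_of_mem ⟨P, rfl⟩

theorem isOpen_preimage_affineStructure {φ : X → Y} (hφ : ∀ i, (fun x => d (φ x) i) ∈ ratFns c)
    {S : Set Y} (hS : IsOpen[(affineStructure d).top] S) :
    IsOpen[(affineStructure c).top] (φ ⁻¹' S) := by
  let _ : TopologicalSpace X := (affineStructure c).top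
  let _ : TopologicalSpace Y := (affineStructure d).top
  have hc : Continuous φ := by
    refine continuous_generateFrom_iff.2 ?_
    rintro _ ⟨Q, rfl⟩
    exact isOpen_ne_zero (eval_mem (R := ratFns c) hφ Q)
  exact hS.preimage hc

/-- A local expression as a quotient of functions from `ratFns` suffices for regularity. -/
theorem regular_affineStructure {S : Set X} {f : X → ℂ}
    (h : ∀ x ∈ S, ∃ T, IsOpen[(affineStructure c).top] T ∧ x ∈ T ∧ ∃ p ∈ ratFns c, ∃ q ∈ ratFns c,
      q x ≠ 0 ∧ ∀ y ∈ S ∩ T, q y ≠ 0 → f y = p y / q y) : (affineStructure c).regular S f := by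
  intro x hx
  obtain ⟨T, hT, hxT, p, ⟨P, P', hP⟩, q, ⟨Q, Q', hQ⟩, hqx, hf⟩ := h x hx
  obtain ⟨_, ⟨B, rfl⟩, hxB, hBT⟩ :=
    @TopologicalSpace.IsTopologicalBasis.exists_subset_of_mem_open X (affineStructure c).top _
      (isTopologicalBasis_affineStructure c) x T hxT hT
  refine ⟨P * Q' * B, Q * P' * B, ?_, fun y hy hyQ => ?_⟩
  · rw [(hQ x).2] at hqx
    rw [map_mul, map_mul]
    exact mul_ne_zero (mul_ne_zero (fun h0 => hqx (by rw [h0, zero_div])) (hP x).1) hxB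
  · rw [map_mul, map_mul] at hyQ
    have hB := right_ne_zero_of_mul hyQ
    have hQy := left_ne_zero_of_mul (left_ne_zero_of_mul hyQ)
    have hqy : q y ≠ 0 := by
      rw [(hQ y).2]
      exact div_ne_zero hQy (hQ y).1
    rw [hf y ⟨hy, hBT hB⟩ hqy, (hP y).2, (hQ y).2, div_div_div_eq]
    simp only [map_mul]
    rw [mul_div_mul_right _ _ hB, mul_comm (MvPolynomial.eval (c y) P')]

end

variable {n : ℕ}

/-- The entries of a matrix as coordinates on `GL_n`. -/
def entryCoord (g : GL (Fin n) ℂ) (ij : Fin n × Fin n) : ℂ :=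
  (g : Matrix (Fin n) (Fin n) ℂ) ij.1 ij.2

/-- On the chart `Δ_w ≠ 0`, polynomials in the canonical coordinates are rational functions of the
matrix entries. The numerator and the denominator are given on the whole of `GL_n`, but the
denominator is only claimed not to vanish on the chart. -/
theorem exists_eval_canonCoord_eq (w : Equiv.Perm (Fin n)) (P : MvPolynomial (Fin n × Fin n) ℂ) :
    ∃ p ∈ ratFns (entryCoord (n := n)), ∃ q ∈ ratFns (entryCoord (n := n)),
      ∀ g : GL (Fin n) ℂ, (∀ k, flagMinor g k w ≠ 0) →
        q g ≠ 0 ∧ MvPolynomial.eval (canonCoord w g) P = p g / q g := by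
  let X := {g : GL (Fin n) ℂ // ∀ k, flagMinor g k w ≠ 0}
  have hent : EntriesIn (ratFns fun x : X => entryCoord x.val)
      fun x : X => (x.val : Matrix (Fin n) (Fin n) ℂ) := fun r k =>
    coord_mem_ratFns (c := fun x : X => entryCoord x.val) (r, k)
  have h := eval_mem (R := ratFns fun x : X => entryCoord x.val)
    (d := fun x : X => canonCoord w x.val)
    (fun ij => hent.canon (w := w) (fun x => x.property) ij.1 ij.2) P
  obtain ⟨A, B, hAB⟩ := h
  have hc : ∀ i, (fun g : GL (Fin n) ℂ => entryCoord g i) ∈ ratFns (entryCoord (n := n)) :=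
    fun i => coord_mem_ratFns i
  exact ⟨_, eval_mem hc A, _, eval_mem hc B, fun g hg => hAB ⟨g, hg⟩⟩

/-- The part of the chart `Δ_w ≠ 0` of the flag variety where a polynomial in the canonical
coordinates does not vanish. -/
def chartOpen (w : Equiv.Perm (Fin n)) (P : MvPolynomial (Fin n × Fin n) ℂ) : Set (Flag n) :=
  {F | ∃ g, toFlag g = F ∧ (∀ k, flagMinor g k w ≠ 0) ∧ MvPolynomial.eval (canonCoord w g) P ≠ 0}

theorem canonCoord_congr (w : Equiv.Perm (Fin n)) {g h : GL (Fin n) ℂ}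
    (hgh : toFlag g = toFlag h) : canonCoord w g = canonCoord w h := by
  ext ij
  exact congrFun (congrFun (canon_congr w hgh) ij.1) ij.2

theorem mem_chartOpen {w : Equiv.Perm (Fin n)} {P : MvPolynomial (Fin n × Fin n) ℂ}
    {g : GL (Fin n) ℂ} : toFlag g ∈ chartOpen w P ↔
      (∀ k, flagMinor g k w ≠ 0) ∧ MvPolynomial.eval (canonCoord w g) P ≠ 0 := by
  constructor
  · rintro ⟨h, hhg, h1, h2⟩
    rw [canonCoord_congr w hhg] at h2
    exact ⟨fun k => (flagMinor_ne_zero_congr hhg k _).1 (h1 k), h2⟩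
  · exact fun h => ⟨g, rfl, h⟩

theorem isOpen_chartOpen (w : Equiv.Perm (Fin n)) (P : MvPolynomial (Fin n × Fin n) ℂ) :
    IsOpen[(flagVariety n).top] (chartOpen w P) := by
  change IsOpen[(affineStructure (entryCoord (n := n))).top] (toFlag ⁻¹' chartOpen w P)
  obtain ⟨p, hp, q, -, h⟩ := exists_eval_canonCoord_eq w P
  have hent : EntriesIn (ratFns (entryCoord (n := n)))
      fun g : GL (Fin n) ℂ => (g : Matrix (Fin n) (Fin n) ℂ) := fun r k =>
    coord_mem_ratFns (c := entryCoord) (r, k)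
  have hΔ : (fun g : GL (Fin n) ℂ => ∏ k, flagMinor g k w) ∈ ratFns (entryCoord (n := n)) :=
    finset_prod_mem fun k _ => hent.flagMinor k w
  have heq : toFlag ⁻¹' chartOpen w P =
      {g : GL (Fin n) ℂ | (∏ k, flagMinor g k w) * p g ≠ 0} := by
    ext g
    rw [Set.mem_preimage, mem_chartOpen, Set.mem_ofPred_eq, mul_ne_zero_iff,
      Finset.prod_ne_zero_iff]
    simp only [Finset.mem_univ, true_imp_iff]
    refine and_congr_right fun hg => ?_
    obtain ⟨hq, hpq⟩ := h g hg
    rw [hpq, ne_eq, div_eq_zero_iff, not_or]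
    exact and_iff_left hq
  rw [heq]
  exact isOpen_ne_zero ((ratFns _).mul_mem hΔ hp)

/-- Quotients of polynomials in the canonical coordinates are regular functions. -/
theorem regular_chartOpen (w : Equiv.Perm (Fin n)) {P Q : MvPolynomial (Fin n × Fin n) ℂ}
    {h : Flag n → ℂ} (hh : ∀ g : GL (Fin n) ℂ, h (toFlag g) =
      MvPolynomial.eval (canonCoord w g) P / MvPolynomial.eval (canonCoord w g) Q) :
    (flagVariety n).regular (chartOpen w Q) h := by
  change (affineStructure (entryCoord (n := n))).regular (toFlag ⁻¹' chartOpen w Q) (h ∘ toFlag)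
  obtain ⟨p, hp, q, hq, h1⟩ := exists_eval_canonCoord_eq w P
  obtain ⟨p', hp', q', hq', h2⟩ := exists_eval_canonCoord_eq w Q
  refine regular_affineStructure fun g hg => ⟨Set.univ, ?_, Set.mem_univ _, fun g => p g * q' g,
    (ratFns _).mul_mem hp hq', fun g => q g * p' g, (ratFns _).mul_mem hq hp', ?_, ?_⟩
  · let _ : TopologicalSpace (GL (Fin n) ℂ) := (affineStructure (entryCoord (n := n))).top
    exact isOpen_univ
  · rw [Set.mem_preimage, mem_chartOpen] at hg
    have h3 := h2 g hg.1
    rw [h3.2] at hg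
    exact mul_ne_zero (h1 g hg.1).1 fun h0 => hg.2 (by rw [h0, zero_div])
  · rintro g ⟨hg, -⟩ -
    rw [Set.mem_preimage, mem_chartOpen] at hg
    rw [Function.comp_apply, hh, (h1 g hg.1).2, (h2 g hg.1).2, div_div_div_eq]

/-- A map into the flag variety given by rational functions, whose image lies in the chart
`Δ_w ≠ 0`, is an isomorphism onto its image if the coordinates of its source are rational functions
of the canonical coordinates. -/
theorem isIsomorphism_of_ratFns {X σ : Type*} {c : X → σ → ℂ} {D : Set (Flag n)} (e : X ≃ D)
    (z : X → GL (Fin n) ℂ) (he : ∀ t, (e t : Flag n) = toFlag (z t)) (w : Equiv.Perm (Fin n))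
    (hw : ∀ t k, flagMinor (z t) k w ≠ 0)
    (hz : EntriesIn (ratFns c) fun t => (z t : Matrix (Fin n) (Fin n) ℂ))
    (hc : ∀ i, (fun t => c t i) ∈ ratFns fun t => canonCoord w (z t)) :
    IsIsomorphism (affineStructure c) ((flagVariety n).restrict D) e := by
  have hz' : ∀ i, (fun t => entryCoord (z t) i) ∈ ratFns c := fun i => hz i.1 i.2
  have hpre : ∀ T : Set (Flag n), IsOpen[(flagVariety n).top] T →
      IsOpen[(affineStructure c).top] {t | toFlag (z t) ∈ T} := fun T hT =>
    isOpen_preimage_affineStructure (d := entryCoord (n := n)) (φ := z) hz'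
      (S := toFlag ⁻¹' T) hT
  constructor
  · intro S
    constructor
    · rintro ⟨T, hT, rfl⟩
      have h1 := hpre T hT
      have h2 : e ⁻¹' (Subtype.val ⁻¹' T) = {t | toFlag (z t) ∈ T} := by
        ext t
        rw [Set.mem_preimage, Set.mem_preimage, he, Set.mem_ofPred_eq]
      rw [h2]
      exact h1
    · intro hS
      let _ : TopologicalSpace D := ((flagVariety n).restrict D).top
      let _ : TopologicalSpace X := (affineStructure c).top
      have hsymm : Continuous e.symm := by
        refine continuous_generateFrom_iff.2 ?_
        rintro _ ⟨Q, rfl⟩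
        obtain ⟨P, P', hP⟩ := eval_mem (R := ratFns fun t => canonCoord w (z t)) hc Q
        beta_reduce at hP
        refine ⟨chartOpen w P, isOpen_chartOpen w P, ?_⟩
        ext y
        obtain ⟨t, rfl⟩ := e.surjective y
        rw [Set.mem_preimage, Set.mem_preimage, he, mem_chartOpen, Equiv.symm_apply_apply,
          Set.mem_ofPred_eq, (hP t).2, ne_eq, ne_eq, div_eq_zero_iff, not_or]
        exact ⟨fun h => ⟨h.2, (hP t).1⟩, fun h => ⟨hw t, h.1⟩⟩
      have h1 := hS.preimage hsymm
      rwa [← Set.preimage_comp, Equiv.self_comp_symm, Set.preimage_id] at h1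
  · intro S hS f
    constructor
    · intro hf
      refine regular_affineStructure fun t ht => ?_
      obtain ⟨W, h, hW, htW, hreg, hfh⟩ := hf (e t) ht
      rw [he] at htW
      obtain ⟨P, Q, hQ, hPQ⟩ := hreg (z t) htW
      refine ⟨_, hpre W hW, htW, _, eval_mem hz' P, _, eval_mem hz' Q, hQ, ?_⟩
      rintro t' ⟨ht', htW'⟩ hQ'
      have h1 := hfh (e t') ht' (by rw [he]; exact htW')
      rw [he] at h1
      exact h1.trans (hPQ (z t') htW' hQ')
    · intro hf y hy
      obtain ⟨t, rfl⟩ := e.surjective y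
      obtain ⟨P, Q, hQ, hPQ⟩ := hf t hy
      obtain ⟨P₁, P₂, hP⟩ := eval_mem (R := ratFns fun t => canonCoord w (z t)) hc P
      obtain ⟨Q₁, Q₂, hQ'⟩ := eval_mem (R := ratFns fun t => canonCoord w (z t)) hc Q
      beta_reduce at hP hQ'
      have hQ₁ : ∀ t, MvPolynomial.eval (c t) Q ≠ 0 ↔
          MvPolynomial.eval (canonCoord w (z t)) Q₁ ≠ 0 := by
        intro t
        rw [(hQ' t).2, ne_eq, div_eq_zero_iff, not_or]
        exact and_iff_left (hQ' t).1
      have hsurj : ∀ F : Flag n, ∃ g, toFlag g = F := QuotientGroup.mk_surjective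
      choose r hr using hsurj
      refine ⟨chartOpen w (P₂ * Q₁), fun F =>
        MvPolynomial.eval (canonCoord w (r F)) (P₁ * Q₂) /
          MvPolynomial.eval (canonCoord w (r F)) (P₂ * Q₁), isOpen_chartOpen w _, ?_,
        regular_chartOpen w fun g => by rw [canonCoord_congr w (hr (toFlag g))], ?_⟩
      · rw [he, mem_chartOpen, map_mul]
        exact ⟨hw t, mul_ne_zero (hP t).1 ((hQ₁ t).1 hQ)⟩
      · intro y' hy' hyW
        obtain ⟨t', rfl⟩ := e.surjective y'
        rw [he, mem_chartOpen, map_mul] at hyW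
        have h1 := hPQ t' hy' ((hQ₁ t').2 (right_ne_zero_of_mul hyW.2))
        have h2 := hr (e t' : Flag n)
        rw [he] at h2
        rw [Function.comp_apply] at h1
        rw [h1, he]
        beta_reduce
        rw [canonCoord_congr w h2, (hP t').2, (hQ' t').2, div_div_div_eq, map_mul, map_mul]

/-! ### The decomposition -/

/-- The parametrization of a Deodhar cell is an isomorphism. -/
theorem DistinguishedData.exists_equiv [NeZero n] {a : Fin n → Fin n} {V U : List (Factor n)}
    (D : DistinguishedData a V U) (huv : TiltedLE a (wordProd U) (wordProd V))
    (hreg : IsRegularWord a (wordProd V) V) :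
    ∃ e : Params a V U ≃ deodharCell a V U,
      IsIsomorphism (torusTimesAffine (JZero V U) (JMinus a V U))
        ((flagVariety n).restrict (deodharCell a V U)) e ∧
      ∀ t, (e t : Flag n) = toFlag (cellMatrix a V U t) := by
  let e : Params a V U ≃ deodharCell a V U :=
    (Equiv.ofInjective _ (D.toFlag_injective hreg)).trans (Equiv.setCongr (D.range_toFlag huv hreg))
  refine ⟨e, ?_, fun t => rfl⟩
  refine isIsomorphism_of_ratFns (c := paramCoord) e (cellMatrix a V U) (fun t => rfl) (wordProd V)
    (fun t k => ?_) cellMatrix_mem (D.paramCoord_mem hreg)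
  have h := (D.invariant hreg t le_rfl).1.flagMinor_ne_zero k
  rwa [partialMatrix_length, prefixProd_length] at h

end

end TiltedDeodhar

open TiltedDeodhar
theorem mainTheorem2 (n : ℕ) [NeZero n] (a : Fin n → Fin n) (u v : Equiv.Perm (Fin n))
    (huv : TiltedLesssim a u v) (V : List (Factor n)) (hV : IsTiltedReducedWord a v V)
    (hreg : IsRegularWord a v V) :
    openTiltedRichardson u v = (⋃ U ∈ {U | IsDistinguished a V U u}, deodharCell a V U) ∧
    {U | IsDistinguished a V U u}.PairwiseDisjoint (deodharCell a V) ∧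
    ∀ U, IsDistinguished a V U u →
      ∃ e : Params a V U ≃ deodharCell a V U,
        IsIsomorphism (torusTimesAffine (JZero V U) (JMinus a V U))
          ((flagVariety n).restrict (deodharCell a V U)) e ∧
        ∀ t, (e t : Flag n) = toFlag (cellMatrix a V U t) := by
  have hasc := hV.isAscendingWord
  obtain rfl : wordProd V = v := hV.1.2
  refine ⟨?_, ?_, ?_⟩
  · ext F
    obtain ⟨g, rfl⟩ : ∃ g, toFlag g = F := QuotientGroup.mk_surjective F
    simp only [Set.mem_iUnion, Set.mem_ofPred_eq, exists_prop, isDistinguished_iff hasc]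
    constructor
    · intro hF
      obtain ⟨U, hU, rfl, y, hy, hyg⟩ := exists_isFlagChain hasc huv.2
        ((mem_openTiltedRichardson huv.1).1 hF)
      exact ⟨U, ⟨hU, rfl⟩, (hU.mem_deodharCell_iff huv.1).2 ⟨y, hy, hyg⟩⟩
    · rintro ⟨U, ⟨_, rfl⟩, hF⟩
      exact hF.1
  · intro U hU U' hU' hne
    rw [Set.mem_ofPred_eq, isDistinguished_iff hasc] at hU hU'
    obtain ⟨D, rfl⟩ := hU
    obtain ⟨D', hprod⟩ := hU'
    refine Set.disjoint_left.2 fun F hF hF' => hne ?_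
    obtain ⟨y, hy, hyF⟩ := (D.mem_deodharCell_iff huv.1).1 hF
    obtain ⟨y', hy', hyF'⟩ := (D'.mem_deodharCell_iff (hprod ▸ huv.1)).1 hF'
    exact hy.subword_eq D D' hy' (hyF.trans hyF'.symm)
  · intro U hU
    obtain ⟨D, rfl⟩ := (isDistinguished_iff hasc).1 hU
    exact D.exists_equiv huv.1 hreg
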